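/- Let $d\ge 1$, $T>0$, $H\in(1/2,1)$ and $\alpha_H=H(2H-1)$. A (generalized) function $f$ on $\mathbb{R}^d$ is called a spatial covariance function if it is real and is the Fourier transform of a tempered measure $\mu$, i.e. $f(x)=\int_{\mathbb{R}^d} e^{-i\xi\cdot x}\,\mu(d\xi)$ in the sense of tempered distributions; expressions $\iint\varphi(x)f(x-y)\psi(y)\,dy\,dx$ are double integrals if $f$ is a function, and in general denote the pairing of $f$ with $w\mapsto\int\varphi(y+w)\psi(y)\,dy$. Let $\mathcal{HP}$ be the completion of $\mathcal{D}((0,T)\times\mathbb{R}^d)$ with respect to $$\langle\varphi,\psi\rangle_{\mathcal{HP}}=\alpha_H\int_0^T\!\!\int_0^T|u-v|^{2H-2}\int_{\mathbb{R}^d}\!\int_{\mathbb{R}^d}\varphi(u,x)f(x-y)\psi(v,y)\,dy\,dx\,dv\,du ,$$ where a function $\varphi$ is regarded as an element of $\mathcal{HP}$ if there are test functions $\varphi_n$ with $\|\varphi_n-\varphi\|_{\mathcal{HP}}\to 0$. Let $B=\{B(\varphi);\varphi\in\mathcal{D}((0,T)\times\mathbb{R}^d)\}$ be a zero-mean Gaussian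 process with $E(B(\varphi)B(\psi))=\langle\varphi,\psi\rangle_{\mathcal{HP}}$, extended by isometry (as an $L^2(\Omega)$-limit) to $\varphi\in\mathcal{HP}$. Let $G(t,x)=(4\pi t)^{-d/2}e^{-|x|^2/(4t)}$ for $t>0$ and $G(t,x)=0$ for $t\le 0$, let $g_{tx}(s,y)=G(t-s,x-y)$, $(\eta*\tilde G)(t,x)=\int_0^\infty\int_{\mathbb{R}^d}\eta(t+s,x+y)G(s,y)\,dy\,ds$, and $$I_{f,tx}(r,s)=\iint g_{tx}(s,y)f(y-z)g_{tx}(r,z)\,dy\,dz,\qquad J_f(u,v,y,z)=\iint G(u,y-x)f(x-x')G(v,z-x')\,dx\,dx'.$$ Suppose that there are constants $A_f,B_f,C_f>0$ and $\alpha_f<d$ such that $$A_f(2t-s-r)^{-(d-\alpha_f)/2}\le I_{f,tx}(r,s)\le B_f(2t-r-s)^{-(d-\alpha_f)/2}\quad\text{for all } t\in[0,T],\ r,s\in[0,t),\ x\in\mathbb{R}^d,$$ $$J_f(u,v,y,z)\le C_f(u+v)^{-(d-\alpha_f)/2}\quad\text{for all } u,v\in(0,T],\ y,z\in\mathbb{R}^d.$$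 Then $\eta*\tilde G\in\mathcal{HP}$ for every $\eta\in\mathcal{D}((0,T)\times\mathbb{R}^d)$, so that the distribution-valued solution $u(\eta)=B(\eta*\tilde G)$ of $u_t-\Delta u=\dot B$, $u(0,\cdot)=0$, is defined. There exists a jointly measurable process $X=\{X(t,x);t\in[0,T],x\in\mathbb{R}^d\}$ that is locally mean-square bounded (for every compact $K\subset\mathbb{R}^d$, $\sup_{t\in[0,T],x\in K}E|X(t,x)|^2<\infty$) and satisfies, for every $\eta\in\mathcal{D}((0,T)\times\mathbb{R}^d)$, $$u(\eta)=\int_0^T\int_{\mathbb{R}^d}X(t,x)\eta(t,x)\,dx\,dt\quad\text{a.s.},$$ if and only if $H>(d-\alpha_f)/4$. In this case $g_{tx}\in\mathcal{HP}$ for all $(t,x)\in[0,T]\times\mathbb{R}^d$; the process $X$ can be chosen as a modification of $u(t,x)=B(g_{tx})$, i.e. $X(t,x)=u(t,x)$ a.s. for every $(t,x)$; and every such $X$ satisfies $X(t,x)=u(t,x)$ a.s. for almost every $(t,x)\in[0,T]\times\mathbb{R}^d$. -/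

import Mathlib

open MeasureTheory ProbabilityTheory Set Filter Topology
open scoped SchwartzMap Distributions ENNReal NNReal

noncomputable section

namespace FracHeat

/-- The space `ℝ^d` with the Euclidean norm. -/
abbrev Space (d : ℕ) : Type := EuclideanSpace ℝ (Fin d)

/-! ### Spatial covariance functions and the spatial form -/

/-- A real (generalized) function `f` on `ℝ^d`, i.e. a continuous linear functional on the real
Schwartz functions, is a spatial covariance function if it is the Fourier transform of a tempered
measure `μ`, that is `f(x) = ∫ exp (-i ξ·x) μ(dξ)` in the sense of tempered distributions:
`⟨f, φ⟩ = ∫ (∫ exp (-i ξ·x) φ(x) dx) μ(dξ)`. -/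
def IsSpatialCovariance {d : ℕ} (f : 𝓢(Space d, ℝ) →L[ℝ] ℝ) : Prop :=
  ∃ μ : Measure (Space d), μ.HasTemperateGrowth ∧ ∀ φ : 𝓢(Space d, ℝ),
    ((f φ : ℝ) : ℂ) = ∫ ξ, (∫ x, Complex.exp (-Complex.I * (inner ℝ ξ x : ℝ)) * (φ x : ℂ)) ∂μ

/-- `K` is the cross-correlation `w ↦ ∫ φ(y + w) ψ(y) dy`, and it is a Schwartz function. -/
def IsCrossCorrelation {d : ℕ} (φ ψ : Space d → ℝ) (K : 𝓢(Space d, ℝ)) : Prop :=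
  ∀ w, Integrable (fun y => φ (y + w) * ψ y) ∧ K w = ∫ y, φ (y + w) * ψ y

open Classical in
/-- The spatial form `∫∫ φ(x) f(x - y) ψ(y) dy dx`. For a generalized function `f` this is the
pairing of `f` with the cross-correlation of `φ` and `ψ`; it is the double integral if `f` is
a function, see `spatialForm_eq_integral`. It is used only where the cross-correlation is
a Schwartz function, and set to `0` elsewhere. -/
def spatialForm {d : ℕ} (f : 𝓢(Space d, ℝ) →L[ℝ] ℝ) (φ ψ : Space d → ℝ) : ℝ :=
  if h : ∃ K, IsCrossCorrelation φ ψ K then f h.choose else 0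

theorem spatialForm_eq {d : ℕ} (f : 𝓢(Space d, ℝ) →L[ℝ] ℝ) {φ ψ : Space d → ℝ}
    {K : 𝓢(Space d, ℝ)} (hK : IsCrossCorrelation φ ψ K) : spatialForm f φ ψ = f K := by
  have h : ∃ K, IsCrossCorrelation φ ψ K := ⟨K, hK⟩
  have e : h.choose = K := by
    ext w
    rw [(h.choose_spec w).2, (hK w).2]
  rw [spatialForm, dif_pos h, e]

theorem spatialForm_eq_integral {d : ℕ} (f : 𝓢(Space d, ℝ) →L[ℝ] ℝ) (F : Space d → ℝ)
    (hF : ∀ K : 𝓢(Space d, ℝ), f K = ∫ w, F w * K w) {φ ψ : Space d → ℝ}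
    (hK : ∃ K, IsCrossCorrelation φ ψ K)
    (hint : Integrable (fun p : Space d × Space d => φ p.1 * F (p.1 - p.2) * ψ p.2)) :
    spatialForm f φ ψ = ∫ x, ∫ y, φ x * F (x - y) * ψ y := by
  obtain ⟨K, hK⟩ := hK
  have mp : MeasurePreserving (fun z : Space d × Space d => (z.1 + z.2, z.1))
      (volume.prod volume) (volume.prod volume) :=
    Measure.measurePreserving_swap.comp (measurePreserving_prod_add volume volume)
  have h2 : Integrable (fun z : Space d × Space d => φ (z.1 + z.2) * F z.2 * ψ z.1)
      (volume.prod volume) := by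
    have := mp.integrable_comp_of_integrable (g := fun p : Space d × Space d =>
      φ p.1 * F (p.1 - p.2) * ψ p.2) hint
    simpa [Function.comp_def] using this
  rw [spatialForm_eq f hK, hF K]
  have e1 : ∫ x, ∫ y, φ x * F (x - y) * ψ y = ∫ y, ∫ x, φ x * F (x - y) * ψ y :=
    integral_integral_swap hint
  have e2 : ∀ y, ∫ x, φ x * F (x - y) * ψ y = ∫ w, φ (y + w) * F w * ψ y := by
    intro y
    rw [← integral_add_left_eq_self (fun x => φ x * F (x - y) * ψ y) y]
    simp
  rw [e1]
  simp_rw [e2]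
  rw [integral_integral_swap (f := fun y w => φ (y + w) * F w * ψ y) h2]
  congr 1
  ext w
  rw [(hK w).2, ← integral_const_mul]
  congr 1
  ext y
  ring

/-! ### The heat kernel -/

/-- The fundamental solution `G` of the heat equation on `ℝ^d`. -/
def heatKernel (d : ℕ) (t : ℝ) (x : Space d) : ℝ :=
  if 0 < t then (4 * Real.pi * t) ^ (-((d : ℝ) / 2)) * Real.exp (-‖x‖ ^ 2 / (4 * t)) else 0

/-- `g_{tx}(s, y) = G(t - s, x - y)`. -/
def gKernel {d : ℕ} (t : ℝ) (x : Space d) (p : ℝ × Space d) : ℝ :=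
  heatKernel d (t - p.1) (x - p.2)

/-- `I_{f,tx}(r, s) = ∫∫ g_{tx}(s, y) f(y - z) g_{tx}(r, z) dy dz`. -/
def Iform {d : ℕ} (f : 𝓢(Space d, ℝ) →L[ℝ] ℝ) (t : ℝ) (x : Space d) (r s : ℝ) : ℝ :=
  spatialForm f (fun y => gKernel t x (s, y)) (fun z => gKernel t x (r, z))

/-- `J_f(u, v, y, z) = ∫∫ G(u, y - x) f(x - x') G(v, z - x') dx dx'`. -/
def Jform {d : ℕ} (f : 𝓢(Space d, ℝ) →L[ℝ] ℝ) (u v : ℝ) (y z : Space d) : ℝ :=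
  spatialForm f (fun x => heatKernel d u (y - x)) (fun x' => heatKernel d v (z - x'))

/-! ### The space `HP` of deterministic integrands -/

/-- The open set `(0, T) × ℝ^d`. -/
def domain (d : ℕ) (T : ℝ) : TopologicalSpace.Opens (ℝ × Space d) :=
  ⟨Ioo 0 T ×ˢ univ, isOpen_Ioo.prod isOpen_univ⟩

/-- The integrand `|u - v|^(2H-2) ∫∫ φ(u, x) f(x - y) ψ(v, y) dy dx` of the `HP` form. -/
def hpIntegrand {d : ℕ} (f : 𝓢(Space d, ℝ) →L[ℝ] ℝ) (H : ℝ) (φ ψ : ℝ × Space d → ℝ)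
    (p : ℝ × ℝ) : ℝ :=
  |p.1 - p.2| ^ (2 * H - 2) * spatialForm f (fun x => φ (p.1, x)) (fun y => ψ (p.2, y))

/-- The inner product of `HP`,
`α_H ∫_0^T ∫_0^T |u - v|^(2H-2) ∫∫ φ(u, x) f(x - y) ψ(v, y) dy dx dv du`, `α_H = H (2H - 1)`. -/
def hpForm {d : ℕ} (f : 𝓢(Space d, ℝ) →L[ℝ] ℝ) (H T : ℝ) (φ ψ : ℝ × Space d → ℝ) : ℝ :=
  H * (2 * H - 1) * ∫ p in Ioo 0 T ×ˢ Ioo 0 T, hpIntegrand f H φ ψ p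

/-- The integral that defines `‖φ‖²` in `HP` is meaningful and converges absolutely in time. -/
def HPFinite {d : ℕ} (f : 𝓢(Space d, ℝ) →L[ℝ] ℝ) (H T : ℝ) (φ : ℝ × Space d → ℝ) : Prop :=
  (∀ᵐ p : ℝ × ℝ ∂volume.restrict (Ioo 0 T ×ˢ Ioo 0 T),
    ∃ K, IsCrossCorrelation (fun x => φ (p.1, x)) (fun y => φ (p.2, y)) K) ∧
  IntegrableOn (hpIntegrand f H φ φ) (Ioo 0 T ×ˢ Ioo 0 T)

/-- The test functions `φn` converge to the function `φ` in the norm of `HP`. -/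
def HPTendsto {d : ℕ} (f : 𝓢(Space d, ℝ) →L[ℝ] ℝ) (H T : ℝ)
    (φn : ℕ → 𝓓(domain d T, ℝ)) (φ : ℝ × Space d → ℝ) : Prop :=
  (∀ n, HPFinite f H T (fun p => φn n p - φ p)) ∧
  Tendsto (fun n => hpForm f H T (fun p => φn n p - φ p) (fun p => φn n p - φ p)) atTop (𝓝 0)

/-- The function `φ` belongs to `HP`, the completion of the test functions. -/
def MemHP {d : ℕ} (f : 𝓢(Space d, ℝ) →L[ℝ] ℝ) (H T : ℝ) (φ : ℝ × Space d → ℝ) : Prop :=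
  ∃ φn : ℕ → 𝓓(domain d T, ℝ), HPTendsto f H T φn φ

/-! ### The noise and its stochastic integral -/

/-- `B` is a zero-mean Gaussian process indexed by the test functions on `(0, T) × ℝ^d`, with
covariance `E (B φ * B ψ) = ⟨φ, ψ⟩` in `HP`. -/
structure IsFractionalColoredNoise {d : ℕ} (f : 𝓢(Space d, ℝ) →L[ℝ] ℝ) (H T : ℝ)
    {Ω : Type*} [MeasurableSpace Ω] (P : Measure Ω) (B : 𝓓(domain d T, ℝ) → Ω → ℝ) : Prop where
  gaussian : IsGaussianProcess B P
  mean_zero : ∀ φ, ∫ ω, B φ ω ∂P = 0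
  covariance : ∀ φ ψ, ∫ ω, B φ ω * B ψ ω ∂P = hpForm f H T φ ψ

/-- `Y` is (a version of) the stochastic integral `B(φ)`: the `L²(Ω)`-limit of `B(φn)` for
test functions `φn` that converge to `φ` in `HP`. -/
def IsStochasticIntegral {d : ℕ} (f : 𝓢(Space d, ℝ) →L[ℝ] ℝ) (H T : ℝ)
    {Ω : Type*} [MeasurableSpace Ω] (P : Measure Ω) (B : 𝓓(domain d T, ℝ) → Ω → ℝ)
    (φ : ℝ × Space d → ℝ) (Y : Ω → ℝ) : Prop :=
  MemLp Y 2 P ∧ ∃ φn : ℕ → 𝓓(domain d T, ℝ), HPTendsto f H T φn φ ∧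
    Tendsto (fun n => eLpNorm (fun ω => B (φn n) ω - Y ω) 2 P) atTop (𝓝 0)

open Classical in
/-- The stochastic integral `B(φ)` of a function `φ` in `HP` (a version of it). -/
def stochasticIntegral {d : ℕ} (f : 𝓢(Space d, ℝ) →L[ℝ] ℝ) (H T : ℝ)
    {Ω : Type*} [MeasurableSpace Ω] (P : Measure Ω) (B : 𝓓(domain d T, ℝ) → Ω → ℝ)
    (φ : ℝ × Space d → ℝ) : Ω → ℝ :=
  if h : ∃ Y, IsStochasticIntegral f H T P B φ Y then h.choose else 0

/-! ### Solutions of the stochastic heat equation -/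

/-- `(η * G̃)(t, x) = ∫_0^∞ ∫ η(t + s, x + y) G(s, y) dy ds`. -/
def convReflected {d : ℕ} {T : ℝ} (η : 𝓓(domain d T, ℝ)) (p : ℝ × Space d) : ℝ :=
  ∫ s in Ioi (0 : ℝ), ∫ y, η (p.1 + s, p.2 + y) * heatKernel d s y

/-- The distribution-valued solution `u(η) = B(η * G̃)`. -/
def distributionSolution {d : ℕ} (f : 𝓢(Space d, ℝ) →L[ℝ] ℝ) (H T : ℝ)
    {Ω : Type*} [MeasurableSpace Ω] (P : Measure Ω) (B : 𝓓(domain d T, ℝ) → Ω → ℝ)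
    (η : 𝓓(domain d T, ℝ)) : Ω → ℝ :=
  stochasticIntegral f H T P B (convReflected η)

/-- The process solution `u(t, x) = B(g_{tx})`. -/
def processSolution {d : ℕ} (f : 𝓢(Space d, ℝ) →L[ℝ] ℝ) (H T : ℝ)
    {Ω : Type*} [MeasurableSpace Ω] (P : Measure Ω) (B : 𝓓(domain d T, ℝ) → Ω → ℝ)
    (t : ℝ) (x : Space d) : Ω → ℝ :=
  stochasticIntegral f H T P B (gKernel t x)

/-- `X = {X(t, x); t ∈ [0, T], x ∈ ℝ^d}` is jointly measurable, locally mean-square bounded, and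
represents the distribution-valued process `u`: for every test function `η`, almost surely
`u(η) = ∫_0^T ∫ X(t, x) η(t, x) dx dt`. Values of `X` at times outside `[0, T]` play no role. -/
structure Represents {d : ℕ} {T : ℝ} {Ω : Type*} [MeasurableSpace Ω] (P : Measure Ω)
    (u : 𝓓(domain d T, ℝ) → Ω → ℝ) (X : ℝ → Space d → Ω → ℝ) : Prop where
  measurable : Measurable (fun p : Icc (0 : ℝ) T × Space d × Ω => X p.1 p.2.1 p.2.2)
  locally_bounded : ∀ K : Set (Space d), IsCompact K →
    ∃ C : ℝ≥0, ∀ t ∈ Icc 0 T, ∀ x ∈ K, eLpNorm (X t x) 2 P ≤ C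
  represents : ∀ η : 𝓓(domain d T, ℝ), ∀ᵐ ω ∂P,
    u η ω = ∫ t in (0 : ℝ)..T, ∫ x, X t x ω * η (t, x)

end FracHeat

end

/-!
The proof takes place in the spectral domain. Let `f` be the Fourier transform of the tempered
measure `μ`. The time covariance `α_H |u - v|^(2H-2)` equals `∫ κ(u, w) κ(v, w) dw` with `κ(u, w) =
c |u - w|^(H-3/2)`, so that

  `⟨φ, ψ⟩ = ∫∫ Φ(w, ξ) conj Ψ(w, ξ) dw μ(dξ)`,  `Φ(w, ξ) = ∫_0^T κ(u, w) 𝓕φ(u, ·)(ξ) du`,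

whenever the integrals converge absolutely (`IsRegular`, `hpForm_eq_inner`). Hence `HP` is realized
isometrically in `L²(dw ⊗ μ(dξ))` by `embed`, and the stochastic integral becomes a continuous
linear map `V` into `L²(Ω)` that is isometric on the closure of the test functions
(`IsFractionalColoredNoise.exists_clm`, `stochasticIntegral_ae_eq`).

The Fourier transform of `g_{tx}(u, ·)` is `exp (-i ξ·x - (t - u)|ξ|²)`. Its phase does not depend
on `u`, so `‖g_{tx}‖²` is `α_H ∫∫ |u - v|^(2H-2) I_{f,tx}(u, v) du dv`, finite or not. By the bounds
on `I_f` it is comparable to `∫∫ |u - v|^(2H-2) (u + v)^(-(d-α)/2) du dv` over `(0, t)²`, where `u`,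
`v` are the times remaining until `t`. By homogeneity this is finite if and only if `(d - α)/2 <
2H`, and then it is bounded for `t ≤ T` (`lintegral_energy_lt_top`, `lintegral_energy_eq_top`).

* Membership in `HP`. Cut-offs, in time near `0` and `t` and then in space, approximate `g_{tx}` by
  test functions; dominated convergence applies to the Fourier transforms (`embed_mem_closure`). The
  same argument covers `η * G̃`, which is smooth with rapidly decaying slices.
* Sufficiency. If the energies are bounded, `B(g_{tx})` has a jointly measurable version `X`,
  because its distances from a countable dense family depend measurably on `(t, x)`. Since the
  representative of `η * G̃` is the average of those of `g_{tx}` with weight `η`, Fubini's theorem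
  shows that `B(η * G̃)` and `∫ X η` have the same integral over every event
  (`clm_convReflected_ae_eq`).
* Uniqueness. The difference of two representing processes has integral zero over products of a set
  in space-time and an event (`Represents.ae_unique`).
* Necessity. If `X` represents `u` and `η n` are probability densities that concentrate at `(T, 0)`,
  then `E |u(η n)|²` is bounded by Jensen's inequality, and it is the energy of `η n * G̃`, whose
  representative converges to that of `g_{T0}`. By Fatou's lemma `g_{T0}` has finite energy
  (`Represents.lintegral_absFeature_lt_top`).
-/

noncomputable section

namespace FracHeat

/-! ### The spatial Fourier transform -/

/-- The spatial Fourier transform `ξ ↦ ∫ exp (-i ξ·x) φ(x) dx` of a real function. -/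
def sft {d : ℕ} (φ : Space d → ℝ) (ξ : Space d) : ℂ :=
  ∫ x, Complex.exp (-Complex.I * (inner ℝ ξ x : ℝ)) * (φ x : ℂ)

section SpatialFourier

open FourierTransform

variable {d : ℕ}

theorem norm_exp_neg_I_mul (r : ℝ) : ‖Complex.exp (-Complex.I * (r : ℂ))‖ = 1 := by
  have : -Complex.I * (r : ℂ) = ((-r : ℝ) : ℂ) * Complex.I := by push_cast; ring
  rw [this, Complex.norm_exp_ofReal_mul_I]

theorem sft_eq_fourier (φ : Space d → ℝ) (ξ : Space d) :
    sft φ ξ = 𝓕 (fun x => (φ x : ℂ)) ((2 * Real.pi)⁻¹ • ξ) := by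
  rw [Real.fourier_eq', sft]
  congr 1
  ext x
  rw [smul_eq_mul, inner_smul_right, real_inner_comm]
  congr 2
  push_cast
  have : (Real.pi : ℂ) ≠ 0 := by exact_mod_cast Real.pi_ne_zero
  field_simp

theorem integrable_exp_mul {φ : Space d → ℝ} (hφ : Integrable φ) (ξ : Space d) :
    Integrable (fun x => Complex.exp (-Complex.I * (inner ℝ ξ x : ℝ)) * (φ x : ℂ)) := by
  refine hφ.ofReal.bdd_mul (c := 1) (by fun_prop) ?_
  exact Eventually.of_forall fun x => (norm_exp_neg_I_mul _).le

theorem sft_sub {φ ψ : Space d → ℝ} (hφ : Integrable φ) (hψ : Integrable ψ) (ξ : Space d) :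
    sft (fun x => φ x - ψ x) ξ = sft φ ξ - sft ψ ξ := by
  rw [sft, sft, sft, ← integral_sub (integrable_exp_mul hφ ξ) (integrable_exp_mul hψ ξ)]
  congr 1
  ext x
  push_cast
  ring

theorem sft_const_mul (c : ℝ) (φ : Space d → ℝ) (ξ : Space d) :
    sft (fun x => c * φ x) ξ = c * sft φ ξ := by
  rw [sft, sft, ← integral_const_mul]
  congr 1
  ext x
  push_cast
  ring

/-- The cross-correlation of two Schwartz functions is a Schwartz function, and its Fourier
transform is the product of the Fourier transform of one with the conjugate of the other. -/
theorem exists_isCrossCorrelation (φ ψ : 𝓢(Space d, ℝ)) :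
    ∃ K : 𝓢(Space d, ℝ), IsCrossCorrelation φ ψ K ∧
      ∀ ξ, sft K ξ = sft φ ξ * starRingEnd ℂ (sft ψ ξ) := by
  let toC : 𝓢(Space d, ℝ) →L[ℝ] 𝓢(Space d, ℂ) := SchwartzMap.postcompCLM Complex.ofRealCLM
  let neg : 𝓢(Space d, ℂ) →L[ℝ] 𝓢(Space d, ℂ) :=
    SchwartzMap.compCLMOfContinuousLinearEquiv ℝ (ContinuousLinearEquiv.neg ℝ)
  have toC_apply : ∀ (χ : 𝓢(Space d, ℝ)) x, toC χ x = (χ x : ℂ) := fun χ x => by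
    simp [toC]
  have neg_apply : ∀ (χ : 𝓢(Space d, ℂ)) x, neg χ x = χ (-x) := fun χ x => by
    simp [neg]
  let KC : 𝓢(Space d, ℂ) :=
    SchwartzMap.convolution (ContinuousLinearMap.mul ℂ ℂ) (neg (toC ψ)) (toC φ)
  let K : 𝓢(Space d, ℝ) := SchwartzMap.postcompCLM Complex.reCLM KC
  have hint : ∀ w, Integrable (fun y => φ (y + w) * ψ y) := fun w => by
    refine (ψ.integrable (μ := volume)).bdd_mul (c := SchwartzMap.seminorm ℝ 0 0 φ) ?_ ?_
    · exact (φ.continuous.comp (continuous_add_const w)).aestronglyMeasurable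
    · exact Eventually.of_forall fun y => φ.norm_le_seminorm ℝ _
  have hKC : ∀ w, KC w = ((∫ y, φ (y + w) * ψ y : ℝ) : ℂ) := fun w => by
    have h1 : KC w = ∫ t, (ψ (-t) : ℂ) * (φ (w - t) : ℂ) := by
      simp only [KC]
      rw [SchwartzMap.convolution_apply, convolution_def]
      simp only [ContinuousLinearMap.mul_apply', neg_apply, toC_apply]
    rw [h1, ← integral_neg_eq_self, ← integral_complex_ofReal]
    congr 1
    ext y
    push_cast
    rw [neg_neg, sub_neg_eq_add, add_comm w y, mul_comm]
  have hK : ∀ w, K w = ∫ y, φ (y + w) * ψ y := fun w => by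
    simp only [K, SchwartzMap.postcompCLM_apply, hKC]
    simp only [Complex.reCLM_apply, Complex.ofReal_re]
  refine ⟨K, fun w => ⟨hint w, hK w⟩, fun ξ => ?_⟩
  have e1 : (fun x => (K x : ℂ)) = KC := by
    ext w
    rw [hK, hKC]
  have e2 : starRingEnd ℂ (sft ψ ξ) = 𝓕 (neg (toC ψ)) ((2 * Real.pi)⁻¹ • ξ) := by
    have : ⇑(neg (toC ψ)) = fun x => (((fun y => ψ (-y)) x : ℝ) : ℂ) := by
      ext x
      rw [neg_apply, toC_apply]
    rw [SchwartzMap.fourier_coe, this, ← sft_eq_fourier, sft, sft, ← integral_conj,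
      ← integral_neg_eq_self]
    congr 1
    ext x
    simp [← Complex.exp_conj]
  have e3 : sft φ ξ = 𝓕 (toC φ) ((2 * Real.pi)⁻¹ • ξ) := by
    rw [SchwartzMap.fourier_coe, sft_eq_fourier]
    congr 1
  rw [sft_eq_fourier, e1, e2, e3, ← SchwartzMap.fourier_coe]
  simp only [KC]
  rw [SchwartzMap.fourier_convolution, SchwartzMap.pairing_apply_apply,
    ContinuousLinearMap.mul_apply', mul_comm]

/-- `f` is the Fourier transform of the tempered measure `μ`. -/
def IsFourierTransformOf (f : 𝓢(Space d, ℝ) →L[ℝ] ℝ) (μ : Measure (Space d)) : Prop :=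
  ∀ φ : 𝓢(Space d, ℝ), ((f φ : ℝ) : ℂ) = ∫ ξ, sft φ ξ ∂μ

/-- The spatial form in the spectral domain. -/
theorem spatialForm_eq_integral_sft {f : 𝓢(Space d, ℝ) →L[ℝ] ℝ} {μ : Measure (Space d)}
    (hf : IsFourierTransformOf f μ) {φ ψ : Space d → ℝ} (φS ψS : 𝓢(Space d, ℝ))
    (hφ : ∀ x, φS x = φ x) (hψ : ∀ x, ψS x = ψ x) :
    ((spatialForm f φ ψ : ℝ) : ℂ) = ∫ ξ, sft φ ξ * starRingEnd ℂ (sft ψ ξ) ∂μ := by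
  obtain rfl : ⇑φS = φ := funext hφ
  obtain rfl : ⇑ψS = ψ := funext hψ
  obtain ⟨K, hK, hF⟩ := exists_isCrossCorrelation φS ψS
  rw [spatialForm_eq f hK, hf K]
  simp_rw [hF]

end SpatialFourier

/-! ### Gaussians -/

section Gaussian

variable {d : ℕ}

theorem iteratedDeriv_exp_neg_mul (a : ℝ) (n : ℕ) (r : ℝ) :
    iteratedDeriv n (fun r => Real.exp (-a * r)) r = (-a) ^ n * Real.exp (-a * r) := by
  rw [iteratedDeriv_exp_const_mul]

/-- The Gaussian `exp (-a ‖x‖²)` as a Schwartz function. -/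
theorem exists_schwartz_gaussian {a : ℝ} (ha : 0 < a) :
    ∃ ψ : 𝓢(Space d, ℝ), ∀ x, ψ x = Real.exp (-a * ‖x‖ ^ 2) := by
  have hsm : ContDiff ℝ (⊤ : ℕ∞) fun x : Space d => Real.exp (-a * ‖x‖ ^ 2) :=
    Real.contDiff_exp.comp (contDiff_const.mul (contDiff_norm_sq ℝ))
  refine ⟨⟨fun x => Real.exp (-a * ‖x‖ ^ 2), hsm, fun k n => ?_⟩, fun x => rfl⟩
  obtain ⟨m, C, hC, hbd⟩ :=
    (Function.hasTemperateGrowth_norm_sq (Space d)).norm_iteratedFDeriv_le_uniform n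
  -- polynomial times Gaussian is bounded
  obtain ⟨M, hM⟩ : ∃ M : ℝ, ∀ r : ℝ, 0 ≤ r →
      (1 + r) ^ (k + m * n) * Real.exp (-a * r ^ 2) ≤ M := by
    set N := k + m * n
    refine ⟨N.factorial * Real.exp (1 + (1 / (4 * a))), fun r hr => ?_⟩
    have h1 : (1 + r) ^ N ≤ N.factorial * Real.exp (1 + r) := by
      have := Real.pow_div_factorial_le_exp (1 + r) (by positivity) N
      rwa [div_le_iff₀ (by positivity), mul_comm] at this
    have h2 : (1 + r) + -a * r ^ 2 ≤ 1 + 1 / (4 * a) := by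
      have : 0 ≤ a * (r - 1 / (2 * a)) ^ 2 := by positivity
      have e : a * (r - 1 / (2 * a)) ^ 2 = a * r ^ 2 - r + 1 / (4 * a) := by
        field_simp
        ring
      linarith
    calc (1 + r) ^ N * Real.exp (-a * r ^ 2)
        ≤ N.factorial * Real.exp (1 + r) * Real.exp (-a * r ^ 2) := by gcongr
      _ = N.factorial * Real.exp ((1 + r) + -a * r ^ 2) := by
          rw [Real.exp_add (1 + r)]
          ring
      _ ≤ _ := by gcongr
  refine ⟨n.factorial * (1 + a) ^ n * (1 + C) ^ n * M, fun x => ?_⟩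
  have key : ‖iteratedFDeriv ℝ n ((fun r : ℝ => Real.exp (-a * r)) ∘ fun x : Space d => ‖x‖ ^ 2) x‖
      ≤ n.factorial * ((1 + a) ^ n * Real.exp (-a * ‖x‖ ^ 2)) * ((1 + C) * (1 + ‖x‖) ^ m) ^ n := by
    refine norm_iteratedFDeriv_comp_le (N := ((⊤ : ℕ∞) : WithTop ℕ∞)) (by fun_prop)
      (contDiff_norm_sq ℝ)
      (by exact_mod_cast le_top) x (fun i hi => ?_) (fun i hi hin => ?_)
    · rw [norm_iteratedFDeriv_eq_norm_iteratedDeriv, iteratedDeriv_exp_neg_mul, norm_mul, norm_pow,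
        norm_neg, Real.norm_of_nonneg ha.le, Real.norm_of_nonneg (Real.exp_nonneg _)]
      gcongr
      calc a ^ i ≤ (1 + a) ^ i := by gcongr; linarith
        _ ≤ (1 + a) ^ n := pow_le_pow_right₀ (by linarith) hi
    · have h1 : (1 : ℝ) ≤ (1 + C) * (1 + ‖x‖) ^ m := by
        have := one_le_pow₀ (M₀ := ℝ) (a := 1 + ‖x‖) (by linarith [norm_nonneg x]) (n := m)
        nlinarith
      calc _ ≤ C * (1 + ‖x‖) ^ m := hbd i hin x
        _ ≤ (1 + C) * (1 + ‖x‖) ^ m := by gcongr; linarith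
        _ ≤ _ := le_self_pow₀ h1 (by omega)
  calc ‖x‖ ^ k * ‖iteratedFDeriv ℝ n (fun x : Space d => Real.exp (-a * ‖x‖ ^ 2)) x‖
      ≤ (1 + ‖x‖) ^ k * (n.factorial * ((1 + a) ^ n * Real.exp (-a * ‖x‖ ^ 2)) *
          ((1 + C) * (1 + ‖x‖) ^ m) ^ n) := by
        gcongr
        · linarith
        · exact key
    _ = n.factorial * (1 + a) ^ n * (1 + C) ^ n *
          ((1 + ‖x‖) ^ (k + m * n) * Real.exp (-a * ‖x‖ ^ 2)) := by
        rw [mul_pow, ← pow_mul, pow_add]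
        ring
    _ ≤ _ := by
        gcongr
        exact hM _ (norm_nonneg x)

theorem heatKernel_nonneg (t : ℝ) (x : Space d) : 0 ≤ heatKernel d t x := by
  rw [heatKernel]
  split_ifs with h
  · positivity
  · rfl

theorem heatKernel_of_nonpos {t : ℝ} (ht : t ≤ 0) (x : Space d) : heatKernel d t x = 0 := by
  rw [heatKernel, if_neg (not_lt.2 ht)]

theorem heatKernel_neg (t : ℝ) (x : Space d) : heatKernel d t (-x) = heatKernel d t x := by
  rw [heatKernel, heatKernel, norm_neg]

theorem measurable_heatKernel : Measurable fun p : ℝ × Space d => heatKernel d p.1 p.2 := by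
  unfold heatKernel
  refine Measurable.ite (measurableSet_lt measurable_const measurable_fst) ?_ measurable_const
  fun_prop

/-- The slices `y ↦ g_{tx}(s, y)` are Schwartz functions. -/
theorem exists_schwartz_heatKernel (t : ℝ) (x : Space d) :
    ∃ ψ : 𝓢(Space d, ℝ), ∀ y, ψ y = heatKernel d t (x - y) := by
  rcases le_or_gt t 0 with ht | ht
  · exact ⟨0, fun y => by simp [heatKernel_of_nonpos ht]⟩
  obtain ⟨ψ, hψ⟩ := exists_schwartz_gaussian (d := d) (a := 1 / (4 * t)) (by positivity)
  refine ⟨(4 * Real.pi * t) ^ (-((d : ℝ) / 2)) • SchwartzMap.compSubConstCLM ℝ x ψ, fun y => ?_⟩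
  simp only [smul_apply, SchwartzMap.compSubConstCLM_apply, hψ, smul_eq_mul]
  rw [heatKernel, if_pos ht, norm_sub_rev]
  congr 2
  ring

/-- The Fourier transform of `y ↦ G(t, x - y)` is `exp (-i ξ·x - t|ξ|²)`. -/
theorem sft_heatKernel {t : ℝ} (ht : 0 < t) (x ξ : Space d) :
    sft (fun y => heatKernel d t (x - y)) ξ =
      Complex.exp (-Complex.I * (inner ℝ ξ x : ℝ)) * (Real.exp (-t * ‖ξ‖ ^ 2) : ℝ) := by
  have h4 : 0 < 4 * Real.pi * t := by positivity
  have hG : ∀ y : Space d, Complex.exp (-Complex.I * (inner ℝ ξ (x - y) : ℝ)) *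
      (heatKernel d t y : ℂ) = (Complex.exp (-Complex.I * (inner ℝ ξ x : ℝ)) *
        ((4 * Real.pi * t) ^ (-((d : ℝ) / 2)) : ℝ)) *
        Complex.exp (-((1 / (4 * t) : ℝ) : ℂ) * (‖y‖ : ℂ) ^ 2 + Complex.I * (inner ℝ ξ y : ℝ)) := by
    intro y
    rw [heatKernel, if_pos ht, inner_sub_right, Complex.exp_add]
    push_cast
    rw [mul_sub, Complex.exp_sub]
    rw [show -(‖y‖ : ℂ) ^ 2 / (4 * t) = -(1 / (4 * t)) * (‖y‖ : ℂ) ^ 2 by ring,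
      neg_mul Complex.I (inner ℝ ξ y : ℂ), Complex.exp_neg, div_inv_eq_mul]
    ring
  have h := GaussianFourier.integral_cexp_neg_mul_sq_norm_add (V := Space d)
    (b := ((1 / (4 * t) : ℝ) : ℂ)) (by rw [Complex.ofReal_re]; positivity) Complex.I ξ
  rw [sft, ← integral_sub_left_eq_self _ volume x]
  simp only [sub_sub_cancel]
  simp_rw [hG]
  rw [integral_const_mul, h, mul_assoc]
  congr 1
  have e1 : (Real.pi : ℂ) / ((1 / (4 * t) : ℝ) : ℂ) = ((4 * Real.pi * t : ℝ) : ℂ) := by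
    push_cast
    field_simp
  rw [e1, finrank_euclideanSpace_fin, Complex.ofReal_cpow h4.le, ← mul_assoc]
  push_cast
  rw [← Complex.cpow_add _ _ (by simpa using h4.ne'), neg_add_cancel, Complex.cpow_zero, one_mul,
    Complex.I_sq]
  congr 1
  have : (t : ℂ) ≠ 0 := by exact_mod_cast ht.ne'
  field_simp

theorem sft_heatKernel_of_nonpos {t : ℝ} (ht : t ≤ 0) (x ξ : Space d) :
    sft (fun y => heatKernel d t (x - y)) ξ = 0 := by
  simp [sft, heatKernel_of_nonpos ht]

/-- The heat kernel has total mass one. -/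
theorem integral_heatKernel {t : ℝ} (ht : 0 < t) : ∫ y : Space d, heatKernel d t y = 1 := by
  have h := sft_heatKernel (d := d) ht 0 0
  simp only [sft, inner_zero_left, zero_sub, heatKernel_neg] at h
  simp at h
  rw [integral_complex_ofReal] at h
  exact_mod_cast h

theorem integrable_heatKernel (t : ℝ) : Integrable fun y : Space d => heatKernel d t y := by
  obtain ⟨ψ, hψ⟩ := exists_schwartz_heatKernel (d := d) t 0
  refine (ψ.integrable (μ := volume)).congr (Eventually.of_forall fun y => ?_)
  simp only [hψ, zero_sub, heatKernel_neg]

theorem lintegral_heatKernel {t : ℝ} (ht : 0 < t) :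
    ∫⁻ y : Space d, ENNReal.ofReal (heatKernel d t y) = 1 := by
  rw [← ofReal_integral_eq_lintegral_ofReal (integrable_heatKernel t)
    (Eventually.of_forall fun y => heatKernel_nonneg t y), integral_heatKernel ht,
    ENNReal.ofReal_one]

end Gaussian

/-! ### The time kernel -/

section TimeKernel

/-- The product `|z|^(H-3/2) |1-z|^(H-3/2)` is integrable on the line: the exponent exceeds `-1`,
which settles the points `0` and `1`, and `2H - 3 < -1` settles infinity. -/
theorem integrable_abs_rpow_mul {H : ℝ} (hH : 1 / 2 < H) (hH' : H < 1) :
    Integrable fun z : ℝ => |z| ^ (H - 3 / 2) * |1 - z| ^ (H - 3 / 2) := by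
  set s := H - 3 / 2 with hs
  have hs1 : -1 < s := by linarith
  have hs2 : s < -(1 / 2) := by linarith
  let g : ℝ → ℝ := (Ioo 0 1).indicator fun z => z ^ s
  have hg : Integrable g :=
    ((intervalIntegral.integrableOn_Ioo_rpow_iff one_pos).2 hs1).integrable_indicator
      measurableSet_Ioo
  have hg0 : ∀ z, 0 ≤ g z := fun z => indicator_nonneg (fun z hz => by
    have := hz.1
    positivity) z
  have hfar : Integrable fun z : ℝ => (1 + ‖z‖) ^ (2 * s) := by
    have := integrable_one_add_norm (E := ℝ) (μ := volume) (r := -(2 * s)) (by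
      simp only [Module.finrank_self, Nat.cast_one]; linarith)
    simpa using this
  -- `B` dominates the product where `|z| ≤ |1 - z|`: the first two terms for `|z| < 1`, the last
  -- one elsewhere. The other half of the line is its reflection.
  let B : ℝ → ℝ := fun z => 2 * g z + 2 * g (-z) + 4 * (1 + ‖z‖) ^ (2 * s)
  have hB : Integrable B := ((hg.const_mul 2).add (hg.comp_neg.const_mul 2)).add (hfar.const_mul 4)
  have hB0 : ∀ z, 0 ≤ B z := fun z => by
    have := hg0 z
    have := hg0 (-z)
    positivity
  have key : ∀ z, |z| ≤ |1 - z| → |z| ^ s * |1 - z| ^ s ≤ B z := by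
    intro z hz
    have h1 : 0 ≤ 4 * (1 + ‖z‖) ^ (2 * s) := by positivity
    rcases eq_or_ne z 0 with rfl | hz0
    · rw [abs_zero, Real.zero_rpow (by linarith), zero_mul]
      exact hB0 0
    have hzp : 0 < |z| := abs_pos.2 hz0
    rcases lt_or_ge |z| 1 with hz1 | hz1
    · have hhalf : (1 : ℝ) / 2 ≤ |1 - z| := by
        have := abs_add_le (1 - z) z
        rw [sub_add_cancel, abs_one] at this
        linarith
      have h2 : |1 - z| ^ s ≤ 2 := by
        calc |1 - z| ^ s ≤ (1 / 2) ^ s :=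
              Real.rpow_le_rpow_of_nonpos (by norm_num) hhalf (by linarith)
          _ = 2 ^ (-s) := by rw [one_div, Real.inv_rpow (by norm_num), Real.rpow_neg (by norm_num)]
          _ ≤ 2 ^ (1 : ℝ) := Real.rpow_le_rpow_of_exponent_le (by norm_num) (by linarith)
          _ = 2 := Real.rpow_one 2
      have h3 : |z| ^ s ≤ g z + g (-z) := by
        rcases abs_cases z with ⟨h, h'⟩ | ⟨h, h'⟩
        · have : g z = |z| ^ s := by
            rw [h]
            exact indicator_of_mem (by constructor <;> linarith) _
          linarith [hg0 (-z)]
        · have : g (-z) = |z| ^ s := by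
            rw [h]
            exact indicator_of_mem (by constructor <;> linarith) _
          linarith [hg0 z]
      have h4 : |z| ^ s * |1 - z| ^ s ≤ |z| ^ s * 2 := by gcongr
      simp only [B]
      linarith
    · have h2 : |1 - z| ^ s ≤ |z| ^ s := Real.rpow_le_rpow_of_nonpos hzp hz (by linarith)
      have h3 : |z| ^ s * |1 - z| ^ s ≤ |z| ^ (2 * s) := by
        rw [two_mul, Real.rpow_add hzp]
        gcongr
      have h4 : |z| ^ (2 * s) ≤ ((1 + |z|) / 2) ^ (2 * s) :=
        Real.rpow_le_rpow_of_nonpos (by positivity) (by linarith) (by linarith)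
      have h5 : ((1 + |z|) / 2) ^ (2 * s) ≤ 4 * (1 + |z|) ^ (2 * s) := by
        rw [div_eq_inv_mul, Real.mul_rpow (by norm_num) (by positivity)]
        gcongr
        calc (2 : ℝ)⁻¹ ^ (2 * s) = 2 ^ (-(2 * s)) := by
              rw [Real.inv_rpow (by norm_num), Real.rpow_neg (by norm_num)]
          _ ≤ 2 ^ (2 : ℝ) := Real.rpow_le_rpow_of_exponent_le (by norm_num) (by linarith)
          _ = 4 := by norm_num
      have := hg0 z
      have := hg0 (-z)
      simp only [B, Real.norm_eq_abs]
      linarith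
  refine (hB.add (hB.comp_sub_left 1)).mono' (by fun_prop) (Eventually.of_forall fun z => ?_)
  rw [Real.norm_of_nonneg (by positivity)]
  simp only [Pi.add_apply]
  rcases le_total |z| |1 - z| with h | h
  · linarith [key z h, hB0 (1 - z)]
  · have := key (1 - z) (by simpa using h)
    rw [sub_sub_cancel, mul_comm] at this
    linarith [hB0 z]

/-- The constant `∫ |z|^(H-3/2) |1-z|^(H-3/2) dz`. -/
def kernelConst (H : ℝ) : ℝ := ∫ z : ℝ, |z| ^ (H - 3 / 2) * |1 - z| ^ (H - 3 / 2)

theorem kernelConst_pos {H : ℝ} (hH : 1 / 2 < H) (hH' : H < 1) : 0 < kernelConst H := by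
  rw [kernelConst, integral_pos_iff_support_of_nonneg (fun z => by positivity)
    (integrable_abs_rpow_mul hH hH')]
  have : Ioo (0 : ℝ) 1 ⊆ Function.support
      fun z : ℝ => |z| ^ (H - 3 / 2) * |1 - z| ^ (H - 3 / 2) := by
    intro z hz
    have h1 : 0 < |z| := abs_pos.2 hz.1.ne'
    have h2 : 0 < |1 - z| := abs_pos.2 (by linarith [hz.2])
    exact (mul_pos (Real.rpow_pos_of_pos h1 _) (Real.rpow_pos_of_pos h2 _)).ne'
  exact lt_of_lt_of_le (by simp) (measure_mono this)

/-- The kernel `κ(u, w) = c |u - w|^(H-3/2)`, normalized so that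
`∫ κ(u, w) κ(v, w) dw = H (2H - 1) |u - v|^(2H-2)`. -/
def timeKernel (H u w : ℝ) : ℝ :=
  √(H * (2 * H - 1) / kernelConst H) * |u - w| ^ (H - 3 / 2)

theorem timeKernel_nonneg (H u w : ℝ) : 0 ≤ timeKernel H u w := by
  unfold timeKernel
  positivity

theorem measurable_timeKernel (H : ℝ) : Measurable fun p : ℝ × ℝ => timeKernel H p.1 p.2 := by
  unfold timeKernel
  fun_prop

theorem integrable_timeKernel_mul {H : ℝ} (hH : 1 / 2 < H) (hH' : H < 1) {u v : ℝ} (huv : u ≠ v) :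
    Integrable (fun w => timeKernel H u w * timeKernel H v w) ∧
      ∫ w, timeKernel H u w * timeKernel H v w = H * (2 * H - 1) * |u - v| ^ (2 * H - 2) := by
  have hr : v - u ≠ 0 := sub_ne_zero.2 huv.symm
  have hr0 : 0 < |v - u| := abs_pos.2 hr
  have hc := kernelConst_pos hH hH'
  set s := H - 3 / 2 with hs
  -- the substitution `w = u + (v - u) z`
  have hsub : ∀ w, timeKernel H u w * timeKernel H v w =
      (H * (2 * H - 1) / kernelConst H * |v - u| ^ (2 * s)) *
        (|(w - u) / (v - u)| ^ s * |1 - (w - u) / (v - u)| ^ s) := by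
    intro w
    have e1 : |u - w| = |v - u| * |(w - u) / (v - u)| := by
      rw [abs_div, mul_div_cancel₀ _ hr0.ne', abs_sub_comm]
    have e2 : |v - w| = |v - u| * |1 - (w - u) / (v - u)| := by
      rw [← abs_mul]
      congr 1
      field_simp
      ring
    have h0 : 0 ≤ H * (2 * H - 1) / kernelConst H :=
      div_nonneg (mul_nonneg (by linarith) (by linarith)) hc.le
    rw [timeKernel, timeKernel, e1, e2, Real.mul_rpow hr0.le (abs_nonneg _),
      Real.mul_rpow hr0.le (abs_nonneg _), two_mul s, Real.rpow_add hr0]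
    nth_rewrite 3 [← Real.mul_self_sqrt h0]
    ring
  simp_rw [hsub]
  have hI := integrable_abs_rpow_mul hH hH'
  have hI2 : Integrable fun w : ℝ => |(w - u) / (v - u)| ^ s * |1 - (w - u) / (v - u)| ^ s :=
    ((integrable_comp_div_iff _ hr).2 hI).comp_sub_right u
  refine ⟨hI2.const_mul _, ?_⟩
  rw [integral_const_mul, integral_sub_right_eq_self
    (fun w : ℝ => |w / (v - u)| ^ s * |1 - w / (v - u)| ^ s) u,
    Measure.integral_comp_div (fun w : ℝ => |w| ^ s * |1 - w| ^ s), smul_eq_mul]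
  change _ * (_ * kernelConst H) = _
  have e3 : |v - u| ^ (2 * s) * |v - u| = |u - v| ^ (2 * H - 2) := by
    nth_rewrite 2 [← Real.rpow_one |v - u|]
    rw [← Real.rpow_add hr0, abs_sub_comm]
    congr 1
    rw [hs]
    ring
  rw [← e3]
  field_simp

theorem lintegral_timeKernel_mul {H : ℝ} (hH : 1 / 2 < H) (hH' : H < 1) {u v : ℝ} (huv : u ≠ v) :
    ∫⁻ w, ENNReal.ofReal (timeKernel H u w) * ENNReal.ofReal (timeKernel H v w) =
      ENNReal.ofReal (H * (2 * H - 1) * |u - v| ^ (2 * H - 2)) := by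
  obtain ⟨h1, h2⟩ := integrable_timeKernel_mul hH hH' huv
  rw [← h2, ofReal_integral_eq_lintegral_ofReal h1
    (Eventually.of_forall fun w => mul_nonneg (timeKernel_nonneg _ _ _) (timeKernel_nonneg _ _ _))]
  simp_rw [ENNReal.ofReal_mul (timeKernel_nonneg H u _)]

/-- The kernel is locally integrable in time because `H - 3/2 > -1`. -/
theorem integrableOn_timeKernel {H : ℝ} (hH : 1 / 2 < H) (w T : ℝ) :
    IntegrableOn (fun u => timeKernel H u w) (Ioo 0 T) := by
  have h : Integrable ((Ioo (0 : ℝ) (|w| + |T| + 1)).indicator fun z => z ^ (H - 3 / 2)) :=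
    ((intervalIntegral.integrableOn_Ioo_rpow_iff (by positivity)).2
      (by linarith)).integrable_indicator measurableSet_Ioo
  have h2 := ((h.comp_sub_right w).add (h.comp_sub_left w)).const_mul
    √(H * (2 * H - 1) / kernelConst H)
  refine h2.integrableOn.mono'
    ((measurable_timeKernel H).comp (measurable_id.prodMk measurable_const)).aestronglyMeasurable ?_
  have h3 : ∀ᵐ u ∂(volume.restrict (Ioo 0 T)), u ≠ w := ae_restrict_of_ae (Measure.ae_ne volume w)
  filter_upwards [h3, ae_restrict_mem measurableSet_Ioo] with u hu huT
  rw [Real.norm_of_nonneg (timeKernel_nonneg _ _ _), timeKernel]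
  refine mul_le_mul_of_nonneg_left ?_ (Real.sqrt_nonneg _)
  have hnn : ∀ y, 0 ≤ (Ioo (0 : ℝ) (|w| + |T| + 1)).indicator (fun z => z ^ (H - 3 / 2)) y :=
    fun y => indicator_nonneg (fun z hz => by have := hz.1; positivity) y
  have hlt : |u - w| < |w| + |T| + 1 := by
    have h4 : |u| ≤ |T| := by rw [abs_of_pos huT.1]; exact huT.2.le.trans (le_abs_self T)
    linarith [abs_sub u w]
  have hpos : 0 < |u - w| := abs_pos.2 (sub_ne_zero.2 hu)
  simp only [Pi.add_apply]
  rcases abs_cases (u - w) with ⟨h, h'⟩ | ⟨h, h'⟩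
  · have := indicator_of_mem (s := Ioo (0 : ℝ) (|w| + |T| + 1)) (a := u - w)
      (by constructor <;> linarith) (fun z => z ^ (H - 3 / 2))
    rw [this, h]
    linarith [hnn (w - u)]
  · have := indicator_of_mem (s := Ioo (0 : ℝ) (|w| + |T| + 1)) (a := w - u)
      (by constructor <;> linarith) (fun z => z ^ (H - 3 / 2))
    rw [this, h, neg_sub]
    linarith [hnn (u - w)]

theorem ae_fst_ne_snd : ∀ᵐ p : ℝ × ℝ, p.1 ≠ p.2 := by
  have hm : MeasurableSet {p : ℝ × ℝ | p.1 ≠ p.2} :=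
    (measurableSet_eq_fun measurable_fst measurable_snd).compl
  rw [Measure.volume_eq_prod]
  refine (Measure.ae_prod_mem_iff_ae_ae_mem hm).2 (Eventually.of_forall fun x => ?_)
  filter_upwards [Measure.ae_ne volume x] with y hy
  exact Ne.symm hy

/-- Tonelli's theorem: a product of integrals over time, squared and integrated over the product
space, factorizes for each pair of times. -/
theorem lintegral_sq_mul_prod {X Y : Type*} [MeasurableSpace X] [MeasurableSpace Y] (μ : Measure X)
    [SFinite μ] (ρ : Measure Y) [SFinite ρ] (S : Set ℝ) (k : ℝ → Y → ℝ≥0∞) (a : ℝ → X → ℝ≥0∞)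
    (hk : Measurable (fun p : ℝ × Y => k p.1 p.2)) (ha : Measurable (fun p : ℝ × X => a p.1 p.2)) :
    ∫⁻ z, (∫⁻ u in S, k u z.1 * a u z.2) ^ 2 ∂(ρ.prod μ) =
      ∫⁻ p in S ×ˢ S, (∫⁻ w, k p.1 w * k p.2 w ∂ρ) * ∫⁻ ξ, a p.1 ξ * a p.2 ξ ∂μ := by
  have hsq : ∀ z : Y × X, (∫⁻ u in S, k u z.1 * a u z.2) ^ 2 =
      ∫⁻ p in S ×ˢ S, (k p.1 z.1 * a p.1 z.2) * (k p.2 z.1 * a p.2 z.2) := by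
    intro z
    have hz : Measurable fun u => k u z.1 * a u z.2 := by fun_prop
    rw [sq, ← lintegral_prod_mul hz.aemeasurable hz.aemeasurable, Measure.prod_restrict]
    rfl
  simp_rw [hsq]
  have hm1 : Measurable fun q : (Y × X) × (ℝ × ℝ) =>
      (k q.2.1 q.1.1 * a q.2.1 q.1.2) * (k q.2.2 q.1.1 * a q.2.2 q.1.2) := by fun_prop
  rw [lintegral_lintegral_swap hm1.aemeasurable]
  refine lintegral_congr fun p => ?_
  rw [← lintegral_prod_mul (by fun_prop) (by fun_prop)]
  refine lintegral_congr fun z => ?_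
  ring

/-- Tonelli's theorem for the energy of a nonnegative function of time and frequency. -/
theorem lintegral_sq_timeKernel {X : Type*} [MeasurableSpace X] (μ : Measure X) [SFinite μ]
    {H : ℝ} (hH : 1 / 2 < H) (hH' : H < 1) (S : Set ℝ) (a : ℝ → X → ℝ≥0∞)
    (ha : Measurable (fun p : ℝ × X => a p.1 p.2)) :
    ∫⁻ z, (∫⁻ u in S, ENNReal.ofReal (timeKernel H u z.1) * a u z.2) ^ 2
        ∂((volume : Measure ℝ).prod μ) =
      ∫⁻ p in S ×ˢ S, ENNReal.ofReal (H * (2 * H - 1) * |p.1 - p.2| ^ (2 * H - 2)) *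
        ∫⁻ ξ, a p.1 ξ * a p.2 ξ ∂μ := by
  rw [lintegral_sq_mul_prod μ volume S (fun u w => ENNReal.ofReal (timeKernel H u w)) a
    (measurable_timeKernel H).ennreal_ofReal ha]
  refine lintegral_congr_ae (ae_restrict_of_ae ?_)
  filter_upwards [ae_fst_ne_snd] with p hp
  rw [lintegral_timeKernel_mul hH hH' hp]

theorem restrict_prod_self (S : Set ℝ) : (volume : Measure (ℝ × ℝ)).restrict (S ×ˢ S) =
    (volume.restrict S).prod (volume.restrict S) := by
  rw [Measure.prod_restrict]
  rfl

/-- The integral over the triangle `a < b` of `(b - a)^(2H-2) b^(-β)`. -/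
theorem lintegral_triangle {H β : ℝ} (hH : 1 / 2 < H) (T : ℝ) :
    ∫⁻ b in Ioo 0 T, ∫⁻ a in Ioo 0 b,
        ENNReal.ofReal ((b - a) ^ (2 * H - 2)) * ENNReal.ofReal (b ^ (-β)) =
      ENNReal.ofReal ((2 * H - 1)⁻¹) * ∫⁻ b in Ioo 0 T, ENNReal.ofReal (b ^ (2 * H - 1 - β)) := by
  rw [← lintegral_const_mul _ (by fun_prop)]
  refine setLIntegral_congr_fun measurableSet_Ioo fun b hb => ?_
  have hb0 : 0 < b := hb.1
  have hint : IntervalIntegrable (fun a => (b - a) ^ (2 * H - 2)) volume 0 b := by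
    have := (intervalIntegral.intervalIntegrable_rpow' (a := b) (b := 0)
      (r := 2 * H - 2) (by linarith)).comp_sub_left b
    simpa using this
  have hval : ∫ a in (0 : ℝ)..b, (b - a) ^ (2 * H - 2) = b ^ (2 * H - 1) / (2 * H - 1) := by
    rw [intervalIntegral.integral_comp_sub_left (fun a => a ^ (2 * H - 2)) b, sub_self, sub_zero,
      integral_rpow (Or.inl (by linarith)), show 2 * H - 2 + 1 = 2 * H - 1 by ring,
      Real.zero_rpow (by linarith), sub_zero]
  rw [lintegral_mul_const _ (by fun_prop), ← ofReal_integral_eq_lintegral_ofReal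
    ((intervalIntegrable_iff_integrableOn_Ioo_of_le hb0.le).1 hint), ← integral_Ioc_eq_integral_Ioo,
    ← intervalIntegral.integral_of_le hb0.le, hval, ← ENNReal.ofReal_mul, ← ENNReal.ofReal_mul]
  · congr 1
    rw [sub_eq_add_neg _ β, Real.rpow_add hb0]
    ring
  · exact inv_nonneg.2 (by linarith)
  · exact div_nonneg (by positivity) (by linarith)
  · filter_upwards [ae_restrict_mem measurableSet_Ioo] with a ha
    exact Real.rpow_nonneg (by linarith [ha.2]) _

/-- The integrand is homogeneous. On the triangle where `b` is the larger of the two times,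
`p.1 + p.2` is comparable to `b`, and the integral reduces to that of `b^(2H-1-β)`, which is finite
if and only if `β < 2H`. -/
theorem lintegral_energy_lt_top {H β : ℝ} (hH : 1 / 2 < H) (hβ : 0 ≤ β) (hβH : β < 2 * H) {T : ℝ}
    (hT : 0 < T) :
    ∫⁻ p in Ioo 0 T ×ˢ Ioo 0 T,
      ENNReal.ofReal (|p.1 - p.2| ^ (2 * H - 2) * (p.1 + p.2) ^ (-β)) < ∞ := by
  let F : ℝ → ℝ → ℝ≥0∞ := fun b a => (Ioo 0 b).indicator
    (fun a => ENNReal.ofReal ((b - a) ^ (2 * H - 2)) * ENNReal.ofReal (b ^ (-β))) a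
  have hFm : Measurable fun p : ℝ × ℝ => F p.1 p.2 := by
    have : (fun p : ℝ × ℝ => F p.1 p.2) = {p : ℝ × ℝ | 0 < p.2 ∧ p.2 < p.1}.indicator
        fun p => ENNReal.ofReal ((p.1 - p.2) ^ (2 * H - 2)) * ENNReal.ofReal (p.1 ^ (-β)) := rfl
    rw [this]
    exact Measurable.indicator (by fun_prop)
      ((measurableSet_lt measurable_const measurable_snd).inter
        (measurableSet_lt measurable_snd measurable_fst))
  have hF : ∫⁻ b in Ioo 0 T, ∫⁻ a in Ioo 0 T, F b a < ∞ := by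
    have h1 : ∫⁻ b in Ioo 0 T, ∫⁻ a in Ioo 0 T, F b a ≤ ∫⁻ b in Ioo 0 T, ∫⁻ a in Ioo 0 b,
        ENNReal.ofReal ((b - a) ^ (2 * H - 2)) * ENNReal.ofReal (b ^ (-β)) := by
      refine lintegral_mono fun b => ?_
      refine (setLIntegral_le_lintegral _ _).trans (le_of_eq ?_)
      exact lintegral_indicator measurableSet_Ioo _
    refine h1.trans_lt ?_
    rw [lintegral_triangle hH]
    refine ENNReal.mul_lt_top ENNReal.ofReal_lt_top ?_
    exact ((intervalIntegral.integrableOn_Ioo_rpow_iff hT).2 (by linarith)).lintegral_lt_top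
  have hle : ∀ᵐ p : ℝ × ℝ ∂volume.restrict (Ioo 0 T ×ˢ Ioo 0 T),
      ENNReal.ofReal (|p.1 - p.2| ^ (2 * H - 2) * (p.1 + p.2) ^ (-β)) ≤
        F p.1 p.2 + F p.2 p.1 := by
    have hne := ae_restrict_of_ae (s := Ioo 0 T ×ˢ Ioo 0 T) ae_fst_ne_snd
    filter_upwards [hne, ae_restrict_mem (measurableSet_Ioo.prod measurableSet_Ioo)] with p hp hpT
    obtain ⟨⟨h1, -⟩, ⟨h2, -⟩⟩ := hpT
    have aux : ∀ a b : ℝ, 0 < a → a < b →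
        ENNReal.ofReal (|a - b| ^ (2 * H - 2) * (a + b) ^ (-β)) ≤ F b a := by
      intro a b ha hab
      rw [show F b a = _ from indicator_of_mem (s := Ioo 0 b) (a := a) ⟨ha, hab⟩ _,
        ENNReal.ofReal_mul (by positivity), abs_sub_comm, abs_of_pos (sub_pos.2 hab)]
      refine mul_le_mul_right (ENNReal.ofReal_le_ofReal ?_) _
      exact Real.rpow_le_rpow_of_nonpos (by linarith) (by linarith) (by linarith)
    rcases lt_or_gt_of_ne hp with h | h
    · exact (aux _ _ h1 h).trans le_add_self
    · rw [abs_sub_comm, add_comm p.1]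
      exact (aux _ _ h2 h).trans le_self_add
  refine (lintegral_mono_ae hle).trans_lt ?_
  rw [lintegral_add_left hFm]
  rw [restrict_prod_self, lintegral_prod _ hFm.aemeasurable,
    lintegral_prod_symm (fun p : ℝ × ℝ => F p.2 p.1) (hFm.comp measurable_swap).aemeasurable]
  exact ENNReal.add_lt_top.2 ⟨hF, hF⟩

/-- The converse of `lintegral_energy_lt_top`; one triangle suffices, on which
`p.1 + p.2 ≤ 2 b`. -/
theorem lintegral_energy_eq_top {H β : ℝ} (hH : 1 / 2 < H) (hH' : H < 1) (hβH : 2 * H ≤ β) {T : ℝ}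
    (hT : 0 < T) :
    ∫⁻ p in Ioo 0 T ×ˢ Ioo 0 T,
      ENNReal.ofReal (|p.1 - p.2| ^ (2 * H - 2) * (p.1 + p.2) ^ (-β)) = ∞ := by
  have hm : Measurable fun p : ℝ × ℝ =>
      ENNReal.ofReal (|p.1 - p.2| ^ (2 * H - 2) * (p.1 + p.2) ^ (-β)) := by fun_prop
  have h2 : (0 : ℝ) < 2 ^ (-β) := by positivity
  have hle : ENNReal.ofReal (2 ^ (-β)) * ∫⁻ b in Ioo 0 T, ∫⁻ a in Ioo 0 b,
      ENNReal.ofReal ((b - a) ^ (2 * H - 2)) * ENNReal.ofReal (b ^ (-β)) ≤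
      ∫⁻ p in Ioo 0 T ×ˢ Ioo 0 T,
      ENNReal.ofReal (|p.1 - p.2| ^ (2 * H - 2) * (p.1 + p.2) ^ (-β)) := by
    rw [restrict_prod_self, lintegral_prod _ hm.aemeasurable,
      ← lintegral_const_mul' _ _ ENNReal.ofReal_ne_top]
    refine setLIntegral_mono' measurableSet_Ioo fun b hb => ?_
    rw [← lintegral_const_mul' _ _ ENNReal.ofReal_ne_top]
    refine (setLIntegral_mono' measurableSet_Ioo fun a ha => ?_).trans
      (lintegral_mono_set (Ioo_subset_Ioo_right hb.2.le))
    have hb0 := hb.1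
    have hab : 0 < b - a := sub_pos.2 ha.2
    rw [← ENNReal.ofReal_mul (by positivity), ← ENNReal.ofReal_mul h2.le, abs_of_pos hab]
    refine ENNReal.ofReal_le_ofReal ?_
    calc 2 ^ (-β) * ((b - a) ^ (2 * H - 2) * b ^ (-β))
        = (b - a) ^ (2 * H - 2) * (2 * b) ^ (-β) := by
          rw [Real.mul_rpow (by norm_num) hb0.le]; ring
      _ ≤ _ := by
          refine mul_le_mul_of_nonneg_left ?_ (by positivity)
          exact Real.rpow_le_rpow_of_nonpos (by linarith [ha.1]) (by linarith [ha.2]) (by linarith)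
  rw [eq_top_iff]
  refine le_trans (le_of_eq ?_) hle
  rw [lintegral_triangle hH]
  have hno : ∫⁻ b in Ioo 0 T, ENNReal.ofReal (b ^ (2 * H - 1 - β)) = ∞ := by
    by_contra hfin
    have : IntegrableOn (fun b : ℝ => b ^ (2 * H - 1 - β)) (Ioo 0 T) := by
      refine ⟨by fun_prop, ?_⟩
      rw [hasFiniteIntegral_iff_ofReal]
      · exact lt_top_iff_ne_top.2 hfin
      · filter_upwards [ae_restrict_mem measurableSet_Ioo] with b hb
        exact Real.rpow_nonneg hb.1.le _
    have := (intervalIntegral.integrableOn_Ioo_rpow_iff hT).1 this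
    linarith
  rw [hno, ENNReal.mul_top, ENNReal.mul_top]
  · exact (ENNReal.ofReal_pos.2 h2).ne'
  · exact (ENNReal.ofReal_pos.2 (inv_pos.2 (by linarith))).ne'

end TimeKernel

/-! ### The spectral representation of the space of integrands -/

section Spectral

variable {d : ℕ}

/-- A tempered measure is finite on bounded sets. -/
theorem isLocallyFiniteMeasure_of_temperate (μ : Measure (Space d)) [μ.HasTemperateGrowth] :
    IsLocallyFiniteMeasure μ := by
  refine ⟨fun x => ⟨Metric.ball x 1, Metric.ball_mem_nhds x one_pos, ?_⟩⟩
  set n := μ.integrablePower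
  have h := (Measure.integrable_pow_neg_integrablePower μ).measure_ge_lt_top
    (ε := (2 + ‖x‖) ^ (-(n : ℝ))) (by positivity)
  refine lt_of_le_of_lt (measure_mono fun y hy => ?_) h
  have hy' : ‖y‖ ≤ 1 + ‖x‖ := by
    have h1 := mem_ball_iff_norm.1 hy
    have h2 := norm_le_insert' y x
    linarith
  exact Real.rpow_le_rpow_of_nonpos (by positivity) (by linarith) (by simp)

/-- The measure `dw ⊗ μ(dξ)` of the spectral domain. -/
abbrev spectralMeasure (μ : Measure (Space d)) : Measure (ℝ × Space d) :=
  (volume : Measure ℝ).prod μ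

/-- The spectral representative `(w, ξ) ↦ ∫_0^T κ(u, w) 𝓕φ(u, ·)(ξ) du` of a function `φ`. The
norm of `φ` in `HP` is the norm of its representative in `L²(dw ⊗ μ(dξ))`. -/
def feature (H T : ℝ) (φ : ℝ × Space d → ℝ) (z : ℝ × Space d) : ℂ :=
  ∫ u in Ioo 0 T, (timeKernel H u z.1 : ℂ) * sft (fun x => φ (u, x)) z.2

/-- The spectral representative with absolute values inside the integral over time. -/
def absFeature (H T : ℝ) (φ : ℝ × Space d → ℝ) (z : ℝ × Space d) : ℝ≥0∞ :=
  ∫⁻ u in Ioo 0 T, ENNReal.ofReal (timeKernel H u z.1) * ‖sft (fun x => φ (u, x)) z.2‖ₑ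

/-- The functions for which the `HP` form is an absolutely convergent integral in the spectral
domain: the slices at almost all times are Schwartz functions, and the energy is finite. -/
structure IsRegular (μ : Measure (Space d)) (H T : ℝ) (φ : ℝ × Space d → ℝ) : Prop where
  measurable : Measurable φ
  slice : ∀ᵐ u ∂volume.restrict (Ioo 0 T), ∃ ψ : 𝓢(Space d, ℝ), ∀ x, ψ x = φ (u, x)
  finite : ∫⁻ z, absFeature H T φ z ^ 2 ∂spectralMeasure μ < ∞

theorem stronglyMeasurable_sft {X : Type*} [MeasurableSpace X] {φ : X × Space d → ℝ}
    (hφ : Measurable φ) :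
    StronglyMeasurable fun p : X × Space d => sft (fun x => φ (p.1, x)) p.2 := by
  unfold sft
  have : Measurable fun q : (X × Space d) × Space d =>
      Complex.exp (-Complex.I * (inner ℝ q.1.2 q.2 : ℝ)) * (φ (q.1.1, q.2) : ℂ) := by
    fun_prop
  exact this.stronglyMeasurable.integral_prod_right

theorem measurable_absFeature (H T : ℝ) {φ : ℝ × Space d → ℝ} (hφ : Measurable φ) :
    Measurable (absFeature H T φ) := by
  unfold absFeature
  have h1 := measurable_timeKernel H
  have h2 := (stronglyMeasurable_sft hφ).measurable
  have : Measurable fun q : (ℝ × Space d) × ℝ => ENNReal.ofReal (timeKernel H q.2 q.1.1) *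
      ‖sft (fun x => φ (q.2, x)) q.1.2‖ₑ :=
    (h1.comp (measurable_snd.prodMk (measurable_fst.comp measurable_fst))).ennreal_ofReal.mul
      (h2.comp (measurable_snd.prodMk (measurable_snd.comp measurable_fst))).enorm
  exact this.lintegral_prod_right'

theorem measurable_feature_integrand (H : ℝ) {φ : ℝ × Space d → ℝ} (hφ : Measurable φ) :
    Measurable fun q : (ℝ × Space d) × ℝ => (timeKernel H q.2 q.1.1 : ℂ) *
      sft (fun x => φ (q.2, x)) q.1.2 := by
  have h1 := measurable_timeKernel H
  have h2 := (stronglyMeasurable_sft hφ).measurable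
  exact (Complex.measurable_ofReal.comp
    (h1.comp (measurable_snd.prodMk (measurable_fst.comp measurable_fst)))).mul
      (h2.comp (measurable_snd.prodMk (measurable_snd.comp measurable_fst)))

theorem stronglyMeasurable_feature (H T : ℝ) {φ : ℝ × Space d → ℝ} (hφ : Measurable φ) :
    StronglyMeasurable (feature H T φ) :=
  (measurable_feature_integrand H hφ).stronglyMeasurable.integral_prod_right

theorem enorm_timeKernel_mul (H u w : ℝ) (z : ℂ) :
    ‖(timeKernel H u w : ℂ) * z‖ₑ = ENNReal.ofReal (timeKernel H u w) * ‖z‖ₑ := by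
  rw [enorm_mul, ← ofReal_norm, Complex.norm_real, Real.norm_of_nonneg (timeKernel_nonneg H u w)]

theorem enorm_feature_le (H T : ℝ) (φ : ℝ × Space d → ℝ) (z : ℝ × Space d) :
    ‖feature H T φ z‖ₑ ≤ absFeature H T φ z := by
  refine (enorm_integral_le_lintegral_enorm _).trans (le_of_eq ?_)
  simp_rw [enorm_timeKernel_mul]
  rfl

theorem eLpNorm_two_sq {α E : Type*} [MeasurableSpace α] [NormedAddCommGroup E] (F : α → E)
    (ρ : Measure α) : eLpNorm F 2 ρ ^ 2 = ∫⁻ a, ‖F a‖ₑ ^ 2 ∂ρ := by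
  rw [eLpNorm_eq_lintegral_rpow_enorm_toReal (by norm_num) (by norm_num),
    ← ENNReal.rpow_natCast, ← ENNReal.rpow_mul]
  simp

theorem memLp_two_of_lintegral {X E : Type*} [MeasurableSpace X] [NormedAddCommGroup E]
    {ρ : Measure X} {F : X → E} (hF : AEStronglyMeasurable F ρ) (h : ∫⁻ x, ‖F x‖ₑ ^ 2 ∂ρ < ∞) :
    MemLp F 2 ρ := by
  refine ⟨hF, ?_⟩
  rw [eLpNorm_lt_top_iff_lintegral_rpow_enorm_lt_top (by norm_num) (by norm_num)]
  simpa using h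

theorem IsRegular.memLp {μ : Measure (Space d)} {H T : ℝ} {φ : ℝ × Space d → ℝ}
    (hφ : IsRegular μ H T φ) : MemLp (feature H T φ) 2 (spectralMeasure μ) := by
  refine memLp_two_of_lintegral
    (stronglyMeasurable_feature H T hφ.measurable).aestronglyMeasurable ?_
  refine lt_of_le_of_lt (lintegral_mono fun z => ?_) hφ.finite
  gcongr
  exact enorm_feature_le H T φ z

theorem IsRegular.ae_absFeature_lt_top {μ : Measure (Space d)} {H T : ℝ} {φ : ℝ × Space d → ℝ}
    (hφ : IsRegular μ H T φ) : ∀ᵐ z ∂spectralMeasure μ, absFeature H T φ z < ∞ := by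
  filter_upwards [ae_lt_top ((measurable_absFeature H T hφ.measurable).pow_const 2) hφ.finite.ne]
    with z hz
  exact (ENNReal.pow_lt_top_iff).1 hz |>.resolve_right (by norm_num)

theorem integrable_feature_integrand {H T : ℝ} {φ : ℝ × Space d → ℝ} (hφ : Measurable φ)
    {z : ℝ × Space d} (hz : absFeature H T φ z < ∞) :
    IntegrableOn (fun u => (timeKernel H u z.1 : ℂ) * sft (fun x => φ (u, x)) z.2) (Ioo 0 T) := by
  refine ⟨((measurable_feature_integrand H hφ).comp
    (measurable_const.prodMk measurable_id)).aestronglyMeasurable, ?_⟩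
  rw [HasFiniteIntegral]
  simp_rw [enorm_timeKernel_mul]
  exact hz

theorem ennreal_add_sq_le (a b : ℝ≥0∞) : (a + b) ^ 2 ≤ 4 * a ^ 2 + 4 * b ^ 2 := by
  rcases le_total a b with h | h
  · calc (a + b) ^ 2 ≤ (b + b) ^ 2 := by gcongr
      _ = 4 * b ^ 2 := by ring
      _ ≤ _ := le_add_self
  · calc (a + b) ^ 2 ≤ (a + a) ^ 2 := by gcongr
      _ = 4 * a ^ 2 := by ring
      _ ≤ _ := le_self_add

theorem ennreal_mul_le_sq_add_sq (a b : ℝ≥0∞) : a * b ≤ a ^ 2 + b ^ 2 := by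
  rcases le_total a b with h | h
  · calc a * b ≤ b * b := by gcongr
      _ = b ^ 2 := by ring
      _ ≤ _ := le_add_self
  · calc a * b ≤ a * a := by gcongr
      _ = a ^ 2 := by ring
      _ ≤ _ := le_self_add

theorem ae_sft_sub {H T : ℝ} {μ : Measure (Space d)} {φ ψ : ℝ × Space d → ℝ}
    (hφ : IsRegular μ H T φ) (hψ : IsRegular μ H T ψ) :
    ∀ᵐ u ∂volume.restrict (Ioo 0 T), ∀ ξ, sft (fun x => φ (u, x) - ψ (u, x)) ξ =
      sft (fun x => φ (u, x)) ξ - sft (fun x => ψ (u, x)) ξ := by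
  filter_upwards [hφ.slice, hψ.slice] with u hu hu' ξ
  obtain ⟨a, ha⟩ := hu
  obtain ⟨b, hb⟩ := hu'
  simp_rw [← ha, ← hb]
  exact sft_sub a.integrable b.integrable ξ

theorem IsRegular.sub {H T : ℝ} {μ : Measure (Space d)} {φ ψ : ℝ × Space d → ℝ}
    (hφ : IsRegular μ H T φ) (hψ : IsRegular μ H T ψ) :
    IsRegular μ H T (fun p => φ p - ψ p) where
  measurable := hφ.measurable.sub hψ.measurable
  slice := by
    filter_upwards [hφ.slice, hψ.slice] with u hu hu'
    obtain ⟨a, ha⟩ := hu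
    obtain ⟨b, hb⟩ := hu'
    exact ⟨a - b, fun x => by simp [ha, hb]⟩
  finite := by
    have hle : ∀ z, absFeature H T (fun p => φ p - ψ p) z ≤
        absFeature H T φ z + absFeature H T ψ z := by
      intro z
      have hm : Measurable fun u => ENNReal.ofReal (timeKernel H u z.1) *
          ‖sft (fun x => φ (u, x)) z.2‖ₑ := by
        have := ((measurable_feature_integrand H hφ.measurable).comp
          (measurable_const (a := z) |>.prodMk measurable_id)).enorm
        simpa only [Function.comp_def, enorm_timeKernel_mul, id] using this
      rw [absFeature, absFeature, absFeature, ← lintegral_add_left hm]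
      refine lintegral_mono_ae ?_
      filter_upwards [ae_sft_sub hφ hψ] with u hu
      rw [hu, ← mul_add]
      gcongr
      exact enorm_sub_le
    refine lt_of_le_of_lt (lintegral_mono fun z =>
      (pow_le_pow_left' (hle z) 2).trans (ennreal_add_sq_le _ _)) ?_
    rw [lintegral_add_left
      (((measurable_absFeature H T hφ.measurable).pow_const 2).const_mul 4),
      lintegral_const_mul _ ((measurable_absFeature H T hφ.measurable).pow_const 2),
      lintegral_const_mul _ ((measurable_absFeature H T hψ.measurable).pow_const 2)]
    exact ENNReal.add_lt_top.2 ⟨ENNReal.mul_lt_top (by norm_num) hφ.finite,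
      ENNReal.mul_lt_top (by norm_num) hψ.finite⟩

theorem feature_sub {H T : ℝ} {μ : Measure (Space d)} {φ ψ : ℝ × Space d → ℝ}
    (hφ : IsRegular μ H T φ) (hψ : IsRegular μ H T ψ) :
    feature H T (fun p => φ p - ψ p) =ᵐ[spectralMeasure μ]
      fun z => feature H T φ z - feature H T ψ z := by
  filter_upwards [hφ.ae_absFeature_lt_top, hψ.ae_absFeature_lt_top] with z h1 h2
  rw [feature, feature, feature, ← integral_sub (integrable_feature_integrand hφ.measurable h1)
    (integrable_feature_integrand hψ.measurable h2)]
  refine integral_congr_ae ?_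
  filter_upwards [ae_sft_sub hφ hψ] with u hu
  rw [hu, mul_sub]

/-- Fubini's theorem for a product of two integrals depending on the same parameter. -/
theorem integral_mul_integral_eq {Z : Type*} [MeasurableSpace Z] (ρ : Measure Z) [SFinite ρ]
    (S : Set ℝ) {A B : ℝ × Z → ℂ} (hA : Measurable A) (hB : Measurable B)
    (hfin : ∫⁻ z, (∫⁻ u in S, ‖A (u, z)‖ₑ) * (∫⁻ u in S, ‖B (u, z)‖ₑ) ∂ρ < ∞) :
    IntegrableOn (fun p : ℝ × ℝ => ∫ z, A (p.1, z) * B (p.2, z) ∂ρ) (S ×ˢ S) ∧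
    ∫ z, (∫ u in S, A (u, z)) * (∫ u in S, B (u, z)) ∂ρ =
      ∫ p in S ×ˢ S, ∫ z, A (p.1, z) * B (p.2, z) ∂ρ := by
  have hG : Measurable fun q : (ℝ × ℝ) × Z => A (q.1.1, q.2) * B (q.1.2, q.2) := by fun_prop
  have hGint : Integrable (Function.uncurry fun (p : ℝ × ℝ) (z : Z) => A (p.1, z) * B (p.2, z))
      ((volume.restrict (S ×ˢ S)).prod ρ) := by
    refine ⟨hG.aestronglyMeasurable, ?_⟩
    change ∫⁻ q : (ℝ × ℝ) × Z, ‖A (q.1.1, q.2) * B (q.1.2, q.2)‖ₑ ∂_ < ∞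
    rw [lintegral_prod_symm _ hG.enorm.aemeasurable]
    refine lt_of_le_of_lt (le_of_eq (lintegral_congr fun z => ?_)) hfin
    rw [← lintegral_prod_mul (f := fun u => ‖A (u, z)‖ₑ) (g := fun u => ‖B (u, z)‖ₑ)
        (by fun_prop) (by fun_prop), restrict_prod_self]
    exact lintegral_congr fun p => enorm_mul _ _
  refine ⟨hGint.integral_prod_left, ?_⟩
  rw [integral_integral_swap hGint]
  refine integral_congr_ae (Eventually.of_forall fun z => ?_)
  simp only
  rw [restrict_prod_self, integral_prod_mul (fun u => A (u, z)) (fun u => B (u, z))]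

/-- Integration over the spectral domain gives the time kernel times the spatial form. -/
theorem integral_spectral_eq {f : 𝓢(Space d, ℝ) →L[ℝ] ℝ} {μ : Measure (Space d)} [SFinite μ]
    (hf : IsFourierTransformOf f μ) {H : ℝ} (hH : 1 / 2 < H) (hH' : H < 1)
    {φ ψ : ℝ × Space d → ℝ} {p : ℝ × ℝ} (hp : p.1 ≠ p.2) {a b : 𝓢(Space d, ℝ)}
    (ha : ∀ x, a x = φ (p.1, x)) (hb : ∀ x, b x = ψ (p.2, x)) :
    ∫ z, ((timeKernel H p.1 z.1 : ℂ) * sft (fun x => φ (p.1, x)) z.2) *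
        starRingEnd ℂ ((timeKernel H p.2 z.1 : ℂ) * sft (fun x => ψ (p.2, x)) z.2)
        ∂spectralMeasure μ =
      ((H * (2 * H - 1) * hpIntegrand f H φ ψ p : ℝ) : ℂ) := by
  have e : ∀ z : ℝ × Space d, ((timeKernel H p.1 z.1 : ℂ) * sft (fun x => φ (p.1, x)) z.2) *
        starRingEnd ℂ ((timeKernel H p.2 z.1 : ℂ) * sft (fun x => ψ (p.2, x)) z.2) =
      ((timeKernel H p.1 z.1 * timeKernel H p.2 z.1 : ℝ) : ℂ) *
        (sft (fun x => φ (p.1, x)) z.2 * starRingEnd ℂ (sft (fun x => ψ (p.2, x)) z.2)) := by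
    intro z
    simp only [map_mul, Complex.conj_ofReal]
    push_cast
    ring
  simp_rw [e]
  rw [integral_prod_mul (fun w => ((timeKernel H p.1 w * timeKernel H p.2 w : ℝ) : ℂ))
      (fun ξ => sft (fun x => φ (p.1, x)) ξ * starRingEnd ℂ (sft (fun x => ψ (p.2, x)) ξ)),
    integral_complex_ofReal, (integrable_timeKernel_mul hH hH' hp).2,
    ← spatialForm_eq_integral_sft hf a b ha hb, hpIntegrand]
  push_cast
  ring

/-- The `HP` form in the spectral domain, together with the absolute convergence of the integral
that defines it. -/
theorem hpForm_eq_integral_feature {f : 𝓢(Space d, ℝ) →L[ℝ] ℝ} {μ : Measure (Space d)} [SFinite μ]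
    (hf : IsFourierTransformOf f μ) {H T : ℝ} (hH : 1 / 2 < H) (hH' : H < 1)
    {φ ψ : ℝ × Space d → ℝ} (hφ : IsRegular μ H T φ) (hψ : IsRegular μ H T ψ) :
    IntegrableOn (hpIntegrand f H φ ψ) (Ioo 0 T ×ˢ Ioo 0 T) ∧
    ((hpForm f H T φ ψ : ℝ) : ℂ) =
      ∫ z, feature H T φ z * starRingEnd ℂ (feature H T ψ z) ∂spectralMeasure μ := by
  have hα : 0 < H * (2 * H - 1) := mul_pos (by linarith) (by linarith)
  have hA := (measurable_feature_integrand H hφ.measurable).comp measurable_swap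
  have hB := Complex.continuous_conj.measurable.comp
    ((measurable_feature_integrand H hψ.measurable).comp measurable_swap)
  have hfin : ∫⁻ z, absFeature H T φ z * absFeature H T ψ z ∂spectralMeasure μ < ∞ := by
    refine lt_of_le_of_lt (lintegral_mono fun z => ennreal_mul_le_sq_add_sq _ _) ?_
    rw [lintegral_add_left ((measurable_absFeature H T hφ.measurable).pow_const 2)]
    exact ENNReal.add_lt_top.2 ⟨hφ.finite, hψ.finite⟩
  obtain ⟨h1, h2⟩ := integral_mul_integral_eq (spectralMeasure μ) (Ioo 0 T) hA hB (by
    refine lt_of_le_of_lt (le_of_eq (lintegral_congr fun z => ?_)) hfin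
    congr 1
    · exact lintegral_congr fun u => enorm_timeKernel_mul _ _ _ _
    · refine lintegral_congr fun u => ?_
      rw [← enorm_timeKernel_mul, ← ofReal_norm, ← ofReal_norm]
      exact congrArg _ (RCLike.norm_conj _))
  simp only [Function.comp_apply, Prod.swap_prod_mk] at h1 h2
  have hinner : ∀ᵐ p : ℝ × ℝ ∂volume.restrict (Ioo 0 T ×ˢ Ioo 0 T),
      ∫ z, ((timeKernel H p.1 z.1 : ℂ) * sft (fun x => φ (p.1, x)) z.2) *
        starRingEnd ℂ ((timeKernel H p.2 z.1 : ℂ) * sft (fun x => ψ (p.2, x)) z.2)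
        ∂spectralMeasure μ =
      ((H * (2 * H - 1) * hpIntegrand f H φ ψ p : ℝ) : ℂ) := by
    have hs1 : ∀ᵐ p : ℝ × ℝ ∂volume.restrict (Ioo 0 T ×ˢ Ioo 0 T),
        ∃ a : 𝓢(Space d, ℝ), ∀ x, a x = φ (p.1, x) := by
      rw [restrict_prod_self]
      exact Measure.quasiMeasurePreserving_fst.ae hφ.slice
    have hs2 : ∀ᵐ p : ℝ × ℝ ∂volume.restrict (Ioo 0 T ×ˢ Ioo 0 T),
        ∃ a : 𝓢(Space d, ℝ), ∀ x, a x = ψ (p.2, x) := by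
      rw [restrict_prod_self]
      exact Measure.quasiMeasurePreserving_snd.ae hψ.slice
    filter_upwards [hs1, hs2, ae_restrict_of_ae ae_fst_ne_snd] with p ⟨a, ha⟩ ⟨b, hb⟩ hp
    exact integral_spectral_eq hf hH hH' hp ha hb
  have hint : IntegrableOn (hpIntegrand f H φ ψ) (Ioo 0 T ×ˢ Ioo 0 T) := by
    have h3 : IntegrableOn (fun p => H * (2 * H - 1) * hpIntegrand f H φ ψ p)
        (Ioo 0 T ×ˢ Ioo 0 T) := by
      refine (h1.congr hinner).re.congr (Eventually.of_forall fun p => ?_)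
      simp only [RCLike.re_eq_complex_re, Complex.ofReal_re]
    exact (integrable_const_mul_iff (isUnit_iff_ne_zero.2 hα.ne') _).1 h3
  refine ⟨hint, ?_⟩
  rw [integral_congr_ae hinner, integral_complex_ofReal, integral_const_mul] at h2
  rw [hpForm, ← h2]
  refine integral_congr_ae (Eventually.of_forall fun z => ?_)
  simp only
  rw [integral_conj]
  rfl

/-- For regular functions the hypotheses in the definition of convergence in `HP` hold. -/
theorem IsRegular.hpFinite {f : 𝓢(Space d, ℝ) →L[ℝ] ℝ} {μ : Measure (Space d)} [SFinite μ]
    (hf : IsFourierTransformOf f μ) {H T : ℝ} (hH : 1 / 2 < H) (hH' : H < 1)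
    {φ : ℝ × Space d → ℝ} (hφ : IsRegular μ H T φ) : HPFinite f H T φ := by
  refine ⟨?_, (hpForm_eq_integral_feature hf hH hH' hφ hφ).1⟩
  rw [restrict_prod_self]
  filter_upwards [Measure.quasiMeasurePreserving_fst.ae hφ.slice,
    Measure.quasiMeasurePreserving_snd.ae hφ.slice] with p ⟨a, ha⟩ ⟨b, hb⟩
  obtain ⟨K, hK, -⟩ := exists_isCrossCorrelation a b
  refine ⟨K, ?_⟩
  have e1 : (fun x => φ (p.1, x)) = a := funext fun x => (ha x).symm
  have e2 : (fun x => φ (p.2, x)) = b := funext fun x => (hb x).symm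
  rw [e1, e2]
  exact hK

open Classical in
/-- The spectral representative as an element of `L²(dw ⊗ μ(dξ); ℂ)`, regarded as a real Hilbert
space. It is `0` if the representative is not square integrable. -/
def embed (μ : Measure (Space d)) (H T : ℝ) (φ : ℝ × Space d → ℝ) :
    Lp ℂ 2 (spectralMeasure μ) :=
  if h : MemLp (feature H T φ) 2 (spectralMeasure μ) then h.toLp else 0

theorem embed_coeFn {μ : Measure (Space d)} {H T : ℝ} {φ : ℝ × Space d → ℝ}
    (hφ : IsRegular μ H T φ) : embed μ H T φ =ᵐ[spectralMeasure μ] feature H T φ := by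
  rw [embed, dif_pos hφ.memLp]
  exact hφ.memLp.coeFn_toLp

theorem embed_sub {μ : Measure (Space d)} {H T : ℝ} {φ ψ : ℝ × Space d → ℝ}
    (hφ : IsRegular μ H T φ) (hψ : IsRegular μ H T ψ) :
    embed μ H T (fun p => φ p - ψ p) = embed μ H T φ - embed μ H T ψ := by
  refine Lp.ext ?_
  filter_upwards [embed_coeFn (hφ.sub hψ), feature_sub hφ hψ, embed_coeFn hφ, embed_coeFn hψ,
    Lp.coeFn_sub (embed μ H T φ) (embed μ H T ψ)] with z h1 h2 h3 h4 h5
  rw [h1, h2, h5, Pi.sub_apply, h3, h4]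

/-- The isometry behind everything: `embed` carries the `HP` form to the inner product of
`L²(dw ⊗ μ(dξ))`. -/
theorem hpForm_eq_inner {f : 𝓢(Space d, ℝ) →L[ℝ] ℝ} {μ : Measure (Space d)} [SFinite μ]
    (hf : IsFourierTransformOf f μ) {H T : ℝ} (hH : 1 / 2 < H) (hH' : H < 1)
    {φ ψ : ℝ × Space d → ℝ} (hφ : IsRegular μ H T φ) (hψ : IsRegular μ H T ψ) :
    hpForm f H T φ ψ = inner ℝ (embed μ H T φ) (embed μ H T ψ) := by
  have h := (hpForm_eq_integral_feature hf hH hH' hφ hψ).2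
  have hint : Integrable (fun z => feature H T φ z * starRingEnd ℂ (feature H T ψ z))
      (spectralMeasure μ) := by
    refine hφ.memLp.integrable_mul (q := 2) ?_
    exact hψ.memLp.star
  have h2 : hpForm f H T φ ψ = ∫ z, (feature H T φ z * starRingEnd ℂ (feature H T ψ z)).re
      ∂spectralMeasure μ := by
    rw [← Complex.ofReal_re (hpForm f H T φ ψ), h]
    exact (integral_re hint).symm
  rw [h2, L2.inner_def]
  refine integral_congr_ae ?_
  filter_upwards [embed_coeFn hφ, embed_coeFn hψ] with z h3 h4
  rw [h3, h4, Complex.inner]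
  simp
  ring

theorem hpForm_self_eq {f : 𝓢(Space d, ℝ) →L[ℝ] ℝ} {μ : Measure (Space d)} [SFinite μ]
    (hf : IsFourierTransformOf f μ) {H T : ℝ} (hH : 1 / 2 < H) (hH' : H < 1)
    {φ ψ : ℝ × Space d → ℝ} (hφ : IsRegular μ H T φ) (hψ : IsRegular μ H T ψ) :
    hpForm f H T (fun p => φ p - ψ p) (fun p => φ p - ψ p) =
      ‖embed μ H T φ - embed μ H T ψ‖ ^ 2 := by
  rw [hpForm_eq_inner hf hH hH' (hφ.sub hψ) (hφ.sub hψ), embed_sub hφ hψ,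
    real_inner_self_eq_norm_sq]

theorem enorm_embed_sq {μ : Measure (Space d)} {H T : ℝ} {φ : ℝ × Space d → ℝ}
    (hφ : IsRegular μ H T φ) :
    ‖embed μ H T φ‖ₑ ^ 2 = ∫⁻ z, ‖feature H T φ z‖ₑ ^ 2 ∂spectralMeasure μ := by
  rw [Lp.enorm_def, eLpNorm_congr_ae (embed_coeFn hφ), eLpNorm_two_sq]

end Spectral

/-! ### Rapid decay of the spatial Fourier transform of test functions -/

section Decay

variable {d : ℕ}

/-- The derivatives of a slice are dominated by those of the function of space-time. -/
theorem norm_iteratedFDeriv_slice_le {F : Type*} [NormedAddCommGroup F] [NormedSpace ℝ F]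
    {W : ℝ × Space d → F} (hW : ContDiff ℝ (⊤ : ℕ∞) W) (n : ℕ) (u : ℝ) (x : Space d) :
    ‖iteratedFDeriv ℝ n (fun x => W (u, x)) x‖ ≤ ‖iteratedFDeriv ℝ n W (u, x)‖ := by
  let L : Space d →L[ℝ] ℝ × Space d := ContinuousLinearMap.inr ℝ ℝ (Space d)
  have e : (fun x => W (u, x)) = (fun p => W ((u, 0) + p)) ∘ L := by
    ext y
    simp [L]
  have hW' : ContDiff ℝ (⊤ : ℕ∞) fun p => W ((u, (0 : Space d)) + p) := by fun_prop
  rw [e, L.iteratedFDeriv_comp_right hW' x (i := n) (by exact_mod_cast le_top),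
    iteratedFDeriv_comp_add_left]
  refine (ContinuousMultilinearMap.norm_compContinuousLinearMap_le _ _).trans ?_
  have h1 : ‖L‖ ≤ 1 := ContinuousLinearMap.norm_inr_le_one ℝ ℝ (Space d)
  have h2 : (u, (0 : Space d)) + L x = (u, x) := by simp [L]
  rw [h2]
  refine mul_le_of_le_one_right (norm_nonneg _) ?_
  exact Finset.prod_le_one (fun _ _ => norm_nonneg _) fun _ _ => h1

theorem hasCompactSupport_slice {F : Type*} [NormedAddCommGroup F] {h : ℝ × Space d → F}
    (hc : HasCompactSupport h) (u : ℝ) : HasCompactSupport fun x => h (u, x) := by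
  refine HasCompactSupport.intro (hc.isCompact.image continuous_snd) fun x hx => ?_
  by_contra hne
  exact hx ⟨(u, x), subset_tsupport _ hne, rfl⟩

theorem exists_schwartz_slice {h : ℝ × Space d → ℝ} (hs : ContDiff ℝ (⊤ : ℕ∞) h)
    (hc : HasCompactSupport h) (u : ℝ) : ∃ ψ : 𝓢(Space d, ℝ), ∀ x, ψ x = h (u, x) := by
  have hs' : ContDiff ℝ (⊤ : ℕ∞) fun x => h (u, x) := by fun_prop
  exact ⟨(hasCompactSupport_slice hc u).toSchwartzMap hs', fun x => rfl⟩

/-- The Fourier transforms of the slices of a test function decay rapidly, uniformly in time. -/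
theorem exists_norm_sft_slice_le {h : ℝ × Space d → ℝ} (hs : ContDiff ℝ (⊤ : ℕ∞) h)
    (hc : HasCompactSupport h) (N : ℕ) :
    ∃ C, 0 ≤ C ∧ ∀ u ξ, ‖sft (fun x => h (u, x)) ξ‖ ≤ C * (1 + ‖ξ‖) ^ (-(N : ℝ)) := by
  let hC : ℝ × Space d → ℂ := fun p => (h p : ℂ)
  have hCs : ContDiff ℝ (⊤ : ℕ∞) hC := Complex.ofRealCLM.contDiff.comp hs
  have hCc : HasCompactSupport hC := hc.comp_left (g := fun r : ℝ => (r : ℂ)) (by simp)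
  obtain ⟨R, hR⟩ := hCc.isCompact.isBounded.subset_closedBall 0
  have hM : ∀ p : ℕ, ∃ M, 0 ≤ M ∧ ∀ q, ‖iteratedFDeriv ℝ p hC q‖ ≤ M := fun p => by
    obtain ⟨M, hM⟩ := (hCc.iteratedFDeriv (𝕜 := ℝ) p).exists_bound_of_continuous
      (hCs.continuous_iteratedFDeriv (m := p) (by exact_mod_cast le_top))
    exact ⟨M, (norm_nonneg _).trans (hM 0), hM⟩
  choose M hM0 hM using hM
  let V : ℝ := (volume : Measure (Space d)).real (Metric.closedBall 0 R)
  -- bound for the integrals of the derivatives of the slices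
  have hint : ∀ u p, ∫ x, ‖iteratedFDeriv ℝ p (fun x => hC (u, x)) x‖ ≤ M p * V := by
    intro u p
    have hle : ∀ x, ‖iteratedFDeriv ℝ p (fun x => hC (u, x)) x‖ ≤
        (Metric.closedBall (0 : Space d) R).indicator (fun _ => M p) x := by
      intro x
      have h1 := norm_iteratedFDeriv_slice_le hCs p u x
      by_cases hx : x ∈ Metric.closedBall (0 : Space d) R
      · rw [indicator_of_mem hx]
        exact h1.trans (hM p _)
      · rw [indicator_of_notMem hx]
        have : (u, x) ∉ tsupport hC := fun hmem => hx (by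
          have := hR hmem
          rw [mem_closedBall_zero_iff] at this ⊢
          exact (le_max_right _ _).trans this)
        have h0 : iteratedFDeriv ℝ p hC (u, x) = 0 := by
          by_contra hne
          exact this (support_iteratedFDeriv_subset p hne)
        rw [h0, norm_zero] at h1
        exact h1
    refine (integral_mono_of_nonneg (Eventually.of_forall fun x => norm_nonneg _) ?_
      (Eventually.of_forall hle)).trans (le_of_eq ?_)
    · exact (integrable_indicator_iff measurableSet_closedBall).2
        (integrableOn_const (measure_closedBall_lt_top.ne))
    · rw [integral_indicator_const _ measurableSet_closedBall, smul_eq_mul, mul_comm]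
  have hpow : ∀ n : ℕ, ∃ C, 0 ≤ C ∧ ∀ u w, ‖w‖ ^ n *
      ‖FourierTransform.fourier (fun x => hC (u, x)) w‖ ≤ C := by
    intro n
    refine ⟨2 ^ n * ∑ p ∈ Finset.range 1 ×ˢ Finset.range (n + 1), M p.2 * V, ?_, fun u w => ?_⟩
    · exact mul_nonneg (by positivity)
        (Finset.sum_nonneg fun p _ => mul_nonneg (hM0 p.2) measureReal_nonneg)
    have hsu : ContDiff ℝ (⊤ : ℕ∞) fun x => hC (u, x) := by fun_prop
    let S : 𝓢(Space d, ℂ) := (hasCompactSupport_slice hCc u).toSchwartzMap hsu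
    have hS : ⇑S = fun x => hC (u, x) := rfl
    have := Real.pow_mul_norm_iteratedFDeriv_fourier_le (K := 0) (N := ⊤) hsu
      (fun k m _ _ => by
        rw [← hS]
        exact S.integrable_pow_mul_iteratedFDeriv volume k m) (k := 0) (n := n) le_rfl le_top w
    rw [norm_iteratedFDeriv_zero] at this
    refine this.trans ?_
    simp only [pow_zero, one_mul, Nat.cast_zero, mul_zero, zero_add]
    refine mul_le_mul_of_nonneg_left (Finset.sum_le_sum fun p hp => ?_) (by positivity)
    have hp0 : p.1 = 0 := by
      have := (Finset.mem_product.1 hp).1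
      simpa using this
    simp only [hp0, pow_zero, one_mul]
    exact hint u p.2
  obtain ⟨C0, hC0, h0⟩ := hpow 0
  obtain ⟨CN, hCN, hN⟩ := hpow N
  refine ⟨2 ^ N * (C0 + (2 * Real.pi) ^ N * CN), by positivity, fun u ξ => ?_⟩
  rw [Real.rpow_neg (by positivity), Real.rpow_natCast, ← div_eq_mul_inv,
    le_div_iff₀ (by positivity), sft_eq_fourier]
  set F := ‖FourierTransform.fourier (fun x => hC (u, x)) ((2 * Real.pi)⁻¹ • ξ)‖ with hF
  have h1 : F ≤ C0 := by
    have := h0 u ((2 * Real.pi)⁻¹ • ξ)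
    rwa [pow_zero, one_mul] at this
  have h2 : ‖ξ‖ ^ N * F ≤ (2 * Real.pi) ^ N * CN := by
    have h3 := hN u ((2 * Real.pi)⁻¹ • ξ)
    rw [norm_smul, norm_inv, Real.norm_of_nonneg (by positivity), mul_pow, inv_pow, mul_assoc,
      inv_mul_le_iff₀ (by positivity)] at h3
    exact h3
  have h4 : (1 + ‖ξ‖) ^ N ≤ 2 ^ N * (1 + ‖ξ‖ ^ N) := by
    have h5 := add_pow_le (zero_le_one' ℝ) (norm_nonneg ξ) N
    rw [one_pow] at h5
    refine h5.trans (mul_le_mul_of_nonneg_right ?_ (by positivity))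
    exact pow_le_pow_right₀ (by norm_num) (by omega)
  calc F * (1 + ‖ξ‖) ^ N ≤ F * (2 ^ N * (1 + ‖ξ‖ ^ N)) := by gcongr
    _ = 2 ^ N * (F + ‖ξ‖ ^ N * F) := by ring
    _ ≤ _ := by gcongr

/-- The energy of a function whose Fourier transforms decay is finite. -/
theorem lintegral_decay_lt_top (μ : Measure (Space d)) [μ.HasTemperateGrowth] [SFinite μ] {H : ℝ}
    (hH : 1 / 2 < H) (hH' : H < 1) {T : ℝ} (hT : 0 < T) (C : ℝ) :
    ∫⁻ z, (∫⁻ u in Ioo 0 T, ENNReal.ofReal (timeKernel H u z.1) *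
      ENNReal.ofReal (C * (1 + ‖z.2‖) ^ (-(μ.integrablePower : ℝ)))) ^ 2
        ∂spectralMeasure μ < ∞ := by
  rw [lintegral_sq_timeKernel μ hH hH' (Ioo 0 T)
    (fun _ ξ => ENNReal.ofReal (C * (1 + ‖ξ‖) ^ (-(μ.integrablePower : ℝ)))) (by fun_prop)]
  rw [lintegral_mul_const _ (by fun_prop)]
  refine ENNReal.mul_lt_top ?_ ?_
  · have hα : 0 ≤ H * (2 * H - 1) := mul_nonneg (by linarith) (by linarith)
    simp_rw [ENNReal.ofReal_mul hα]
    rw [lintegral_const_mul _ (by fun_prop)]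
    refine ENNReal.mul_lt_top ENNReal.ofReal_lt_top ?_
    have := lintegral_energy_lt_top (β := 0) hH le_rfl (by linarith) hT
    simpa using this
  · have hi := (Measure.integrable_pow_neg_integrablePower μ).const_mul (C ^ 2)
    refine lt_of_le_of_lt (lintegral_mono fun ξ => ?_) hi.lintegral_lt_top
    rcases le_or_gt 0 C with hC | hC
    · have h0 : 0 ≤ (1 + ‖ξ‖) ^ (-(μ.integrablePower : ℝ)) := by positivity
      have h1 : (1 + ‖ξ‖) ^ (-(μ.integrablePower : ℝ)) ≤ 1 :=
        Real.rpow_le_one_of_one_le_of_nonpos (by linarith [norm_nonneg ξ]) (by simp)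
      rw [← ENNReal.ofReal_mul (by positivity)]
      refine ENNReal.ofReal_le_ofReal ?_
      calc _ = C ^ 2 * ((1 + ‖ξ‖) ^ (-(μ.integrablePower : ℝ)) *
            (1 + ‖ξ‖) ^ (-(μ.integrablePower : ℝ))) := by ring
        _ ≤ C ^ 2 * ((1 + ‖ξ‖) ^ (-(μ.integrablePower : ℝ)) * 1) := by gcongr
        _ = _ := by rw [mul_one]
    · rw [ENNReal.ofReal_of_nonpos, zero_mul]
      · exact bot_le
      · exact mul_nonpos_of_nonpos_of_nonneg hC.le (by positivity)

/-- Decay of order `μ.integrablePower` is enough for regularity, since `μ` integrates it. -/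
theorem isRegular_of_decay {μ : Measure (Space d)} [μ.HasTemperateGrowth] [SFinite μ] {H : ℝ}
    (hH : 1 / 2 < H) (hH' : H < 1) {T : ℝ} (hT : 0 < T) {φ : ℝ × Space d → ℝ} (hm : Measurable φ)
    (hs : ∀ᵐ u ∂volume.restrict (Ioo 0 T), ∃ ψ : 𝓢(Space d, ℝ), ∀ x, ψ x = φ (u, x)) {C : ℝ}
    (hC : ∀ u ∈ Ioo 0 T, ∀ ξ, ‖sft (fun x => φ (u, x)) ξ‖ ≤
      C * (1 + ‖ξ‖) ^ (-(μ.integrablePower : ℝ))) : IsRegular μ H T φ where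
  measurable := hm
  slice := hs
  finite := by
    refine lt_of_le_of_lt (lintegral_mono fun z => ?_) (lintegral_decay_lt_top μ hH hH' hT C)
    refine pow_le_pow_left' (setLIntegral_mono' measurableSet_Ioo fun u hu => ?_) 2
    gcongr
    rw [← ofReal_norm]
    exact ENNReal.ofReal_le_ofReal (hC u hu z.2)

theorem isRegular_of_contDiff {μ : Measure (Space d)} [μ.HasTemperateGrowth] [SFinite μ] {H : ℝ}
    (hH : 1 / 2 < H) (hH' : H < 1) {T : ℝ} (hT : 0 < T) {h : ℝ × Space d → ℝ}
    (hs : ContDiff ℝ (⊤ : ℕ∞) h) (hc : HasCompactSupport h) : IsRegular μ H T h := by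
  obtain ⟨C, -, hC⟩ := exists_norm_sft_slice_le hs hc μ.integrablePower
  exact isRegular_of_decay hH hH' hT hs.continuous.measurable
    (Eventually.of_forall fun u => exists_schwartz_slice hs hc u) fun u _ ξ => hC u ξ

theorem isRegular_testFunction {μ : Measure (Space d)} [μ.HasTemperateGrowth] [SFinite μ] {H : ℝ}
    (hH : 1 / 2 < H) (hH' : H < 1) {T : ℝ} (hT : 0 < T) (η : 𝓓(domain d T, ℝ)) :
    IsRegular μ H T η :=
  isRegular_of_contDiff hH hH' hT η.contDiff η.hasCompactSupport

end Decay

/-! ### The energy of the heat kernel -/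

section HeatEnergy

variable {d : ℕ}

/-- The modulus of the Fourier transform of `g_{tx}(u, ·)`. -/
def heatAmplitude (t u : ℝ) (ξ : Space d) : ℝ :=
  if u < t then Real.exp (-(t - u) * ‖ξ‖ ^ 2) else 0

theorem heatAmplitude_nonneg (t u : ℝ) (ξ : Space d) : 0 ≤ heatAmplitude t u ξ := by
  unfold heatAmplitude
  split_ifs
  · positivity
  · rfl

theorem heatAmplitude_le_one (t u : ℝ) (ξ : Space d) : heatAmplitude t u ξ ≤ 1 := by
  unfold heatAmplitude
  split_ifs with h
  · rw [Real.exp_le_one_iff]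
    nlinarith [sq_nonneg ‖ξ‖]
  · exact zero_le_one

theorem measurable_heatAmplitude :
    Measurable fun p : ℝ × ℝ × Space d => heatAmplitude p.1 p.2.1 p.2.2 := by
  unfold heatAmplitude
  exact Measurable.ite (measurableSet_lt (by fun_prop) (by fun_prop)) (by fun_prop) (by fun_prop)

theorem sft_gKernel (t : ℝ) (x : Space d) (u : ℝ) (ξ : Space d) :
    sft (fun y => gKernel t x (u, y)) ξ =
      Complex.exp (-Complex.I * (inner ℝ ξ x : ℝ)) * (heatAmplitude t u ξ : ℂ) := by
  unfold gKernel heatAmplitude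
  split_ifs with h
  · exact sft_heatKernel (sub_pos.2 h) x ξ
  · rw [Complex.ofReal_zero, mul_zero]
    exact sft_heatKernel_of_nonpos (sub_nonpos.2 (not_lt.1 h)) x ξ

theorem norm_sft_gKernel (t : ℝ) (x : Space d) (u : ℝ) (ξ : Space d) :
    ‖sft (fun y => gKernel t x (u, y)) ξ‖ = heatAmplitude t u ξ := by
  rw [sft_gKernel, norm_mul, norm_exp_neg_I_mul, one_mul, Complex.norm_real,
    Real.norm_of_nonneg (heatAmplitude_nonneg t u ξ)]

theorem enorm_sft_gKernel (t : ℝ) (x : Space d) (u : ℝ) (ξ : Space d) :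
    ‖sft (fun y => gKernel t x (u, y)) ξ‖ₑ = ENNReal.ofReal (heatAmplitude t u ξ) := by
  rw [← ofReal_norm, norm_sft_gKernel]

theorem measurable_gKernel : Measurable fun q : (ℝ × Space d) × (ℝ × Space d) =>
    gKernel q.1.1 q.1.2 q.2 := by
  unfold gKernel
  exact measurable_heatKernel.comp
    (by fun_prop : Measurable fun q : (ℝ × Space d) × (ℝ × Space d) =>
    (q.1.1 - q.2.1, q.1.2 - q.2.2))

theorem exists_schwartz_gKernel (t : ℝ) (x : Space d) (u : ℝ) :
    ∃ ψ : 𝓢(Space d, ℝ), ∀ y, ψ y = gKernel t x (u, y) :=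
  exists_schwartz_heatKernel (t - u) x

theorem absFeature_gKernel (H T t : ℝ) (x : Space d) (z : ℝ × Space d) :
    absFeature H T (gKernel t x) z = ∫⁻ u in Ioo 0 T,
      ENNReal.ofReal (timeKernel H u z.1) * ENNReal.ofReal (heatAmplitude t u z.2) := by
  simp_rw [absFeature, enorm_sft_gKernel]

/-- The spectral representative of `g_{tx}` has constant phase in time, so that nothing is lost by
taking absolute values inside the integral. -/
theorem enorm_feature_gKernel {H : ℝ} (hH : 1 / 2 < H) (T t : ℝ) (x : Space d) (z : ℝ × Space d) :
    ‖feature H T (gKernel t x) z‖ₑ = absFeature H T (gKernel t x) z := by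
  have hm : Measurable fun u => timeKernel H u z.1 * heatAmplitude t u z.2 :=
    ((measurable_timeKernel H).comp (measurable_id.prodMk measurable_const)).mul
      (measurable_heatAmplitude.comp
        (measurable_const.prodMk (measurable_id.prodMk measurable_const)))
  have h0 : ∀ u, 0 ≤ timeKernel H u z.1 * heatAmplitude t u z.2 := fun u =>
    mul_nonneg (timeKernel_nonneg _ _ _) (heatAmplitude_nonneg _ _ _)
  have hint : IntegrableOn (fun u => timeKernel H u z.1 * heatAmplitude t u z.2) (Ioo 0 T) := by
    refine (integrableOn_timeKernel hH z.1 T).mono' hm.aestronglyMeasurable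
      (Eventually.of_forall fun u => ?_)
    rw [Real.norm_of_nonneg (h0 u)]
    exact mul_le_of_le_one_right (timeKernel_nonneg _ _ _) (heatAmplitude_le_one _ _ _)
  have e : feature H T (gKernel t x) z = Complex.exp (-Complex.I * (inner ℝ z.2 x : ℝ)) *
      ((∫ u in Ioo 0 T, timeKernel H u z.1 * heatAmplitude t u z.2 : ℝ) : ℂ) := by
    rw [← integral_complex_ofReal, ← integral_const_mul, feature]
    refine integral_congr_ae (Eventually.of_forall fun u => ?_)
    simp only [sft_gKernel]
    push_cast
    ring
  rw [e, enorm_mul, ← ofReal_norm, norm_exp_neg_I_mul, ENNReal.ofReal_one, one_mul,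
    absFeature_gKernel, ← ofReal_norm, Complex.norm_real, Real.norm_of_nonneg
      (integral_nonneg h0), ofReal_integral_eq_lintegral_ofReal hint (Eventually.of_forall h0)]
  refine lintegral_congr fun u => ?_
  rw [ENNReal.ofReal_mul (timeKernel_nonneg _ _ _)]

/-- `I_{f,tx}(r, s) = ∫ exp (-(2t - r - s)|ξ|²) μ(dξ)`. -/
theorem lintegral_heatAmplitude_mul {f : 𝓢(Space d, ℝ) →L[ℝ] ℝ} {μ : Measure (Space d)}
    [μ.HasTemperateGrowth] (hf : IsFourierTransformOf f μ) {t r s : ℝ} (hr : r < t) (hs : s < t)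
    (x : Space d) :
    ∫⁻ ξ, ENNReal.ofReal (heatAmplitude t s ξ) * ENNReal.ofReal (heatAmplitude t r ξ) ∂μ =
      ENNReal.ofReal (Iform f t x r s) := by
  have hτ : 0 < 2 * t - r - s := by linarith
  have e1 : ∀ ξ : Space d, heatAmplitude t s ξ * heatAmplitude t r ξ =
      Real.exp (-(2 * t - r - s) * ‖ξ‖ ^ 2) := by
    intro ξ
    rw [heatAmplitude, heatAmplitude, if_pos hs, if_pos hr, ← Real.exp_add]
    congr 1
    ring
  obtain ⟨ψ, hψ⟩ := exists_schwartz_gaussian (d := d) hτ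
  have hint : Integrable (fun ξ : Space d => Real.exp (-(2 * t - r - s) * ‖ξ‖ ^ 2)) μ :=
    (ψ.integrable (μ := μ)).congr (Eventually.of_forall hψ)
  have h1 : Iform f t x r s = ∫ ξ, Real.exp (-(2 * t - r - s) * ‖ξ‖ ^ 2) ∂μ := by
    obtain ⟨a, ha⟩ := exists_schwartz_gKernel t x s
    obtain ⟨b, hb⟩ := exists_schwartz_gKernel t x r
    have := spatialForm_eq_integral_sft hf a b ha hb
    rw [← Iform] at this
    have h2 : ∀ ξ, sft (fun y => gKernel t x (s, y)) ξ *
        starRingEnd ℂ (sft (fun y => gKernel t x (r, y)) ξ) =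
        ((Real.exp (-(2 * t - r - s) * ‖ξ‖ ^ 2) : ℝ) : ℂ) := by
      intro ξ
      rw [← e1, sft_gKernel, sft_gKernel, map_mul, Complex.conj_ofReal, ← Complex.exp_conj]
      push_cast
      have : Complex.exp (-Complex.I * (inner ℝ ξ x : ℝ)) *
          Complex.exp (starRingEnd ℂ (-Complex.I * (inner ℝ ξ x : ℝ))) = 1 := by
        rw [← Complex.exp_add]
        simp
      linear_combination ((heatAmplitude t s ξ : ℂ) * heatAmplitude t r ξ) * this
    simp_rw [h2] at this
    rw [integral_complex_ofReal] at this
    exact_mod_cast this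
  rw [h1, ofReal_integral_eq_lintegral_ofReal hint
    (Eventually.of_forall fun _ => Real.exp_nonneg _)]
  refine lintegral_congr fun ξ => ?_
  rw [← e1, ENNReal.ofReal_mul (heatAmplitude_nonneg _ _ _)]

/-- The energy of `g_{tx}` is the double integral over time of `α_H |u - v|^(2H-2)` times
`∫ exp (-(2t - u - v)|ξ|²) μ(dξ)`. -/
theorem lintegral_absFeature_gKernel {μ : Measure (Space d)} [SFinite μ] {H : ℝ} (hH : 1 / 2 < H)
    (hH' : H < 1) (T t : ℝ) (x : Space d) :
    ∫⁻ z, absFeature H T (gKernel t x) z ^ 2 ∂spectralMeasure μ =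
      ∫⁻ p in Ioo 0 T ×ˢ Ioo 0 T, ENNReal.ofReal (H * (2 * H - 1) * |p.1 - p.2| ^ (2 * H - 2)) *
        ∫⁻ ξ, ENNReal.ofReal (heatAmplitude t p.1 ξ) *
          ENNReal.ofReal (heatAmplitude t p.2 ξ) ∂μ := by
  simp_rw [absFeature_gKernel]
  exact lintegral_sq_timeKernel μ hH hH' (Ioo 0 T)
    (fun u ξ => ENNReal.ofReal (heatAmplitude t u ξ)) (measurable_heatAmplitude.comp
      (measurable_const.prodMk measurable_id)).ennreal_ofReal

/-- The energy of the heat kernel is bounded if `H` is above the critical value. -/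
theorem exists_lintegral_absFeature_gKernel_le {f : 𝓢(Space d, ℝ) →L[ℝ] ℝ} {μ : Measure (Space d)}
    [μ.HasTemperateGrowth] [SFinite μ] (hf : IsFourierTransformOf f μ) {H : ℝ} (hH : 1 / 2 < H)
    (hH' : H < 1) {T : ℝ} (hT : 0 < T) {β Bf : ℝ} (hβ : 0 ≤ β) (hβH : β < 2 * H)
    (hI : ∀ t ∈ Icc 0 T, ∀ s ∈ Ico 0 t, ∀ r ∈ Ico 0 t, ∀ x : Space d,
      Iform f t x r s ≤ Bf * (2 * t - r - s) ^ (-β)) :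
    ∃ C : ℝ≥0, ∀ t ∈ Icc 0 T, ∀ x : Space d,
      ∫⁻ z, absFeature H T (gKernel t x) z ^ 2 ∂spectralMeasure μ ≤ C := by
  have hα : 0 ≤ H * (2 * H - 1) := mul_nonneg (by linarith) (by linarith)
  -- After the substitution of `t - u` for `u` and `t - v` for `v`, the integrand is bounded by the
  -- same function `E` for all `t` and `x`.
  let E : ℝ × ℝ → ℝ≥0∞ := fun q => ENNReal.ofReal (H * (2 * H - 1)) * (ENNReal.ofReal Bf *
    (Ioo 0 T ×ˢ Ioo 0 T).indicator (fun q : ℝ × ℝ =>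
      ENNReal.ofReal (|q.1 - q.2| ^ (2 * H - 2) * (q.1 + q.2) ^ (-β))) q)
  have hE : ∫⁻ q, E q < ∞ := by
    have hmeas : Measurable fun q : ℝ × ℝ =>
      ENNReal.ofReal (|q.1 - q.2| ^ (2 * H - 2) * (q.1 + q.2) ^ (-β)) := by fun_prop
    have hset : MeasurableSet (Ioo 0 T ×ˢ Ioo 0 T : Set (ℝ × ℝ)) :=
      measurableSet_Ioo.prod measurableSet_Ioo
    rw [lintegral_const_mul' _ _ ENNReal.ofReal_ne_top, lintegral_const_mul' _ _
      ENNReal.ofReal_ne_top, lintegral_indicator hset]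
    exact ENNReal.mul_lt_top ENNReal.ofReal_lt_top (ENNReal.mul_lt_top ENNReal.ofReal_lt_top
      (lintegral_energy_lt_top hH hβ hβH hT))
  refine ⟨(∫⁻ q, E q).toNNReal, fun t ht x => ?_⟩
  rw [ENNReal.coe_toNNReal hE.ne, lintegral_absFeature_gKernel hH hH',
    ← lintegral_sub_left_eq_self E (t, t)]
  refine (setLIntegral_mono' (measurableSet_Ioo.prod measurableSet_Ioo) fun p hp => ?_).trans
    (setLIntegral_le_lintegral (Ioo 0 T ×ˢ Ioo 0 T) _)
  obtain ⟨⟨h1, h1'⟩, ⟨h2, h2'⟩⟩ := hp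
  by_cases hlt : p.1 < t ∧ p.2 < t
  · obtain ⟨h3, h4⟩ := hlt
    have hmem : ((t, t) - p : ℝ × ℝ) ∈ (Ioo 0 T ×ˢ Ioo 0 T : Set (ℝ × ℝ)) := by
      simp only [mem_prod, mem_Ioo, Prod.fst_sub, Prod.snd_sub]
      refine ⟨⟨?_, ?_⟩, ?_, ?_⟩ <;> linarith [ht.2]
    simp only [E]
    rw [indicator_of_mem hmem, lintegral_heatAmplitude_mul hf h4 h3 x, ENNReal.ofReal_mul hα,
      mul_assoc]
    simp only [Prod.fst_sub, Prod.snd_sub]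
    gcongr _ * ?_
    have h5 : 0 ≤ |p.1 - p.2| ^ (2 * H - 2) := by positivity
    rw [sub_sub_sub_cancel_left, abs_sub_comm p.2 p.1, ENNReal.ofReal_mul h5, mul_left_comm]
    gcongr _ * ?_
    have hpos : 0 ≤ (t - p.1 + (t - p.2)) ^ (-β) := Real.rpow_nonneg (by linarith) _
    rw [← ENNReal.ofReal_mul' hpos]
    refine ENNReal.ofReal_le_ofReal
      ((hI t ht p.1 ⟨h1.le, h3⟩ p.2 ⟨h2.le, h4⟩ x).trans (le_of_eq ?_))
    congr 2
    ring
  -- The kernel `g_{tx}` vanishes from the time `t` on.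
  · have : ∀ ξ : Space d, ENNReal.ofReal (heatAmplitude t p.1 ξ) *
        ENNReal.ofReal (heatAmplitude t p.2 ξ) = 0 := by
      intro ξ
      by_cases h3 : p.1 < t
      · have h4 : ¬ p.2 < t := fun h => hlt ⟨h3, h⟩
        rw [heatAmplitude, heatAmplitude, if_neg h4]
        simp
      · rw [heatAmplitude, if_neg h3]
        simp
    simp [this]

/-- The energy of the heat kernel is infinite if `H` is at or below the critical value. -/
theorem lintegral_absFeature_gKernel_eq_top {f : 𝓢(Space d, ℝ) →L[ℝ] ℝ} {μ : Measure (Space d)}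
    [μ.HasTemperateGrowth] [SFinite μ] (hf : IsFourierTransformOf f μ) {H : ℝ} (hH : 1 / 2 < H)
    (hH' : H < 1) {T : ℝ} (hT : 0 < T) {β A : ℝ} (hA : 0 < A) (hβH : 2 * H ≤ β) (x : Space d)
    (hI : ∀ s ∈ Ico 0 T, ∀ r ∈ Ico 0 T, A * (2 * T - s - r) ^ (-β) ≤ Iform f T x r s) :
    ∫⁻ z, absFeature H T (gKernel T x) z ^ 2 ∂spectralMeasure μ = ∞ := by
  have hα : 0 < H * (2 * H - 1) := mul_pos (by linarith) (by linarith)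
  have hset : MeasurableSet (Ioo 0 T ×ˢ Ioo 0 T : Set (ℝ × ℝ)) :=
    measurableSet_Ioo.prod measurableSet_Ioo
  let E : ℝ × ℝ → ℝ≥0∞ := fun q => ENNReal.ofReal (H * (2 * H - 1)) * (ENNReal.ofReal A *
    (Ioo 0 T ×ˢ Ioo 0 T).indicator (fun q : ℝ × ℝ =>
      ENNReal.ofReal (|q.1 - q.2| ^ (2 * H - 2) * (q.1 + q.2) ^ (-β))) q)
  have hE : ∫⁻ q, E q = ∞ := by
    have hmeas : Measurable fun q : ℝ × ℝ =>
      ENNReal.ofReal (|q.1 - q.2| ^ (2 * H - 2) * (q.1 + q.2) ^ (-β)) := by fun_prop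
    rw [lintegral_const_mul' _ _ ENNReal.ofReal_ne_top, lintegral_const_mul' _ _
      ENNReal.ofReal_ne_top, lintegral_indicator hset, lintegral_energy_eq_top hH hH' hβH hT,
      ENNReal.mul_top (ENNReal.ofReal_pos.2 hA).ne', ENNReal.mul_top (ENNReal.ofReal_pos.2 hα).ne']
  rw [eq_top_iff, ← hE, lintegral_absFeature_gKernel hH hH', ← lintegral_sub_left_eq_self E (T, T),
    ← lintegral_indicator hset]
  refine lintegral_mono fun p => ?_
  by_cases hp : p ∈ (Ioo 0 T ×ˢ Ioo 0 T : Set (ℝ × ℝ))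
  · rw [indicator_of_mem hp]
    obtain ⟨⟨h1, h1'⟩, ⟨h2, h2'⟩⟩ := hp
    have hmem : ((T, T) - p : ℝ × ℝ) ∈ (Ioo 0 T ×ˢ Ioo 0 T : Set (ℝ × ℝ)) := by
      simp only [mem_prod, mem_Ioo, Prod.fst_sub, Prod.snd_sub]
      refine ⟨⟨?_, ?_⟩, ?_, ?_⟩ <;> linarith
    simp only [E]
    rw [indicator_of_mem hmem, lintegral_heatAmplitude_mul hf h2' h1' x, ENNReal.ofReal_mul hα.le,
      mul_assoc]
    simp only [Prod.fst_sub, Prod.snd_sub]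
    gcongr _ * ?_
    have h5 : 0 ≤ |p.1 - p.2| ^ (2 * H - 2) := by positivity
    rw [sub_sub_sub_cancel_left, abs_sub_comm p.2 p.1, ENNReal.ofReal_mul h5, mul_left_comm]
    gcongr _ * ?_
    rw [← ENNReal.ofReal_mul hA.le]
    refine ENNReal.ofReal_le_ofReal (le_trans (le_of_eq ?_) (hI p.1 ⟨h1.le, h1'⟩ p.2 ⟨h2.le, h2'⟩))
    congr 2
    ring
  · have hmem : ((T, T) - p : ℝ × ℝ) ∉ (Ioo 0 T ×ˢ Ioo 0 T : Set (ℝ × ℝ)) := by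
      intro h
      simp only [mem_prod, mem_Ioo, Prod.fst_sub, Prod.snd_sub] at h hp
      exact hp ⟨⟨by linarith [h.1.2], by linarith [h.1.1]⟩,
        by linarith [h.2.2], by linarith [h.2.1]⟩
    simp only [E]
    rw [indicator_of_notMem hmem, mul_zero, mul_zero]
    exact bot_le

theorem isRegular_gKernel {μ : Measure (Space d)} {H T t : ℝ} {x : Space d}
    (h : ∫⁻ z, absFeature H T (gKernel t x) z ^ 2 ∂spectralMeasure μ < ∞) :
    IsRegular μ H T (gKernel t x) where
  measurable := measurable_gKernel.comp (measurable_const (a := (t, x)) |>.prodMk measurable_id)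
  slice := Eventually.of_forall fun u => exists_schwartz_gKernel t x u
  finite := h

theorem stronglyMeasurable_feature_gKernel (H T : ℝ) :
    StronglyMeasurable fun q : (ℝ × Space d) × (ℝ × Space d) =>
      feature H T (gKernel q.1.1 q.1.2) q.2 := by
  have : Measurable fun q : ((ℝ × Space d) × (ℝ × Space d)) × ℝ =>
      (timeKernel H q.2 q.1.2.1 : ℂ) * (Complex.exp (-Complex.I * (inner ℝ q.1.2.2 q.1.1.2 : ℝ)) *
        (heatAmplitude q.1.1.1 q.2 q.1.2.2 : ℂ)) := by
    refine (Complex.measurable_ofReal.comp ((measurable_timeKernel H).comp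
      (by fun_prop : Measurable fun q : ((ℝ × Space d) × (ℝ × Space d)) × ℝ =>
        (q.2, q.1.2.1)))).mul (Measurable.mul (by fun_prop) ?_)
    exact Complex.measurable_ofReal.comp (measurable_heatAmplitude.comp
      (by fun_prop : Measurable fun q : ((ℝ × Space d) × (ℝ × Space d)) × ℝ =>
        (q.1.1.1, q.2, q.1.2.2)))
  simp_rw [feature, sft_gKernel]
  exact this.stronglyMeasurable.integral_prod_right

end HeatEnergy

/-! ### The convolution with the reflected heat kernel -/

section Convolution

open scoped Convolution

variable {d : ℕ}

/-- The volume of space-time is defined as a product measure, but instance search does not unfold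
it to find that it is a Haar measure. -/
instance isAddHaarMeasure_spaceTime (d : ℕ) :
    (volume : Measure (ℝ × Space d)).IsAddHaarMeasure :=
  Measure.prod.instIsAddHaarMeasure volume volume

/-- The reflected heat kernel `(t, x) ↦ G(-t, -x)` on space-time. -/
def reflectedHeat (q : ℝ × Space d) : ℝ := heatKernel d (-q.1) (-q.2)

theorem integrable_indicator_heatKernel (a b c : ℝ) :
    Integrable fun q : ℝ × Space d =>
      (Icc a b).indicator (fun _ => (1 : ℝ)) q.1 * heatKernel d (c * q.1) q.2 := by
  have hm : Measurable fun q : ℝ × Space d =>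
      (Icc a b).indicator (fun _ => (1 : ℝ)) q.1 * heatKernel d (c * q.1) q.2 := by
    refine Measurable.mul ?_ (measurable_heatKernel.comp
      (by fun_prop : Measurable fun q : ℝ × Space d => (c * q.1, q.2)))
    exact (measurable_const.indicator measurableSet_Icc).comp measurable_fst
  refine ⟨hm.aestronglyMeasurable, ?_⟩
  rw [HasFiniteIntegral, Measure.volume_eq_prod, lintegral_prod _ hm.enorm.aemeasurable]
  have hle : ∀ t : ℝ, ∫⁻ y : Space d, ‖(Icc a b).indicator (fun _ => (1 : ℝ)) t *
      heatKernel d (c * t) y‖ₑ ≤ (Icc a b).indicator (fun _ => (1 : ℝ≥0∞)) t := by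
    intro t
    by_cases ht : t ∈ Icc a b
    · rw [indicator_of_mem ht, indicator_of_mem ht]
      rcases le_or_gt (c * t) 0 with h | h
      · simp [heatKernel_of_nonpos h]
      · rw [← lintegral_heatKernel (d := d) h]
        refine lintegral_mono fun y => le_of_eq ?_
        rw [one_mul, ← ofReal_norm, Real.norm_of_nonneg (heatKernel_nonneg _ _)]
    · rw [indicator_of_notMem ht]
      simp
  refine lt_of_le_of_lt (lintegral_mono hle) ?_
  rw [lintegral_indicator_const measurableSet_Icc, one_mul]
  exact measure_Icc_lt_top

theorem locallyIntegrable_reflectedHeat : LocallyIntegrable (reflectedHeat (d := d)) := by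
  refine locallyIntegrable_iff.2 fun K hK => ?_
  obtain ⟨R, hR⟩ := hK.isBounded.subset_closedBall 0
  refine ((integrable_indicator_heatKernel (d := d) (-R) R (-1)).integrableOn (s := K)).congr_fun
    (fun q hq => ?_) hK.measurableSet
  have h1 : q.1 ∈ Icc (-R) R := by
    have h2 := hR hq
    rw [mem_closedBall_zero_iff] at h2
    exact abs_le.1 ((le_max_left _ _).trans h2)
  simp only [reflectedHeat, heatKernel_neg]
  rw [indicator_of_mem h1, one_mul, neg_one_mul]

/-- The convolution of a compactly supported function of space-time with the reflected heat kernel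
decays rapidly in space. The values are vectors, so that the bound applies to derivatives of the
function as well. -/
theorem exists_pow_mul_norm_convolution_le {F : Type} [NormedAddCommGroup F] [NormedSpace ℝ F]
    {h : ℝ × Space d → F} (hcont : Continuous h) (hc : HasCompactSupport h) (t : ℝ) (k : ℕ) :
    ∃ C, ∀ x, ‖x‖ ^ k *
      ‖(reflectedHeat ⋆[ContinuousLinearMap.lsmul ℝ ℝ, volume] h) (t, x)‖ ≤ C := by
  obtain ⟨R, hR0, hR⟩ : ∃ R : ℝ, 0 ≤ R ∧ tsupport h ⊆ Metric.closedBall 0 R := by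
    obtain ⟨R, hR⟩ := hc.isCompact.isBounded.subset_closedBall 0
    exact ⟨max R 0, le_max_right _ _,
      hR.trans (Metric.closedBall_subset_closedBall (le_max_left _ _))⟩
  obtain ⟨M, hM⟩ := hc.exists_bound_of_continuous hcont
  have hM0 : 0 ≤ M := (norm_nonneg _).trans (hM 0)
  set S := R + |t| + 1 with hS
  have hSpos : 0 < S := by positivity
  let C₁ : ℝ := k.factorial * Real.exp (R + 2 * S)
  -- a moment of the heat kernel is controlled by the heat kernel at twice the time
  have hmom : ∀ s ≤ S, ∀ y : Space d, (R + ‖y‖) ^ k * heatKernel d s y ≤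
      C₁ * 2 ^ ((d : ℝ) / 2) * heatKernel d (2 * s) y := by
    intro s hs y
    rcases le_or_gt s 0 with hs0 | hs0
    · rw [heatKernel_of_nonpos hs0, heatKernel_of_nonpos (by linarith)]
      simp
    have h1 : (R + ‖y‖) ^ k ≤ k.factorial * Real.exp (R + ‖y‖) := by
      have := Real.pow_div_factorial_le_exp (R + ‖y‖) (by positivity) k
      rwa [div_le_iff₀ (by positivity), mul_comm] at this
    have h2 : ‖y‖ ≤ ‖y‖ ^ 2 / (8 * S) + 2 * S := by
      have : 0 ≤ (‖y‖ - 4 * S) ^ 2 / (8 * S) := by positivity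
      have e : (‖y‖ - 4 * S) ^ 2 / (8 * S) = ‖y‖ ^ 2 / (8 * S) - ‖y‖ + 2 * S := by
        field_simp
        ring
      linarith
    have h3 : ‖y‖ ^ 2 / (8 * S) ≤ ‖y‖ ^ 2 / (8 * s) := by gcongr
    have h4 : (R + ‖y‖) ^ k ≤ C₁ * Real.exp (‖y‖ ^ 2 / (8 * s)) := by
      refine h1.trans ?_
      simp only [C₁]
      rw [mul_assoc, ← Real.exp_add]
      refine mul_le_mul_of_nonneg_left (Real.exp_le_exp.2 ?_) (by positivity)
      linarith
    have h5 : heatKernel d s y = 2 ^ ((d : ℝ) / 2) * heatKernel d (2 * s) y *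
        Real.exp (-(‖y‖ ^ 2 / (8 * s))) := by
      rw [heatKernel, heatKernel, if_pos hs0, if_pos (by linarith),
        show 4 * Real.pi * (2 * s) = 2 * (4 * Real.pi * s) by ring,
        Real.mul_rpow (x := 2) (by norm_num) (by positivity),
        Real.rpow_neg (by norm_num : (0 : ℝ) ≤ 2)]
      have h6 : Real.exp (-‖y‖ ^ 2 / (4 * s)) =
          Real.exp (-‖y‖ ^ 2 / (4 * (2 * s))) * Real.exp (-(‖y‖ ^ 2 / (8 * s))) := by
        rw [← Real.exp_add]
        congr 1
        field_simp
        ring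
      rw [h6]
      have : (2 : ℝ) ^ ((d : ℝ) / 2) ≠ 0 := by positivity
      field_simp
    have h7 : 0 ≤ heatKernel d (2 * s) y := heatKernel_nonneg _ _
    calc (R + ‖y‖) ^ k * heatKernel d s y
        ≤ C₁ * Real.exp (‖y‖ ^ 2 / (8 * s)) * heatKernel d s y := by
          gcongr
          exact heatKernel_nonneg _ _
      _ = C₁ * 2 ^ ((d : ℝ) / 2) * heatKernel d (2 * s) y *
          (Real.exp (‖y‖ ^ 2 / (8 * s)) * Real.exp (-(‖y‖ ^ 2 / (8 * s)))) := by rw [h5]; ring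
      _ = _ := by rw [← Real.exp_add, add_neg_cancel, Real.exp_zero, mul_one]
  let b : ℝ × Space d → ℝ := fun q => M * (C₁ * 2 ^ ((d : ℝ) / 2)) *
    ((Icc (t - R) (t + R)).indicator (fun _ => (1 : ℝ)) q.1 * heatKernel d (-2 * q.1) q.2)
  have hb : Integrable b := (integrable_indicator_heatKernel (t - R) (t + R) (-2)).const_mul _
  refine ⟨∫ q, b q, fun x => ?_⟩
  have hnorm : ‖x‖ ^ k = ‖‖x‖ ^ k‖ := by rw [Real.norm_of_nonneg (by positivity)]
  rw [convolution_def, hnorm, ← norm_smul, ← integral_smul]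
  refine norm_integral_le_of_norm_le hb (Eventually.of_forall fun q => ?_)
  rw [norm_smul, ← hnorm, ContinuousLinearMap.lsmul_apply, norm_smul, reflectedHeat, heatKernel_neg,
    Real.norm_of_nonneg (heatKernel_nonneg _ _)]
  by_cases hq : (t, x) - q ∈ tsupport h
  · have h1 := hR hq
    rw [mem_closedBall_zero_iff] at h1
    have h2 : |t - q.1| ≤ R := (le_max_left _ _).trans h1
    have h3 : ‖x - q.2‖ ≤ R := (le_max_right _ _).trans h1
    have h4 : ‖x‖ ≤ R + ‖q.2‖ := by
      have := norm_le_insert' x q.2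
      linarith
    have h5 : q.1 ∈ Icc (t - R) (t + R) := by
      rw [abs_le] at h2
      constructor <;> linarith [h2.1, h2.2]
    have h6 : -q.1 ≤ S := by
      have := neg_abs_le t
      linarith [h5.1]
    have h7 := hmom (-q.1) h6 q.2
    have h8 := heatKernel_nonneg (d := d) (-q.1) q.2
    simp only [b]
    rw [indicator_of_mem h5, one_mul, show -2 * q.1 = 2 * -q.1 by ring]
    calc ‖x‖ ^ k * (heatKernel d (-q.1) q.2 * ‖h ((t, x) - q)‖)
        ≤ (R + ‖q.2‖) ^ k * (heatKernel d (-q.1) q.2 * M) := by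
          gcongr
          exact hM _
      _ = M * ((R + ‖q.2‖) ^ k * heatKernel d (-q.1) q.2) := by ring
      _ ≤ M * (C₁ * 2 ^ ((d : ℝ) / 2) * heatKernel d (2 * -q.1) q.2) := by gcongr
      _ = _ := by ring
  · rw [image_eq_zero_of_notMem_tsupport hq, norm_zero, mul_zero, mul_zero]
    have := heatKernel_nonneg (d := d) (-2 * q.1) q.2
    have h9 : 0 ≤ (Icc (t - R) (t + R)).indicator (fun _ => (1 : ℝ)) q.1 :=
      indicator_nonneg (fun _ _ => zero_le_one) _
    simp only [b, C₁]
    positivity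

/-- The derivative of a convolution by scalar multiplication is again such a convolution. -/
theorem precompR_lsmul {G F : Type*} [NormedAddCommGroup G] [NormedSpace ℝ G] [NormedAddCommGroup F]
    [NormedSpace ℝ F] : (ContinuousLinearMap.lsmul ℝ ℝ : ℝ →L[ℝ] F →L[ℝ] F).precompR G =
      ContinuousLinearMap.lsmul ℝ ℝ := by
  ext r L
  simp [ContinuousLinearMap.precompR_apply]

/-- All derivatives of the convolution of a test function with the reflected heat kernel decay
rapidly in space: they are convolutions of derivatives of the test function. -/
theorem exists_pow_mul_norm_iteratedFDeriv_convolution_le (n : ℕ) :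
    ∀ {F : Type} [NormedAddCommGroup F] [NormedSpace ℝ F] {h : ℝ × Space d → F},
      ContDiff ℝ (⊤ : ℕ∞) h → HasCompactSupport h → ∀ (t : ℝ) (k : ℕ), ∃ C, ∀ x, ‖x‖ ^ k *
      ‖iteratedFDeriv ℝ n (reflectedHeat ⋆[ContinuousLinearMap.lsmul ℝ ℝ, volume] h) (t, x)‖ ≤
        C := by
  induction n with
  | zero =>
    intro F _ _ h hs hc t k
    simp_rw [norm_iteratedFDeriv_zero]
    exact exists_pow_mul_norm_convolution_le hs.continuous hc t k
  | succ n ih =>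
    intro F _ _ h hs hc t k
    have hd : fderiv ℝ (reflectedHeat ⋆[ContinuousLinearMap.lsmul ℝ ℝ, volume] h) =
        reflectedHeat ⋆[ContinuousLinearMap.lsmul ℝ ℝ, volume] fderiv ℝ h := by
      ext1 p
      have := hc.hasFDerivAt_convolution_right (ContinuousLinearMap.lsmul ℝ ℝ)
        (locallyIntegrable_reflectedHeat (d := d)) (hs.of_le (by exact_mod_cast le_top)) p
      rw [precompR_lsmul] at this
      exact this.fderiv
    simp_rw [← norm_iteratedFDeriv_fderiv, hd]
    exact ih (hs.fderiv_right (m := ((⊤ : ℕ∞) : WithTop ℕ∞)) (by simp)) (hc.fderiv ℝ) t k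

variable {T : ℝ}

/-- `(η * G̃)(u, y) = ∫ η(t, x) g_{tx}(u, y) dt dx`. -/
theorem convReflected_eq_integral (η : 𝓓(domain d T, ℝ)) (p : ℝ × Space d) :
    convReflected η p = ∫ q, η q * gKernel q.1 q.2 p := by
  have hcont : Continuous η := η.contDiff.continuous
  have hconv : ConvolutionExistsAt reflectedHeat η p (ContinuousLinearMap.lsmul ℝ ℝ) volume :=
    (η.hasCompactSupport.convolutionExists_right _ locallyIntegrable_reflectedHeat hcont) p
  have hint : Integrable fun q : ℝ × Space d => η (p + q) * heatKernel d q.1 q.2 := by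
    have h1 : Integrable fun q : ℝ × Space d => reflectedHeat q • η (p - q) := hconv
    refine h1.comp_neg.congr (Eventually.of_forall fun q => ?_)
    simp [reflectedHeat, mul_comm]
  have e1 : ∫ q, η q * gKernel q.1 q.2 p = ∫ q, η (p + q) * heatKernel d q.1 q.2 := by
    rw [← integral_add_left_eq_self _ p]
    simp [gKernel]
  rw [e1, Measure.volume_eq_prod, integral_prod _ hint, convReflected]
  rw [← integral_indicator measurableSet_Ioi]
  refine integral_congr_ae (Eventually.of_forall fun s => ?_)
  by_cases hs : 0 < s
  · simp only [indicator_of_mem (show s ∈ Ioi (0 : ℝ) from hs)]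
    rfl
  · simp only [indicator_of_notMem (show s ∉ Ioi (0 : ℝ) from hs),
      heatKernel_of_nonpos (not_lt.1 hs), mul_zero, integral_zero]

theorem convReflected_eq_convolution (η : 𝓓(domain d T, ℝ)) :
    convReflected η = reflectedHeat ⋆[ContinuousLinearMap.lsmul ℝ ℝ, volume] η := by
  ext p
  rw [convReflected_eq_integral, convolution_eq_swap]
  refine integral_congr_ae (Eventually.of_forall fun q => ?_)
  simp [reflectedHeat, gKernel, mul_comm]

theorem contDiff_convReflected (η : 𝓓(domain d T, ℝ)) :
    ContDiff ℝ (⊤ : ℕ∞) (convReflected η) := by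
  rw [convReflected_eq_convolution]
  exact η.hasCompactSupport.contDiff_convolution_right _ locallyIntegrable_reflectedHeat η.contDiff

theorem exists_schwartz_convReflected (η : 𝓓(domain d T, ℝ)) (u : ℝ) :
    ∃ ψ : 𝓢(Space d, ℝ), ∀ x, ψ x = convReflected η (u, x) := by
  have hs := contDiff_convReflected η
  refine ⟨⟨fun x => convReflected η (u, x), by fun_prop, fun k n => ?_⟩, fun x => rfl⟩
  obtain ⟨C, hC⟩ := exists_pow_mul_norm_iteratedFDeriv_convolution_le n η.contDiff
    η.hasCompactSupport u k
  rw [← convReflected_eq_convolution] at hC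
  refine ⟨C, fun x => le_trans ?_ (hC x)⟩
  gcongr
  exact norm_iteratedFDeriv_slice_le hs n u x

theorem integrable_testFunction (η : 𝓓(domain d T, ℝ)) : Integrable η :=
  η.contDiff.continuous.integrable_of_hasCompactSupport η.hasCompactSupport

theorem testFunction_eq_zero (η : 𝓓(domain d T, ℝ)) {q : ℝ × Space d} (hq : q.1 ∉ Ioo 0 T) :
    η q = 0 := by
  refine image_eq_zero_of_notMem_tsupport fun h => hq ?_
  exact (η.tsupport_subset h).1

/-- Fubini's theorem: the Fourier transform commutes with the average over `(t, x)`. -/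
theorem sft_convReflected (η : 𝓓(domain d T, ℝ)) (u : ℝ) (ξ : Space d) :
    sft (fun y => convReflected η (u, y)) ξ =
      ∫ q, (η q : ℂ) * sft (fun y => gKernel q.1 q.2 (u, y)) ξ := by
  have hm : Measurable fun r : Space d × (ℝ × Space d) =>
      Complex.exp (-Complex.I * (inner ℝ ξ r.1 : ℝ)) *
        ((η r.2 : ℂ) * (gKernel r.2.1 r.2.2 (u, r.1) : ℂ)) := by
    refine Measurable.mul (by fun_prop) (Measurable.mul ?_ ?_)
    · exact Complex.measurable_ofReal.comp (η.contDiff.continuous.measurable.comp measurable_snd)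
    · exact Complex.measurable_ofReal.comp (measurable_gKernel.comp
        (by fun_prop : Measurable fun r : Space d × (ℝ × Space d) => (r.2, (u, r.1))))
  have hint : Integrable (Function.uncurry fun (y : Space d) (q : ℝ × Space d) =>
      Complex.exp (-Complex.I * (inner ℝ ξ y : ℝ)) *
        ((η q : ℂ) * (gKernel q.1 q.2 (u, y) : ℂ))) (volume.prod volume) := by
    refine ⟨hm.aestronglyMeasurable, ?_⟩
    change ∫⁻ r : Space d × (ℝ × Space d), ‖Complex.exp (-Complex.I * (inner ℝ ξ r.1 : ℝ)) *
        ((η r.2 : ℂ) * (gKernel r.2.1 r.2.2 (u, r.1) : ℂ))‖ₑ ∂_ < ∞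
    rw [lintegral_prod_symm _ hm.enorm.aemeasurable]
    refine lt_of_le_of_lt (lintegral_mono fun q => ?_) (integrable_testFunction η).2
    have h1 : ∀ y : Space d, ‖Complex.exp (-Complex.I * (inner ℝ ξ y : ℝ)) *
        ((η q : ℂ) * (gKernel q.1 q.2 (u, y) : ℂ))‖ₑ =
        ‖η q‖ₑ * ENNReal.ofReal (heatKernel d (q.1 - u) (q.2 - y)) := by
      intro y
      rw [enorm_mul, ← ofReal_norm, norm_exp_neg_I_mul, ENNReal.ofReal_one, one_mul, enorm_mul,
        ← ofReal_norm, ← ofReal_norm, Complex.norm_real, Complex.norm_real, ofReal_norm]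
      congr 2
      exact Real.norm_of_nonneg (heatKernel_nonneg _ _)
    simp_rw [h1]
    rw [lintegral_const_mul' _ _ enorm_ne_top, lintegral_sub_left_eq_self
      (fun y => ENNReal.ofReal (heatKernel d (q.1 - u) y))]
    rcases le_or_gt (q.1 - u) 0 with h | h
    · simp [heatKernel_of_nonpos h]
    · rw [lintegral_heatKernel h, mul_one]
  have e : ∀ y, Complex.exp (-Complex.I * (inner ℝ ξ y : ℝ)) * (convReflected η (u, y) : ℂ) =
      ∫ q, Complex.exp (-Complex.I * (inner ℝ ξ y : ℝ)) *
        ((η q : ℂ) * (gKernel q.1 q.2 (u, y) : ℂ)) := by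
    intro y
    rw [convReflected_eq_integral, ← integral_complex_ofReal, ← integral_const_mul]
    push_cast
    rfl
  rw [sft]
  simp_rw [e]
  rw [integral_integral_swap hint]
  refine integral_congr_ae (Eventually.of_forall fun q => ?_)
  simp only [sft]
  rw [← integral_const_mul]
  refine integral_congr_ae (Eventually.of_forall fun y => ?_)
  simp only
  ring

theorem measurable_sft_gKernel (u : ℝ) (ξ : Space d) :
    Measurable fun q : ℝ × Space d => sft (fun y => gKernel q.1 q.2 (u, y)) ξ := by
  simp_rw [sft_gKernel]
  refine Measurable.mul (by fun_prop) (Complex.measurable_ofReal.comp ?_)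
  exact measurable_heatAmplitude.comp
    (by fun_prop : Measurable fun q : ℝ × Space d => (q.1, u, ξ))

theorem integrable_mul_sft_gKernel (η : 𝓓(domain d T, ℝ)) (u : ℝ) (ξ : Space d) :
    Integrable fun q : ℝ × Space d => (η q : ℂ) * sft (fun y => gKernel q.1 q.2 (u, y)) ξ := by
  refine (integrable_testFunction η).ofReal.mul_bdd (c := 1)
    (measurable_sft_gKernel u ξ).aestronglyMeasurable (Eventually.of_forall fun q => ?_)
  rw [norm_sft_gKernel]
  exact heatAmplitude_le_one _ _ _

/-- The Fourier transform of `η * G̃` at time `u` is `∫ exp (-(t - u)|ξ|²) 𝓕η(t, ·)(ξ) dt` over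
`t > u`, and inherits the decay of that of `η`. -/
theorem exists_norm_sft_convReflected_le (hT : 0 < T) (η : 𝓓(domain d T, ℝ)) (N : ℕ) :
    ∃ C, ∀ u ξ, ‖sft (fun y => convReflected η (u, y)) ξ‖ ≤ C * (1 + ‖ξ‖) ^ (-(N : ℝ)) := by
  obtain ⟨C, hC0, hC⟩ := exists_norm_sft_slice_le η.contDiff η.hasCompactSupport N
  refine ⟨C * T, fun u ξ => ?_⟩
  rw [sft_convReflected, Measure.volume_eq_prod, integral_prod _ (integrable_mul_sft_gKernel η u ξ)]
  have e : ∀ t, ∫ x, (η (t, x) : ℂ) * sft (fun y => gKernel t x (u, y)) ξ =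
      (heatAmplitude t u ξ : ℂ) * sft (fun x => η (t, x)) ξ := by
    intro t
    rw [sft, ← integral_const_mul]
    refine integral_congr_ae (Eventually.of_forall fun x => ?_)
    simp only [sft_gKernel]
    ring
  simp_rw [e]
  have hle : ∀ t, ‖(heatAmplitude t u ξ : ℂ) * sft (fun x => η (t, x)) ξ‖ ≤
      (Ioo 0 T).indicator (fun _ => C * (1 + ‖ξ‖) ^ (-(N : ℝ))) t := by
    intro t
    by_cases ht : t ∈ Ioo 0 T
    · rw [indicator_of_mem ht, norm_mul, Complex.norm_real,
        Real.norm_of_nonneg (heatAmplitude_nonneg _ _ _)]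
      exact (mul_le_of_le_one_left (norm_nonneg _) (heatAmplitude_le_one _ _ _)).trans (hC t ξ)
    · rw [indicator_of_notMem ht]
      have : ∀ x, η (t, x) = 0 := fun x => testFunction_eq_zero η ht
      simp [sft, this]
  refine (norm_integral_le_of_norm_le ?_ (Eventually.of_forall hle)).trans (le_of_eq ?_)
  · exact (integrable_indicator_iff measurableSet_Ioo).2 (integrableOn_const measure_Ioo_lt_top.ne)
  · rw [integral_indicator_const _ measurableSet_Ioo, smul_eq_mul]
    simp only [measureReal_def, Real.volume_Ioo, sub_zero, ENNReal.toReal_ofReal hT.le]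
    ring

theorem isRegular_convReflected {μ : Measure (Space d)} [μ.HasTemperateGrowth] [SFinite μ] {H : ℝ}
    (hH : 1 / 2 < H) (hH' : H < 1) (hT : 0 < T) (η : 𝓓(domain d T, ℝ)) :
    IsRegular μ H T (convReflected η) := by
  obtain ⟨C, hC⟩ := exists_norm_sft_convReflected_le hT η μ.integrablePower
  exact isRegular_of_decay hH hH' hT (contDiff_convReflected η).continuous.measurable
    (Eventually.of_forall fun u => exists_schwartz_convReflected η u) fun u _ ξ => hC u ξ

/-- The spectral representative of `η * G̃` is the average of those of `g_{tx}` with weight `η`. -/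
theorem feature_convReflected {H : ℝ} (hH : 1 / 2 < H) (η : 𝓓(domain d T, ℝ))
    (z : ℝ × Space d) :
    feature H T (convReflected η) z = ∫ q, (η q : ℂ) * feature H T (gKernel q.1 q.2) z := by
  have hm : Measurable fun r : ℝ × (ℝ × Space d) => (timeKernel H r.1 z.1 : ℂ) *
      ((η r.2 : ℂ) * sft (fun y => gKernel r.2.1 r.2.2 (r.1, y)) z.2) := by
    simp_rw [sft_gKernel]
    refine Measurable.mul ?_ (Measurable.mul ?_ (Measurable.mul (by fun_prop) ?_))
    · exact Complex.measurable_ofReal.comp ((measurable_timeKernel H).comp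
        (by fun_prop : Measurable fun r : ℝ × (ℝ × Space d) => (r.1, z.1)))
    · exact Complex.measurable_ofReal.comp (η.contDiff.continuous.measurable.comp measurable_snd)
    · exact Complex.measurable_ofReal.comp (measurable_heatAmplitude.comp
        (by fun_prop : Measurable fun r : ℝ × (ℝ × Space d) => (r.2.1, r.1, z.2)))
  have hint : Integrable (Function.uncurry fun (u : ℝ) (q : ℝ × Space d) =>
      (timeKernel H u z.1 : ℂ) * ((η q : ℂ) * sft (fun y => gKernel q.1 q.2 (u, y)) z.2))
      ((volume.restrict (Ioo 0 T)).prod volume) := by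
    have h1 := (integrableOn_timeKernel hH z.1 T).mul_prod (integrable_testFunction η)
    refine h1.mono hm.aestronglyMeasurable (Eventually.of_forall fun r => ?_)
    simp only [Function.uncurry, norm_mul, Complex.norm_real, norm_sft_gKernel]
    rw [← mul_assoc]
    exact mul_le_of_le_one_right (by positivity) (heatAmplitude_le_one _ _ _)
  rw [feature]
  simp_rw [sft_convReflected, ← integral_const_mul]
  rw [integral_integral_swap hint]
  refine integral_congr_ae (Eventually.of_forall fun q => ?_)
  simp only [feature]
  rw [← integral_const_mul]
  refine integral_congr_ae (Eventually.of_forall fun u => ?_)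
  simp only
  ring

end Convolution

/-! ### Density of the test functions -/

section Density

open FourierTransform

variable {d : ℕ}

/-- Dominated convergence for spectral representatives: pointwise convergence of the Fourier
transforms under a bound of finite energy implies convergence in `HP`. -/
theorem tendsto_embed {μ : Measure (Space d)} [SFinite μ] {H T : ℝ} {φn : ℕ → ℝ × Space d → ℝ}
    {φ : ℝ × Space d → ℝ} (hn : ∀ n, IsRegular μ H T (φn n)) (hφ : IsRegular μ H T φ)
    {D : ℝ → Space d → ℝ≥0∞} (hD : Measurable fun p : ℝ × Space d => D p.1 p.2)
    (hfin : ∫⁻ z, (∫⁻ u in Ioo 0 T, ENNReal.ofReal (timeKernel H u z.1) * D u z.2) ^ 2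
      ∂spectralMeasure μ < ∞)
    (hle : ∀ n, ∀ u ∈ Ioo 0 T, ∀ ξ, ‖sft (fun x => φn n (u, x)) ξ‖ₑ ≤ D u ξ)
    (hlim : ∀ u ∈ Ioo 0 T, ∀ ξ, Tendsto (fun n => sft (fun x => φn n (u, x)) ξ) atTop
      (𝓝 (sft (fun x => φ (u, x)) ξ))) :
    Tendsto (fun n => embed μ H T (φn n)) atTop (𝓝 (embed μ H T φ)) := by
  set W : ℝ × Space d → ℝ≥0∞ := fun z =>
    ∫⁻ u in Ioo 0 T, ENNReal.ofReal (timeKernel H u z.1) * D u z.2 with hW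
  have hκ := measurable_timeKernel H
  have hker : Measurable fun q : (ℝ × Space d) × ℝ =>
      ENNReal.ofReal (timeKernel H q.2 q.1.1) * D q.2 q.1.2 :=
    (hκ.comp (measurable_snd.prodMk (measurable_fst.comp measurable_fst))).ennreal_ofReal.mul
      (hD.comp (measurable_snd.prodMk (measurable_snd.comp measurable_fst)))
  have hWm : Measurable W := hker.lintegral_prod_right'
  have hWfin : ∀ᵐ z ∂spectralMeasure μ, W z < ∞ := by
    filter_upwards [ae_lt_top (hWm.pow_const 2) hfin.ne] with z hz
    exact (ENNReal.pow_lt_top_iff).1 hz |>.resolve_right (by norm_num)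
  -- dominated convergence in time, for almost every `(w, ξ)`
  have hfle : ∀ n z, ‖feature H T (φn n) z‖ₑ ≤ W z := fun n z => by
    refine (enorm_feature_le H T (φn n) z).trans
      (setLIntegral_mono' measurableSet_Ioo fun u hu => ?_)
    gcongr
    exact hle n u hu z.2
  have hflim : ∀ z, W z < ∞ → Tendsto (fun n => feature H T (φn n) z) atTop
      (𝓝 (feature H T φ z)) := by
    intro z hz
    have hkz := hker.comp (measurable_prodMk_left (x := z))
    simp only [Function.comp_def] at hkz
    unfold feature
    refine tendsto_integral_of_dominated_convergence
      (fun u => (ENNReal.ofReal (timeKernel H u z.1) * D u z.2).toReal) (fun n => ?_)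
      (integrable_toReal_of_lintegral_ne_top hkz.aemeasurable hz.ne) (fun n => ?_) ?_
    · have := (measurable_feature_integrand H (hn n).measurable).comp
        (measurable_prodMk_left (x := z))
      exact this.aestronglyMeasurable
    · filter_upwards [ae_lt_top hkz hz.ne, ae_restrict_mem measurableSet_Ioo] with u hu hu'
      rw [← toReal_enorm, enorm_timeKernel_mul]
      refine ENNReal.toReal_mono hu.ne ?_
      gcongr
      exact hle n u hu' z.2
    · filter_upwards [ae_restrict_mem measurableSet_Ioo] with u hu
      exact Tendsto.const_mul (timeKernel H u z.1 : ℂ) (hlim u hu z.2)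
  -- dominated convergence over the spectral domain
  have hsq : Tendsto (fun n => ‖embed μ H T (φn n) - embed μ H T φ‖ₑ ^ 2) atTop (𝓝 0) := by
    have e : ∀ n, ‖embed μ H T (φn n) - embed μ H T φ‖ₑ ^ 2 =
        ∫⁻ z, ‖feature H T (φn n) z - feature H T φ z‖ₑ ^ 2 ∂spectralMeasure μ := fun n => by
      rw [← embed_sub (hn n) hφ, enorm_embed_sq ((hn n).sub hφ)]
      refine lintegral_congr_ae ?_
      filter_upwards [feature_sub (hn n) hφ] with z hz
      rw [hz]
    simp_rw [e]
    have h0 : (0 : ℝ≥0∞) = ∫⁻ _, 0 ∂spectralMeasure μ := by simp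
    rw [h0]
    refine tendsto_lintegral_of_dominated_convergence' (fun z => 4 * W z ^ 2 + 4 * W z ^ 2)
      (fun n => ?_) (fun n => ?_) ?_ ?_
    · have h1 := (stronglyMeasurable_feature H T (hn n).measurable).measurable
      have h2 := (stronglyMeasurable_feature H T hφ.measurable).measurable
      exact ((h1.sub h2).enorm.pow_const 2).aemeasurable
    · filter_upwards [hWfin] with z hz
      have h3 : ‖feature H T φ z‖ₑ ≤ W z :=
        le_of_tendsto (hflim z hz).enorm (Eventually.of_forall fun m => hfle m z)
      refine (pow_le_pow_left' (enorm_sub_le.trans (add_le_add (hfle n z) h3)) 2).trans ?_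
      exact ennreal_add_sq_le _ _
    · have h4 : ∫⁻ z, 4 * W z ^ 2 ∂spectralMeasure μ < ∞ := by
        rw [lintegral_const_mul _ (hWm.pow_const 2)]
        exact ENNReal.mul_lt_top (by norm_num) hfin
      rw [lintegral_add_left ((hWm.pow_const 2).const_mul 4)]
      exact (ENNReal.add_lt_top.2 ⟨h4, h4⟩).ne
    · filter_upwards [hWfin] with z hz
      have h5 := ENNReal.Tendsto.pow (n := 2) ((hflim z hz).sub_const (feature H T φ z)).enorm
      simpa using h5
  rw [tendsto_iff_edist_tendsto_0]
  have h6 := ((ENNReal.continuous_rpow_const (y := 1 / 2)).tendsto 0).comp hsq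
  rw [ENNReal.zero_rpow_of_pos (by norm_num)] at h6
  refine h6.congr fun n => ?_
  rw [Function.comp_apply, edist_eq_enorm_sub, ← ENNReal.rpow_natCast, ← ENNReal.rpow_mul]
  norm_num

/-- The Fourier transform of a dilated cut-off is an average of translates of the transform. -/
theorem sft_dilation_mul {χ : Space d → ℝ} {χc : 𝓢(Space d, ℂ)} (hχ : ∀ x, χc x = (χ x : ℂ))
    (ψ : 𝓢(Space d, ℝ)) (ε : ℝ) (ξ : Space d) :
    sft (fun x => χ (ε • x) * ψ x) ξ =
      ∫ ζ, (𝓕 χc) ζ * sft ψ (ξ - (2 * Real.pi * ε) • ζ) := by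
  have hinv : ∀ y, (χ y : ℂ) =
      ∫ ζ, Complex.exp (((2 * Real.pi * inner ℝ ζ y : ℝ) : ℂ) * Complex.I) * (𝓕 χc) ζ := by
    intro y
    rw [← hχ y]
    conv_lhs => rw [← FourierTransform.fourierInv_fourier_eq (F := 𝓢(Space d, ℂ)) χc]
    rw [SchwartzMap.fourierInv_coe, Real.fourierInv_eq']
    simp only [smul_eq_mul]
  have hm : Measurable fun r : Space d × Space d =>
      Complex.exp (-Complex.I * (inner ℝ (ξ - (2 * Real.pi * ε) • r.2) r.1 : ℝ)) *
        (((𝓕 χc) r.2) * (ψ r.1 : ℂ)) := by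
    have h1 := (𝓕 χc).continuous
    have h2 := ψ.continuous
    exact Continuous.measurable (by fun_prop)
  have hint : Integrable (Function.uncurry fun (x ζ : Space d) =>
      Complex.exp (-Complex.I * (inner ℝ (ξ - (2 * Real.pi * ε) • ζ) x : ℝ)) *
        (((𝓕 χc) ζ) * (ψ x : ℂ))) (volume.prod volume) := by
    have h3 := (ψ.integrable (μ := volume)).ofReal (𝕜 := ℂ) |>.mul_prod
      ((𝓕 χc).integrable (μ := volume))
    refine h3.mono hm.aestronglyMeasurable (Eventually.of_forall fun r => le_of_eq ?_)
    simp only [Function.uncurry, norm_mul, norm_exp_neg_I_mul, one_mul]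
    exact mul_comm _ _
  have e : ∀ x, Complex.exp (-Complex.I * (inner ℝ ξ x : ℝ)) * ((χ (ε • x) * ψ x : ℝ) : ℂ) =
      ∫ ζ, Complex.exp (-Complex.I * (inner ℝ (ξ - (2 * Real.pi * ε) • ζ) x : ℝ)) *
        (((𝓕 χc) ζ) * (ψ x : ℂ)) := by
    intro x
    rw [Complex.ofReal_mul, hinv, ← integral_mul_const, ← integral_const_mul]
    refine integral_congr_ae (Eventually.of_forall fun ζ => ?_)
    simp only
    have : Complex.exp (-Complex.I * (inner ℝ (ξ - (2 * Real.pi * ε) • ζ) x : ℝ)) =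
        Complex.exp (-Complex.I * (inner ℝ ξ x : ℝ)) *
          Complex.exp (((2 * Real.pi * inner ℝ ζ (ε • x) : ℝ) : ℂ) * Complex.I) := by
      rw [← Complex.exp_add, inner_sub_left, inner_smul_left, inner_smul_right]
      congr 1
      push_cast
      simp
      ring
    rw [this]
    ring
  rw [sft]
  simp_rw [e]
  rw [integral_integral_swap hint]
  refine integral_congr_ae (Eventually.of_forall fun ζ => ?_)
  simp only [sft]
  rw [← integral_const_mul]
  refine integral_congr_ae (Eventually.of_forall fun x => ?_)
  simp only
  ring

/-- Polynomial decay of a Fourier transform survives multiplication by a dilated cut-off,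
uniformly in the dilation. -/
theorem exists_norm_sft_dilation_mul_le {χ : Space d → ℝ} {χc : 𝓢(Space d, ℂ)}
    (hχ : ∀ x, χc x = (χ x : ℂ)) (N : ℕ) :
    ∃ K, ∀ (ψ : 𝓢(Space d, ℝ)) (C : ℝ), (∀ ξ, ‖sft ψ ξ‖ ≤ C * (1 + ‖ξ‖) ^ (-(N : ℝ))) →
      ∀ ε ∈ Icc (0 : ℝ) 1, ∀ ξ, ‖sft (fun x => χ (ε • x) * ψ x) ξ‖ ≤
        K * C * (1 + ‖ξ‖) ^ (-(N : ℝ)) := by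
  set X := 𝓕 χc
  have hXi : Integrable fun ζ => ‖X ζ‖ * (1 + 2 * Real.pi * ‖ζ‖) ^ N := by
    have h1 : ∀ k : ℕ, Integrable fun ζ : Space d => ‖ζ‖ ^ k * ‖X ζ‖ := fun k =>
      X.integrable_pow_mul volume k
    have h2 : Integrable fun ζ => ∑ k ∈ Finset.range (N + 1),
        ((2 * Real.pi) ^ k * (N.choose k : ℝ)) * (‖ζ‖ ^ k * ‖X ζ‖) :=
      integrable_finsetSum _ fun k _ => (h1 k).const_mul _
    refine h2.congr (Eventually.of_forall fun ζ => ?_)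
    simp only
    rw [add_comm 1, add_pow, Finset.mul_sum]
    refine Finset.sum_congr rfl fun k _ => ?_
    rw [mul_pow, one_pow]
    ring
  refine ⟨∫ ζ, ‖X ζ‖ * (1 + 2 * Real.pi * ‖ζ‖) ^ N, fun ψ C hC ε hε ξ => ?_⟩
  have hC0 : 0 ≤ C := by
    have := (norm_nonneg _).trans (hC 0)
    simpa using this
  rw [sft_dilation_mul hχ]
  have hb : Integrable fun ζ => ‖X ζ‖ * (1 + 2 * Real.pi * ‖ζ‖) ^ N *
      (C * (1 + ‖ξ‖) ^ (-(N : ℝ))) := hXi.mul_const _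
  refine (norm_integral_le_of_norm_le hb (Eventually.of_forall fun ζ => ?_)).trans
    (le_of_eq (by rw [integral_mul_const, mul_assoc]))
  rw [norm_mul, mul_assoc ‖X ζ‖]
  refine mul_le_mul_of_nonneg_left ((hC _).trans ?_) (norm_nonneg _)
  rw [mul_left_comm]
  refine mul_le_mul_of_nonneg_left ?_ hC0
  rw [Real.rpow_neg (by positivity), Real.rpow_neg (by positivity), Real.rpow_natCast,
    Real.rpow_natCast, ← div_eq_mul_inv, le_div_iff₀ (by positivity),
    inv_mul_le_iff₀ (by positivity), ← mul_pow]
  -- Peetre's inequality `1 + |ξ| ≤ (1 + |ξ - a|) (1 + |a|)`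
  refine pow_le_pow_left₀ (by positivity) ?_ N
  have h3 : ‖ξ‖ ≤ ‖ξ - (2 * Real.pi * ε) • ζ‖ + 2 * Real.pi * ‖ζ‖ := by
    have h4 := norm_le_norm_sub_add ξ ((2 * Real.pi * ε) • ζ)
    have h5 : ‖(2 * Real.pi * ε) • ζ‖ ≤ 2 * Real.pi * ‖ζ‖ := by
      have hp := Real.pi_pos
      rw [norm_smul, Real.norm_of_nonneg (by have := hε.1; positivity)]
      refine mul_le_mul_of_nonneg_right ?_ (norm_nonneg _)
      exact mul_le_of_le_one_right (by positivity) hε.2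
    linarith
  have h6 : 0 ≤ ‖ξ - (2 * Real.pi * ε) • ζ‖ * (2 * Real.pi * ‖ζ‖) := by positivity
  linarith

theorem tendsto_sft_dilation_mul {χ : Space d → ℝ} (hχ : Continuous χ) (h1 : χ 0 = 1)
    (hb : ∀ x, |χ x| ≤ 1) (ψ : 𝓢(Space d, ℝ)) {ε : ℕ → ℝ} (hε : Tendsto ε atTop (𝓝 0))
    (ξ : Space d) :
    Tendsto (fun n => sft (fun x => χ (ε n • x) * ψ x) ξ) atTop (𝓝 (sft ψ ξ)) := by
  unfold sft
  refine tendsto_integral_of_dominated_convergence (fun x => ‖ψ x‖) (fun n => ?_)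
    (ψ.integrable (μ := volume)).norm (fun n => ?_) ?_
  · have := ψ.continuous
    exact Continuous.aestronglyMeasurable (by fun_prop)
  · refine Eventually.of_forall fun x => ?_
    rw [norm_mul, norm_exp_neg_I_mul, one_mul, Complex.norm_real, norm_mul]
    exact mul_le_of_le_one_left (norm_nonneg _) (hb _)
  · refine Eventually.of_forall fun x => ?_
    have h2 : Tendsto (fun n => χ (ε n • x)) atTop (𝓝 (χ ((0 : ℝ) • x))) :=
      (hχ.tendsto _).comp (hε.smul_const x)
    rw [zero_smul, h1] at h2
    have h3 := ((Complex.continuous_ofReal.tendsto _).comp (h2.mul_const (ψ x))).const_mul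
      (Complex.exp (-Complex.I * (inner ℝ ξ x : ℝ)))
    simpa using h3

end Density

/-! ### Approximation of the heat kernel by test functions -/

section TestFunctionsDense

variable {d : ℕ}

/-- A smooth cut-off in time, equal to `0` off `[1/(k+1), t - 1/(k+1)]` and to `1` at every fixed
point of `(0, t)` for large `k`. -/
def timeCutoff (t : ℝ) (k : ℕ) (u : ℝ) : ℝ :=
  Real.smoothTransition ((k + 1) * u - 1) * Real.smoothTransition ((k + 1) * (t - u) - 1)

theorem contDiff_timeCutoff (t : ℝ) (k : ℕ) : ContDiff ℝ (⊤ : ℕ∞) (timeCutoff t k) := by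
  unfold timeCutoff
  exact (Real.smoothTransition.contDiff.comp (by fun_prop)).mul
    (Real.smoothTransition.contDiff.comp (by fun_prop))

theorem timeCutoff_nonneg (t : ℝ) (k : ℕ) (u : ℝ) : 0 ≤ timeCutoff t k u :=
  mul_nonneg (Real.smoothTransition.nonneg _) (Real.smoothTransition.nonneg _)

theorem timeCutoff_le_one (t : ℝ) (k : ℕ) (u : ℝ) : timeCutoff t k u ≤ 1 :=
  mul_le_one₀ (Real.smoothTransition.le_one _) (Real.smoothTransition.nonneg _)
    (Real.smoothTransition.le_one _)

theorem timeCutoff_eq_zero {t : ℝ} {k : ℕ} {u : ℝ}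
    (hu : u ∉ Icc ((k + 1 : ℝ)⁻¹) (t - (k + 1 : ℝ)⁻¹)) : timeCutoff t k u = 0 := by
  have hk : (0 : ℝ) < k + 1 := by positivity
  rw [mem_Icc, not_and_or, not_le, not_le] at hu
  unfold timeCutoff
  rcases hu with h | h
  · rw [Real.smoothTransition.zero_of_nonpos, zero_mul]
    have := mul_lt_mul_of_pos_left h hk
    rw [mul_inv_cancel₀ hk.ne'] at this
    linarith
  · rw [Real.smoothTransition.zero_of_nonpos (x := (k + 1) * (t - u) - 1), mul_zero]
    have := mul_lt_mul_of_pos_left (show t - u < (k + 1 : ℝ)⁻¹ by linarith) hk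
    rw [mul_inv_cancel₀ hk.ne'] at this
    linarith

theorem eventually_timeCutoff_eq_one {t u : ℝ} (hu : u ∈ Ioo 0 t) :
    ∀ᶠ k : ℕ in atTop, timeCutoff t k u = 1 := by
  obtain ⟨m, hm⟩ := exists_nat_gt (2 / u)
  obtain ⟨n, hn⟩ := exists_nat_gt (2 / (t - u))
  have hu1 : 0 < t - u := sub_pos.2 hu.2
  filter_upwards [eventually_ge_atTop m, eventually_ge_atTop n] with k hk hk'
  have h1 : (m : ℝ) ≤ k := by exact_mod_cast hk
  have h2 : (n : ℝ) ≤ k := by exact_mod_cast hk'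
  rw [div_lt_iff₀ hu.1] at hm
  rw [div_lt_iff₀ hu1] at hn
  have h3 := mul_le_mul_of_nonneg_right h1 hu.1.le
  have h4 := mul_le_mul_of_nonneg_right h2 hu1.le
  rw [timeCutoff, Real.smoothTransition.one_of_one_le, Real.smoothTransition.one_of_one_le, one_mul]
  · nlinarith
  · nlinarith [hu.1]

/-- A cut-off in time commutes with the spatial Fourier transform, and keeps functions regular. -/
theorem IsRegular.time_mul {μ : Measure (Space d)} {H T : ℝ} {φ : ℝ × Space d → ℝ}
    (hφ : IsRegular μ H T φ) {θ : ℝ → ℝ} (hm : Measurable θ) (hθ : ∀ u, |θ u| ≤ 1) :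
    IsRegular μ H T fun p => θ p.1 * φ p where
  measurable := (hm.comp measurable_fst).mul hφ.measurable
  slice := by
    filter_upwards [hφ.slice] with u ⟨ψ, hψ⟩
    exact ⟨θ u • ψ, fun x => by simp [hψ]⟩
  finite := by
    refine lt_of_le_of_lt (lintegral_mono fun z => pow_le_pow_left' ?_ 2) hφ.finite
    refine lintegral_mono fun u => mul_le_mul_right ?_ _
    change ‖sft (fun x => θ u * φ (u, x)) z.2‖ₑ ≤ _
    rw [sft_const_mul, ← ofReal_norm, ← ofReal_norm, norm_mul, Complex.norm_real]
    exact ENNReal.ofReal_le_ofReal (mul_le_of_le_one_left (norm_nonneg _) (hθ u))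

/-- A regular function that is smooth on `(0, t) × ℝ^d`, vanishes afterwards, and whose Fourier
transforms decay rapidly away from the times `0` and `t`, is a limit of test functions in `HP`:
one cuts it off in time, and then in space. -/
theorem embed_mem_closure {μ : Measure (Space d)} [μ.HasTemperateGrowth] [SFinite μ] {H T : ℝ}
    (hH : 1 / 2 < H) (hH' : H < 1) (hT : 0 < T) {t : ℝ} (ht : t ≤ T) {φ : ℝ × Space d → ℝ}
    (hφ : IsRegular μ H T φ) (hs : ContDiffOn ℝ (⊤ : ℕ∞) φ (Ioo 0 t ×ˢ univ))
    (h0 : ∀ u, t ≤ u → u < T → ∀ x, φ (u, x) = 0)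
    (hsl : ∀ u, ∃ ψ : 𝓢(Space d, ℝ), ∀ x, ψ x = φ (u, x))
    (hdec : ∀ a b, 0 < a → b < t → ∃ C, ∀ u ∈ Icc a b, ∀ ξ,
      ‖sft (fun x => φ (u, x)) ξ‖ ≤ C * (1 + ‖ξ‖) ^ (-(μ.integrablePower : ℝ))) :
    embed μ H T φ ∈ closure (range fun η : 𝓓(domain d T, ℝ) => embed μ H T η) := by
  -- The cut-off in time decreases the modulus of the Fourier transforms, and `φ` itself dominates.
  have hθabs : ∀ k u, |timeCutoff t k u| ≤ 1 := fun k u => by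
    rw [abs_of_nonneg (timeCutoff_nonneg t k u)]
    exact timeCutoff_le_one t k u
  have hθm : ∀ k, Measurable (timeCutoff t k) := fun k =>
    (contDiff_timeCutoff t k).continuous.measurable
  have hreg : ∀ k, IsRegular μ H T fun p => timeCutoff t k p.1 * φ p := fun k =>
    hφ.time_mul (hθm k) (hθabs k)
  have hlim : Tendsto (fun k => embed μ H T fun p => timeCutoff t k p.1 * φ p) atTop
      (𝓝 (embed μ H T φ)) := by
    refine tendsto_embed hreg hφ (D := fun u ξ => ‖sft (fun x => φ (u, x)) ξ‖ₑ)
      (stronglyMeasurable_sft hφ.measurable).measurable.enorm hφ.finite (fun k u hu ξ => ?_)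
      (fun u hu ξ => ?_)
    · change ‖sft (fun x => timeCutoff t k u * φ (u, x)) ξ‖ₑ ≤ _
      rw [sft_const_mul, ← ofReal_norm, ← ofReal_norm, norm_mul, Complex.norm_real]
      exact ENNReal.ofReal_le_ofReal (mul_le_of_le_one_left (norm_nonneg _) (hθabs k u))
    · by_cases hut : u < t
      · refine tendsto_const_nhds.congr' ?_
        filter_upwards [eventually_timeCutoff_eq_one ⟨hu.1, hut⟩] with k hk
        simp [hk]
      · simp [h0 u (not_lt.1 hut) hu.2]
  rw [← closure_closure]
  refine mem_closure_of_tendsto hlim (Eventually.of_forall fun k => ?_)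
  set a : ℝ := (k + 1 : ℝ)⁻¹ with ha
  have ha0 : 0 < a := by positivity
  obtain ⟨C, hC⟩ := hdec a (t - a) ha0 (by linarith)
  -- For a fixed cut-off in time, the functions `h n` below are test functions; in the limit the
  -- dilated spatial cut-off `χ (ε n • ·)` tends to `1`.
  let χ : ContDiffBump (0 : Space d) := ⟨1, 2, one_pos, one_lt_two⟩
  have hχs : ContDiff ℝ (⊤ : ℕ∞) χ := χ.contDiff
  have hχcs : ContDiff ℝ (⊤ : ℕ∞) fun x => (χ x : ℂ) := Complex.ofRealCLM.contDiff.comp hχs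
  have hχcc : HasCompactSupport fun x => (χ x : ℂ) :=
    χ.hasCompactSupport.comp_left (g := fun r : ℝ => (r : ℂ)) (by simp)
  let χc : 𝓢(Space d, ℂ) := hχcc.toSchwartzMap hχcs
  have hχc : ∀ x, χc x = (χ x : ℂ) := fun x => rfl
  let ε : ℕ → ℝ := fun n => 1 / ((n : ℝ) + 1)
  have hε0 : ∀ n, 0 < ε n := fun n => by positivity
  have hε1 : ∀ n, ε n ≤ 1 := fun n => by
    rw [div_le_one (by positivity)]
    linarith [n.cast_nonneg (α := ℝ)]
  have hε : Tendsto ε atTop (𝓝 0) := tendsto_one_div_add_atTop_nhds_zero_nat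
  let h : ℕ → ℝ × Space d → ℝ := fun n p => χ (ε n • p.2) * (timeCutoff t k p.1 * φ p)
  have hzero : ∀ n p, p ∉ Icc a (t - a) ×ˢ Metric.closedBall (0 : Space d) (2 / ε n) →
      h n p = 0 := by
    intro n p hp
    simp only [h]
    by_cases h1 : p.1 ∈ Icc a (t - a)
    · have h2 : 2 / ε n < ‖p.2‖ := by
        by_contra hle
        exact hp ⟨h1, mem_closedBall_zero_iff.2 (not_lt.1 hle)⟩
      rw [χ.zero_of_le_dist, zero_mul]
      rw [dist_zero_right, norm_smul, Real.norm_of_nonneg (hε0 n).le]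
      rw [div_lt_iff₀ (hε0 n)] at h2
      change (2 : ℝ) ≤ _
      linarith
    · rw [timeCutoff_eq_zero h1, zero_mul, mul_zero]
  have hcomp : ∀ n, IsCompact (Icc a (t - a) ×ˢ Metric.closedBall (0 : Space d) (2 / ε n)) :=
    fun n => isCompact_Icc.prod (isCompact_closedBall _ _)
  have hsupp : ∀ n, tsupport (h n) ⊆ Icc a (t - a) ×ˢ Metric.closedBall (0 : Space d) (2 / ε n) :=
    fun n => closure_minimal (fun p hp => by
      by_contra hne
      exact hp (hzero n p hne)) (hcomp n).isClosed
  have hsm : ∀ n, ContDiff ℝ (⊤ : ℕ∞) (h n) := by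
    intro n
    rw [contDiff_iff_contDiffAt]
    intro p
    by_cases hp : p.1 ∈ Ioo 0 t
    · have h1 : ContDiffAt ℝ (⊤ : ℕ∞) φ p :=
        hs.contDiffAt ((isOpen_Ioo.prod isOpen_univ).mem_nhds ⟨hp, mem_univ _⟩)
      have h2 : ContDiff ℝ (⊤ : ℕ∞) fun p : ℝ × Space d => χ (ε n • p.2) :=
        hχs.comp (by fun_prop)
      have h3 : ContDiff ℝ (⊤ : ℕ∞) fun p : ℝ × Space d => timeCutoff t k p.1 :=
        (contDiff_timeCutoff t k).comp contDiff_fst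
      exact h2.contDiffAt.mul (h3.contDiffAt.mul h1)
    -- Nothing is known about `φ` at such times, but `h n` vanishes near `p`.
    · have h4 : p ∉ tsupport (h n) := fun hmem => hp
        ⟨lt_of_lt_of_le ha0 (hsupp n hmem).1.1, by have := (hsupp n hmem).1.2; linarith⟩
      exact contDiffAt_const.congr_of_eventuallyEq (notMem_tsupport_iff_eventuallyEq.1 h4)
  let η : ℕ → 𝓓(domain d T, ℝ) := fun n =>
    ⟨h n, hsm n, (hcomp n).of_isClosed_subset (isClosed_tsupport _) (hsupp n), fun p hp =>
      ⟨⟨lt_of_lt_of_le ha0 (hsupp n hp).1.1, by have := (hsupp n hp).1.2; linarith⟩, mem_univ _⟩⟩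
  have hη : ∀ n, ⇑(η n) = h n := fun n => rfl
  obtain ⟨K, hK⟩ := exists_norm_sft_dilation_mul_le hχc μ.integrablePower
  refine mem_closure_of_tendsto (b := atTop) (f := fun n => embed μ H T (η n)) ?_
    (Eventually.of_forall fun n => mem_range_self (η n))
  have hKC : ∀ u, ∃ ψ : 𝓢(Space d, ℝ), (∀ x, ψ x = timeCutoff t k u * φ (u, x)) ∧
      ∀ ξ, ‖sft ψ ξ‖ ≤ max C 0 * (1 + ‖ξ‖) ^ (-(μ.integrablePower : ℝ)) := by
    intro u
    obtain ⟨ψ, hψ⟩ := hsl u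
    refine ⟨timeCutoff t k u • ψ, fun x => by simp [hψ], fun ξ => ?_⟩
    have e : ⇑(timeCutoff t k u • ψ) = fun x => timeCutoff t k u * φ (u, x) := by
      ext x
      simp [hψ]
    rw [e, sft_const_mul, norm_mul, Complex.norm_real]
    by_cases hu : u ∈ Icc a (t - a)
    · refine (mul_le_of_le_one_left (norm_nonneg _) (hθabs k u)).trans ((hC u hu ξ).trans ?_)
      gcongr
      exact le_max_left _ _
    · rw [timeCutoff_eq_zero hu, norm_zero, zero_mul]
      positivity
  refine tendsto_embed (fun n => isRegular_testFunction hH hH' hT (η n)) (hreg k)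
    (D := fun _ ξ => ENNReal.ofReal (K * max C 0 * (1 + ‖ξ‖) ^ (-(μ.integrablePower : ℝ))))
    (by fun_prop) (lintegral_decay_lt_top μ hH hH' hT _) (fun n u _ ξ => ?_) (fun u _ ξ => ?_)
  · obtain ⟨ψ, hψ, hb⟩ := hKC u
    have := hK ψ _ hb (ε n) ⟨(hε0 n).le, hε1 n⟩ ξ
    simp_rw [hψ] at this
    rw [← ofReal_norm]
    exact ENNReal.ofReal_le_ofReal this
  · obtain ⟨ψ, hψ, hb⟩ := hKC u
    have := tendsto_sft_dilation_mul hχs.continuous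
      (χ.one_of_mem_closedBall (by simp [χ]))
      (fun x => by rw [abs_of_nonneg χ.nonneg]; exact χ.le_one) ψ hε ξ
    have e : ⇑ψ = fun x => timeCutoff t k u * φ (u, x) := funext hψ
    rw [e] at this
    exact this

theorem contDiffOn_gKernel (t : ℝ) (x : Space d) :
    ContDiffOn ℝ (⊤ : ℕ∞) (gKernel t x) (Ioo 0 t ×ˢ univ) := by
  have h1 : ContDiffOn ℝ (⊤ : ℕ∞) (fun p : ℝ × Space d => (4 * Real.pi * (t - p.1)) ^
      (-((d : ℝ) / 2)) * Real.exp (-‖x - p.2‖ ^ 2 / (4 * (t - p.1)))) (Ioo 0 t ×ˢ univ) := by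
    refine ContDiffOn.mul ?_ ?_
    · refine ContDiffOn.rpow_const_of_ne (by fun_prop) fun p hp => ?_
      have : 0 < t - p.1 := sub_pos.2 hp.1.2
      positivity
    · refine Real.contDiff_exp.comp_contDiffOn (ContDiffOn.div ?_ (by fun_prop) fun p hp => ?_)
      · exact ((contDiff_norm_sq ℝ).comp (by fun_prop :
          ContDiff ℝ (⊤ : ℕ∞) fun p : ℝ × Space d => x - p.2)).neg.contDiffOn
      · have : 0 < t - p.1 := sub_pos.2 hp.1.2
        positivity
  refine h1.congr fun p hp => ?_
  rw [gKernel, heatKernel, if_pos (sub_pos.2 hp.1.2)]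

/-- The singularity of `g_{tx}` at the time `t` is the reason for the cut-off in time: before it,
the Fourier transforms are bounded by a Gaussian. -/
theorem embed_gKernel_mem_closure {μ : Measure (Space d)} [μ.HasTemperateGrowth] [SFinite μ]
    {H T : ℝ} (hH : 1 / 2 < H) (hH' : H < 1) (hT : 0 < T) {t : ℝ} (ht : t ≤ T) {x : Space d}
    (hφ : IsRegular μ H T (gKernel t x)) :
    embed μ H T (gKernel t x) ∈ closure (range fun η : 𝓓(domain d T, ℝ) => embed μ H T η) := by
  refine embed_mem_closure hH hH' hT ht hφ (contDiffOn_gKernel t x)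
    (fun u hu _ y => heatKernel_of_nonpos (sub_nonpos.2 hu) _) (exists_schwartz_gKernel t x)
    fun a b _ hb => ?_
  obtain ⟨ψ, hψ⟩ := exists_schwartz_gaussian (d := d) (sub_pos.2 hb)
  set N := μ.integrablePower
  refine ⟨2 ^ N * (Finset.Iic (N, 0)).sup (fun m => SchwartzMap.seminorm ℝ m.1 m.2) ψ,
    fun u hu ξ => ?_⟩
  have h1 := SchwartzMap.one_add_le_sup_seminorm_apply (𝕜 := ℝ) (m := (N, 0)) (k := N) (n := 0)
    le_rfl le_rfl ψ ξ
  rw [norm_iteratedFDeriv_zero, hψ, Real.norm_of_nonneg (Real.exp_pos _).le] at h1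
  rw [norm_sft_gKernel, Real.rpow_neg (by positivity), Real.rpow_natCast, ← div_eq_mul_inv,
    le_div_iff₀ (by positivity), mul_comm]
  refine le_trans ?_ h1
  gcongr
  rw [heatAmplitude, if_pos (hu.2.trans_lt hb)]
  refine Real.exp_le_exp.2 (mul_le_mul_of_nonneg_right ?_ (sq_nonneg _))
  linarith [hu.2]

theorem embed_convReflected_mem_closure {μ : Measure (Space d)} [μ.HasTemperateGrowth] [SFinite μ]
    {H T : ℝ} (hH : 1 / 2 < H) (hH' : H < 1) (hT : 0 < T) (η : 𝓓(domain d T, ℝ)) :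
    embed μ H T (convReflected η) ∈
      closure (range fun η : 𝓓(domain d T, ℝ) => embed μ H T η) := by
  obtain ⟨C, hC⟩ := exists_norm_sft_convReflected_le hT η μ.integrablePower
  exact embed_mem_closure hH hH' hT le_rfl (isRegular_convReflected hH hH' hT η)
    (contDiff_convReflected η).contDiffOn (fun u hu hu' => absurd hu' (not_lt.2 hu))
    (exists_schwartz_convReflected η) fun a b _ _ => ⟨C, fun u _ ξ => hC u ξ⟩

/-- For regular functions, convergence in `HP` is convergence of the spectral representatives. -/
theorem tendsto_embed_of_hpTendsto {f : 𝓢(Space d, ℝ) →L[ℝ] ℝ} {μ : Measure (Space d)}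
    [μ.HasTemperateGrowth] [SFinite μ] (hf : IsFourierTransformOf f μ) {H T : ℝ} (hH : 1 / 2 < H)
    (hH' : H < 1) (hT : 0 < T) {φ : ℝ × Space d → ℝ} (hφ : IsRegular μ H T φ)
    {φn : ℕ → 𝓓(domain d T, ℝ)} (h : HPTendsto f H T φn φ) :
    Tendsto (fun n => embed μ H T (φn n)) atTop (𝓝 (embed μ H T φ)) := by
  rw [tendsto_iff_norm_sub_tendsto_zero]
  have h1 := (Real.continuous_sqrt.tendsto 0).comp h.2
  rw [Real.sqrt_zero] at h1
  refine h1.congr fun n => ?_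
  rw [Function.comp_apply, hpForm_self_eq hf hH hH' (isRegular_testFunction hH hH' hT (φn n)) hφ,
    Real.sqrt_sq (norm_nonneg _)]

theorem hpTendsto_of_tendsto_embed {f : 𝓢(Space d, ℝ) →L[ℝ] ℝ} {μ : Measure (Space d)}
    [μ.HasTemperateGrowth] [SFinite μ] (hf : IsFourierTransformOf f μ) {H T : ℝ} (hH : 1 / 2 < H)
    (hH' : H < 1) (hT : 0 < T) {φ : ℝ × Space d → ℝ} (hφ : IsRegular μ H T φ)
    {φn : ℕ → 𝓓(domain d T, ℝ)}
    (h : Tendsto (fun n => embed μ H T (φn n)) atTop (𝓝 (embed μ H T φ))) :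
    HPTendsto f H T φn φ := by
  refine ⟨fun n => ((isRegular_testFunction hH hH' hT (φn n)).sub hφ).hpFinite hf hH hH', ?_⟩
  rw [tendsto_iff_norm_sub_tendsto_zero] at h
  have h1 := h.pow 2
  rw [zero_pow two_ne_zero] at h1
  refine h1.congr fun n => ?_
  rw [hpForm_self_eq hf hH hH' (isRegular_testFunction hH hH' hT (φn n)) hφ]

theorem memHP_of_mem_closure {f : 𝓢(Space d, ℝ) →L[ℝ] ℝ} {μ : Measure (Space d)}
    [μ.HasTemperateGrowth] [SFinite μ] (hf : IsFourierTransformOf f μ) {H T : ℝ} (hH : 1 / 2 < H)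
    (hH' : H < 1) (hT : 0 < T) {φ : ℝ × Space d → ℝ} (hφ : IsRegular μ H T φ)
    (h : embed μ H T φ ∈ closure (range fun η : 𝓓(domain d T, ℝ) => embed μ H T η)) :
    MemHP f H T φ := by
  obtain ⟨s, hs, hlim⟩ := mem_closure_iff_seq_limit.1 h
  choose φn hφn using hs
  refine ⟨φn, hpTendsto_of_tendsto_embed hf hH hH' hT hφ ?_⟩
  simpa only [hφn] using hlim

end TestFunctionsDense

/-! ### The stochastic integral as an isometry -/

section Isometry

/-- Two families of vectors with the same Gram matrix are related by a continuous linear map that is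
isometric on the closed span of the first family. -/
theorem exists_clm_of_inner_eq {ι E F : Type*} [NormedAddCommGroup E] [InnerProductSpace ℝ E]
    [CompleteSpace E] [NormedAddCommGroup F] [InnerProductSpace ℝ F] [CompleteSpace F]
    (j : ι → E) (b : ι → F) (h : ∀ i k, inner ℝ (j i) (j k) = inner ℝ (b i) (b k)) :
    ∃ V : E →L[ℝ] F, (∀ i, V (j i) = b i) ∧ ∀ x ∈ closure (range j), ‖V x‖ = ‖x‖ := by
  let J := Finsupp.linearCombination ℝ j
  let L := Finsupp.linearCombination ℝ b
  have hnorm : ∀ c, ‖L c‖ = ‖J c‖ := by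
    intro c
    have h1 : ‖L c‖ ^ 2 = ‖J c‖ ^ 2 := by
      rw [← real_inner_self_eq_norm_sq, ← real_inner_self_eq_norm_sq]
      simp only [L, J, Finsupp.linearCombination_apply, Finsupp.sum, sum_inner, inner_sum,
        inner_smul_left, inner_smul_right, h]
    exact (sq_eq_sq₀ (norm_nonneg _) (norm_nonneg _)).1 h1
  -- The map is defined on the closed span by extension, and off it by orthogonal projection.
  let S := (LinearMap.range J).topologicalClosure
  let e : (ι →₀ ℝ) →ₗ[ℝ] S := J.codRestrict S fun c =>
    Submodule.le_topologicalClosure _ (LinearMap.mem_range_self J c)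
  have hdense : DenseRange e := by
    intro x
    have hx : (x : E) ∈ closure (LinearMap.range J : Set E) := x.2
    rw [closure_subtype]
    refine closure_mono ?_ hx
    rintro _ ⟨c, rfl⟩
    exact ⟨e c, mem_range_self c, rfl⟩
  have hbd : ∃ C, ∀ c, ‖L c‖ ≤ C * ‖e c‖ := ⟨1, fun c => by rw [one_mul, hnorm]; rfl⟩
  let V₀ : S →L[ℝ] F := L.extendOfNorm e
  have hV₀ : ∀ c, V₀ (e c) = L c := fun c => LinearMap.extendOfNorm_eq hdense hbd c
  have hV₀n : ∀ x, ‖V₀ x‖ = ‖x‖ := by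
    intro x
    refine hdense.induction_on (p := fun x => ‖V₀ x‖ = ‖x‖) x
      (isClosed_eq (by fun_prop) (by fun_prop)) fun c => ?_
    rw [hV₀, hnorm]
    rfl
  have hjS : ∀ i, j i ∈ S := fun i =>
    Submodule.le_topologicalClosure _ ⟨Finsupp.single i 1, by simp [J]⟩
  refine ⟨V₀.comp S.orthogonalProjectionOnto, fun i => ?_, fun x hx => ?_⟩
  · have h2 : S.orthogonalProjectionOnto (j i) = e (Finsupp.single i 1) := by
      have : e (Finsupp.single i 1) = ⟨j i, hjS i⟩ := Subtype.ext (by simp [e, J])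
      rw [this]
      exact S.orthogonalProjectionOnto_mem_subspace_eq_self ⟨j i, hjS i⟩
    rw [ContinuousLinearMap.comp_apply, h2, hV₀]
    simp [L]
  · have hxS : x ∈ S := closure_minimal (range_subset_iff.2 hjS)
      (Submodule.isClosed_topologicalClosure _) hx
    have h3 : S.orthogonalProjectionOnto x = ⟨x, hxS⟩ :=
      S.orthogonalProjectionOnto_mem_subspace_eq_self ⟨x, hxS⟩
    rw [ContinuousLinearMap.comp_apply, h3, hV₀n]
    rfl

variable {d : ℕ} {Ω : Type*} [MeasurableSpace Ω] {P : Measure Ω}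

theorem IsFractionalColoredNoise.memLp {f : 𝓢(Space d, ℝ) →L[ℝ] ℝ} {H T : ℝ}
    {B : 𝓓(domain d T, ℝ) → Ω → ℝ} (hB : IsFractionalColoredNoise f H T P B)
    (φ : 𝓓(domain d T, ℝ)) : MemLp (B φ) 2 P :=
  (hB.gaussian.hasGaussianLaw_eval φ).memLp_two

/-- The stochastic integral, in the spectral domain: a continuous linear map into `L²(Ω)` that
extends the noise and is isometric on the closure of the test functions. -/
theorem IsFractionalColoredNoise.exists_clm {f : 𝓢(Space d, ℝ) →L[ℝ] ℝ} {μ : Measure (Space d)}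
    [μ.HasTemperateGrowth] [SFinite μ] (hf : IsFourierTransformOf f μ) {H T : ℝ} (hH : 1 / 2 < H)
    (hH' : H < 1) (hT : 0 < T) {B : 𝓓(domain d T, ℝ) → Ω → ℝ}
    (hB : IsFractionalColoredNoise f H T P B) :
    ∃ V : Lp ℂ 2 (spectralMeasure μ) →L[ℝ] Lp ℝ 2 P,
      (∀ η : 𝓓(domain d T, ℝ), V (embed μ H T η) = (hB.memLp η).toLp) ∧
      ∀ x ∈ closure (range fun η : 𝓓(domain d T, ℝ) => embed μ H T η), ‖V x‖ = ‖x‖ := by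
  refine exists_clm_of_inner_eq (fun η : 𝓓(domain d T, ℝ) => embed μ H T η)
    (fun η => (hB.memLp η).toLp) fun η ζ => ?_
  rw [← hpForm_eq_inner hf hH hH' (isRegular_testFunction hH hH' hT η)
    (isRegular_testFunction hH hH' hT ζ), ← hB.covariance, L2.inner_def]
  refine integral_congr_ae ?_
  filter_upwards [(hB.memLp η).coeFn_toLp, (hB.memLp ζ).coeFn_toLp] with ω h1 h2
  rw [h1, h2]
  simp [mul_comm]

/-- The stochastic integral of `φ` is `V φ` in the spectral domain. In particular it does not depend
on the approximating test functions. -/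
theorem stochasticIntegral_ae_eq {f : 𝓢(Space d, ℝ) →L[ℝ] ℝ} {μ : Measure (Space d)}
    [μ.HasTemperateGrowth] [SFinite μ] (hf : IsFourierTransformOf f μ) {H T : ℝ} (hH : 1 / 2 < H)
    (hH' : H < 1) (hT : 0 < T) {B : 𝓓(domain d T, ℝ) → Ω → ℝ}
    (hB : IsFractionalColoredNoise f H T P B) {V : Lp ℂ 2 (spectralMeasure μ) →L[ℝ] Lp ℝ 2 P}
    (hV : ∀ η : 𝓓(domain d T, ℝ), V (embed μ H T η) = (hB.memLp η).toLp)
    {φ : ℝ × Space d → ℝ} (hφ : IsRegular μ H T φ)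
    (h : embed μ H T φ ∈ closure (range fun η : 𝓓(domain d T, ℝ) => embed μ H T η)) :
    stochasticIntegral f H T P B φ =ᵐ[P] V (embed μ H T φ) := by
  have hlim : ∀ φn : ℕ → 𝓓(domain d T, ℝ), HPTendsto f H T φn φ →
      Tendsto (fun n => (hB.memLp (φn n)).toLp) atTop (𝓝 (V (embed μ H T φ))) := by
    intro φn hφn
    have := (V.continuous.tendsto _).comp (tendsto_embed_of_hpTendsto hf hH hH' hT hφ hφn)
    simpa only [Function.comp_def, hV] using this
  have hex : ∃ Y, IsStochasticIntegral f H T P B φ Y := by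
    obtain ⟨φn, hφn⟩ := memHP_of_mem_closure hf hH hH' hT hφ h
    refine ⟨V (embed μ H T φ), Lp.memLp _, φn, hφn, ?_⟩
    refine (tendsto_iff_edist_tendsto_0.1 (hlim φn hφn)).congr fun n => ?_
    rw [Lp.edist_def]
    refine eLpNorm_congr_ae ?_
    filter_upwards [(hB.memLp (φn n)).coeFn_toLp] with ω hω
    rw [Pi.sub_apply, hω]
  rw [stochasticIntegral, dif_pos hex]
  obtain ⟨hY, φn, hφn, hYlim⟩ := hex.choose_spec
  have h1 : Tendsto (fun n => (hB.memLp (φn n)).toLp) atTop (𝓝 hY.toLp) := by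
    rw [tendsto_iff_edist_tendsto_0]
    simp_rw [Lp.edist_toLp_toLp]
    exact hYlim
  rw [← tendsto_nhds_unique h1 (hlim φn hφn)]
  exact hY.coeFn_toLp.symm

theorem enorm_sq_eq_lintegral {E : Type*} [NormedAddCommGroup E] (Y : Lp E 2 P) :
    ‖Y‖ₑ ^ 2 = ∫⁻ ω, ‖Y ω‖ₑ ^ 2 ∂P := by
  rw [Lp.enorm_def, eLpNorm_two_sq]

/-- A family of elements of `L²` has a jointly measurable version if it is approximated by
a sequence `b`, with errors that depend measurably on the parameter. -/
theorem exists_measurable_modification [IsFiniteMeasure P] {S : Type*} [MeasurableSpace S]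
    (Y : S → Lp ℝ 2 P) (b : ℕ → Lp ℝ 2 P) (δ : ℕ → S → ℝ≥0∞) (hm : ∀ k, Measurable (δ k))
    (hle : ∀ k s, ‖Y s - b k‖ₑ ≤ δ k s) (hb : ∀ s, ∀ ε > 0, ∃ k, δ k s < ε) :
    ∃ X : S → Ω → ℝ, Measurable (fun p : S × Ω => X p.1 p.2) ∧ ∀ s, X s =ᵐ[P] Y s := by
  have hpos : ∀ n : ℕ, (0 : ℝ≥0∞) < (2⁻¹ : ℝ≥0∞) ^ n := fun n => ENNReal.pow_pos (by norm_num) n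
  -- `N n s` is the first index at which the error at `s` is less than `2⁻ⁿ`
  obtain ⟨N, hNm, hN⟩ : ∃ N : ℕ → S → ℕ, (∀ n, Measurable (N n)) ∧
      ∀ n s, ‖Y s - b (N n s)‖ₑ < 2⁻¹ ^ n := by
    classical
    exact ⟨fun n s => Nat.find (hb s _ (hpos n)), fun n =>
      measurable_find (fun s => hb s _ (hpos n)) fun k => measurableSet_lt (hm k) measurable_const,
      fun n s => (hle _ _).trans_lt (Nat.find_spec (hb s _ (hpos n)))⟩
  have hbm : Measurable fun q : ℕ × Ω => b q.1 q.2 :=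
    measurable_from_prod_countable_right fun k => (Lp.stronglyMeasurable (b k)).measurable
  -- The errors are square summable, so that the approximations `b (N n s)` converge to `Y s` almost
  -- surely.
  refine ⟨fun s ω => limsup (fun n => b (N n s) ω) atTop, ?_, fun s => ?_⟩
  · exact Measurable.limsup fun n => hbm.comp
      (((hNm n).comp measurable_fst).prodMk measurable_snd)
  have hmeas : ∀ n, Measurable fun ω => ‖Y s ω - b (N n s) ω‖ₑ ^ 2 := fun n =>
    ((Lp.stronglyMeasurable (Y s)).sub
      (Lp.stronglyMeasurable (b (N n s)))).measurable.enorm.pow_const 2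
  have hsum : ∫⁻ ω, ∑' n, ‖Y s ω - b (N n s) ω‖ₑ ^ 2 ∂P ≠ ∞ := by
    rw [lintegral_tsum fun n => (hmeas n).aemeasurable]
    refine ne_top_of_le_ne_top (b := ∑' n : ℕ, (2⁻¹ : ℝ≥0∞) ^ n) ?_
      (ENNReal.tsum_le_tsum fun n => ?_)
    · rw [ENNReal.tsum_geometric]
      simp
    · have h1 : ∫⁻ ω, ‖Y s ω - b (N n s) ω‖ₑ ^ 2 ∂P = ‖Y s - b (N n s)‖ₑ ^ 2 := by
        rw [enorm_sq_eq_lintegral]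
        refine lintegral_congr_ae ?_
        filter_upwards [Lp.coeFn_sub (Y s) (b (N n s))] with ω hω
        rw [hω, Pi.sub_apply]
      rw [h1, sq]
      have h2 : (2⁻¹ : ℝ≥0∞) ^ n ≤ 1 := pow_le_one' (by norm_num) n
      calc _ ≤ (2⁻¹ : ℝ≥0∞) ^ n * 1 := by
            gcongr
            · exact (hN n s).le
            · exact (hN n s).le.trans h2
        _ = _ := mul_one _
  have hsm : AEMeasurable (fun ω => ∑' n, ‖Y s ω - b (N n s) ω‖ₑ ^ 2) P :=
    (Measurable.tsum hmeas).aemeasurable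
  filter_upwards [ae_lt_top' hsm hsum] with ω hω
  have h3 := ENNReal.tendsto_atTop_zero_of_tsum_ne_top hω.ne
  have h4 := ((ENNReal.continuous_rpow_const (y := 1 / 2)).tendsto 0).comp h3
  rw [ENNReal.zero_rpow_of_pos (by norm_num)] at h4
  have h5 : Tendsto (fun n => b (N n s) ω) atTop (𝓝 (Y s ω)) := by
    rw [tendsto_iff_edist_tendsto_0]
    refine h4.congr fun n => ?_
    rw [Function.comp_apply, edist_comm, edist_eq_enorm_sub, ← ENNReal.rpow_natCast,
      ← ENNReal.rpow_mul]
    norm_num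
  exact h5.limsup_eq

end Isometry

/-! ### Construction of the process solution -/

section Construction

variable {d : ℕ}

theorem norm_feature_gKernel_le {H : ℝ} (hH : 1 / 2 < H) (T t : ℝ) (x : Space d)
    (z : ℝ × Space d) :
    ‖feature H T (gKernel t x) z‖ ≤ ∫ u in Ioo 0 T, timeKernel H u z.1 := by
  refine norm_integral_le_of_norm_le (integrableOn_timeKernel hH z.1 T)
    (Eventually.of_forall fun u => ?_)
  rw [norm_mul, norm_sft_gKernel, Complex.norm_real, Real.norm_of_nonneg (timeKernel_nonneg _ _ _)]
  exact mul_le_of_le_one_right (timeKernel_nonneg _ _ _) (heatAmplitude_le_one _ _ _)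

theorem continuousAt_heatAmplitude {t u : ℝ} (h : u ≠ t) (ξ : Space d) :
    ContinuousAt (fun t => heatAmplitude t u ξ) t := by
  rcases lt_or_gt_of_ne h with h | h
  · have h1 : ContinuousAt (fun t => Real.exp (-(t - u) * ‖ξ‖ ^ 2)) t := by fun_prop
    refine h1.congr ?_
    filter_upwards [lt_mem_nhds h] with s hs
    rw [heatAmplitude, if_pos hs]
  · refine (continuousAt_const (y := (0 : ℝ))).congr ?_
    filter_upwards [gt_mem_nhds h] with s hs
    rw [heatAmplitude, if_neg (not_lt.2 hs.le)]

theorem continuous_feature_gKernel {H : ℝ} (hH : 1 / 2 < H) (T : ℝ) (z : ℝ × Space d) :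
    Continuous fun q : ℝ × Space d => feature H T (gKernel q.1 q.2) z := by
  rw [continuous_iff_continuousAt]
  intro q₀
  unfold feature
  refine continuousAt_of_dominated (bound := fun u => timeKernel H u z.1)
    (Eventually.of_forall fun q => ?_)
    (Eventually.of_forall fun q => Eventually.of_forall fun u => ?_)
    (integrableOn_timeKernel hH z.1 T) ?_
  · have := (measurable_feature_integrand H (measurable_gKernel.comp
      (measurable_prodMk_left (x := q)))).comp (measurable_prodMk_left (x := z))
    exact this.aestronglyMeasurable
  · rw [norm_mul, norm_sft_gKernel, Complex.norm_real,
      Real.norm_of_nonneg (timeKernel_nonneg _ _ _)]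
    exact mul_le_of_le_one_right (timeKernel_nonneg _ _ _) (heatAmplitude_le_one _ _ _)
  · have hne : ∀ᵐ u ∂volume.restrict (Ioo 0 T), u ≠ q₀.1 :=
      ae_restrict_of_ae (Measure.ae_ne volume q₀.1)
    filter_upwards [hne] with u hu
    simp_rw [sft_gKernel]
    have h1 : ContinuousAt (fun q : ℝ × Space d => (heatAmplitude q.1 u z.2 : ℂ)) q₀ :=
      Complex.continuous_ofReal.continuousAt.comp
        (ContinuousAt.comp (f := fun q : ℝ × Space d => q.1) (x := q₀)
          (continuousAt_heatAmplitude hu z.2) continuousAt_fst)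
    have h2 : ContinuousAt (fun q : ℝ × Space d =>
        Complex.exp (-Complex.I * (inner ℝ z.2 q.2 : ℝ))) q₀ := by fun_prop
    exact continuousAt_const.mul (h2.mul h1)

variable {T : ℝ}

/-- A process indexed by the times in `[0, T]`, extended to all times by its values at `0` and
`T`. -/
def extendTime {Ω : Type*} (hT : 0 ≤ T) (X : ℝ → Space d → Ω → ℝ) (q : ℝ × Space d) : Ω → ℝ :=
  X (projIcc 0 T hT q.1) q.2

theorem extendTime_of_mem {Ω : Type*} (hT : 0 ≤ T) (X : ℝ → Space d → Ω → ℝ) {q : ℝ × Space d}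
    (hq : q.1 ∈ Icc 0 T) : extendTime hT X q = X q.1 q.2 := by
  rw [extendTime, projIcc_of_mem hT hq]

variable {Ω : Type*} [MeasurableSpace Ω] {P : Measure Ω}

theorem measurable_extendTime (hT : 0 ≤ T) {X : ℝ → Space d → Ω → ℝ}
    (hX : Measurable fun p : Icc (0 : ℝ) T × Space d × Ω => X p.1 p.2.1 p.2.2) :
    Measurable fun p : (ℝ × Space d) × Ω => extendTime hT X p.1 p.2 := by
  have h1 : Measurable fun p : (ℝ × Space d) × Ω =>
      ((projIcc 0 T hT p.1.1, p.1.2, p.2) : Icc (0 : ℝ) T × Space d × Ω) := by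
    have := (continuous_projIcc (h := hT)).measurable
    fun_prop
  exact hX.comp h1

theorem exists_isCompact_testFunction (η : 𝓓(domain d T, ℝ)) :
    ∃ K : Set (Space d), IsCompact K ∧ ∀ q, q.2 ∉ K → η q = 0 := by
  refine ⟨Prod.snd '' tsupport η, η.hasCompactSupport.isCompact.image continuous_snd,
    fun q hq => ?_⟩
  by_contra hne
  exact hq ⟨q, subset_tsupport _ hne, rfl⟩

theorem lintegral_enorm_le_eLpNorm_two [IsProbabilityMeasure P] {Y : Ω → ℝ}
    (hY : AEStronglyMeasurable Y P) : ∫⁻ ω, ‖Y ω‖ₑ ∂P ≤ eLpNorm Y 2 P := by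
  rw [← eLpNorm_one_eq_lintegral_enorm]
  exact eLpNorm_le_eLpNorm_of_exponent_le (by norm_num) hY

theorem integrable_process_mul [IsProbabilityMeasure P] {X : ℝ × Space d → Ω → ℝ}
    (hX : Measurable fun p : (ℝ × Space d) × Ω => X p.1 p.2) {K : Set (Space d)} {C : ℝ≥0}
    (hC : ∀ q, q.2 ∈ K → eLpNorm (X q) 2 P ≤ C) {g : ℝ × Space d → ℝ} (hg : Integrable g)
    (hK : ∀ q, q.2 ∉ K → g q = 0) :
    Integrable (fun p : (ℝ × Space d) × Ω => X p.1 p.2 * g p.1) (volume.prod P) := by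
  have hm : AEStronglyMeasurable (fun p : (ℝ × Space d) × Ω => X p.1 p.2 * g p.1)
      (volume.prod P) := hX.aestronglyMeasurable.mul hg.1.comp_fst
  refine ⟨hm, ?_⟩
  rw [HasFiniteIntegral, lintegral_prod _ hm.enorm]
  have hfin : ∫⁻ q, (C : ℝ≥0∞) * ‖g q‖ₑ < ∞ := by
    rw [lintegral_const_mul' _ _ ENNReal.coe_ne_top]
    exact ENNReal.mul_lt_top ENNReal.coe_lt_top hg.2
  refine lt_of_le_of_lt (lintegral_mono fun q => ?_) hfin
  simp_rw [enorm_mul]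
  rw [lintegral_mul_const' _ _ enorm_ne_top]
  by_cases hq : q.2 ∈ K
  · gcongr
    exact (lintegral_enorm_le_eLpNorm_two
      (hX.comp measurable_prodMk_left).aestronglyMeasurable).trans (hC q hq)
  · simp [hK q hq]

/-- The iterated integral in the definition of a representing process is an integral over
space-time. -/
theorem ae_iterated_integral_eq [IsProbabilityMeasure P] (hT : 0 < T) {X : ℝ → Space d → Ω → ℝ}
    (hX : Measurable fun p : (ℝ × Space d) × Ω => extendTime hT.le X p.1 p.2)
    (hb : ∀ K : Set (Space d), IsCompact K →
      ∃ C : ℝ≥0, ∀ q : ℝ × Space d, q.2 ∈ K → eLpNorm (extendTime hT.le X q) 2 P ≤ C)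
    (η : 𝓓(domain d T, ℝ)) :
    ∀ᵐ ω ∂P, ∫ t in (0 : ℝ)..T, ∫ x, X t x ω * η (t, x) =
      ∫ q, extendTime hT.le X q ω * η q := by
  obtain ⟨K, hK, hηK⟩ := exists_isCompact_testFunction η
  obtain ⟨C, hC⟩ := hb K hK
  have hint := integrable_process_mul hX hC (integrable_testFunction η) hηK
  filter_upwards [hint.prod_left_ae] with ω hω
  rw [Measure.volume_eq_prod] at hω ⊢
  have h1 : ∀ t, t ∉ Ioc 0 T → ∫ x, extendTime hT.le X (t, x) ω * η (t, x) = 0 := by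
    intro t ht
    have : ∀ x, η (t, x) = 0 := fun x => testFunction_eq_zero η fun h => ht ⟨h.1, h.2.le⟩
    simp [this]
  rw [integral_prod _ hω, intervalIntegral.integral_of_le hT.le,
    ← setIntegral_eq_integral_of_forall_compl_eq_zero h1]
  refine setIntegral_congr_fun measurableSet_Ioc fun t ht => ?_
  refine integral_congr_ae (Eventually.of_forall fun x => ?_)
  simp only
  rw [extendTime_of_mem hT.le X (q := (t, x)) ⟨ht.1.le, ht.2⟩]

theorem Represents.exists_extendTime_bound {u : 𝓓(domain d T, ℝ) → Ω → ℝ}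
    {X : ℝ → Space d → Ω → ℝ} (h : Represents P u X) (hT : 0 ≤ T) {K : Set (Space d)}
    (hK : IsCompact K) :
    ∃ C : ℝ≥0, ∀ q : ℝ × Space d, q.2 ∈ K → eLpNorm (extendTime hT X q) 2 P ≤ C := by
  obtain ⟨C, hC⟩ := h.locally_bounded K hK
  exact ⟨C, fun q hq => hC _ (projIcc 0 T hT q.1).2 _ hq⟩

theorem Represents.ae_eq_integral [IsProbabilityMeasure P] {u : 𝓓(domain d T, ℝ) → Ω → ℝ}
    {X : ℝ → Space d → Ω → ℝ} (h : Represents P u X) (hT : 0 < T) (η : 𝓓(domain d T, ℝ)) :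
    u η =ᵐ[P] fun ω => ∫ q, extendTime hT.le X q ω * η q := by
  filter_upwards [h.represents η, ae_iterated_integral_eq hT
    (measurable_extendTime hT.le h.measurable) (fun K hK => h.exists_extendTime_bound hT.le hK) η]
    with ω h1 h2
  rw [h1, h2]

section Energy

variable {μ : Measure (Space d)} {H : ℝ} {C : ℝ≥0}

theorem enorm_embed_gKernel_sq_le {t : ℝ} {x : Space d}
    (hE : ∫⁻ z, absFeature H T (gKernel t x) z ^ 2 ∂spectralMeasure μ ≤ C) :
    ‖embed μ H T (gKernel t x)‖ₑ ^ 2 ≤ C := by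
  rw [enorm_embed_sq (isRegular_gKernel (hE.trans_lt ENNReal.coe_lt_top))]
  refine (lintegral_mono fun z => ?_).trans hE
  gcongr
  exact enorm_feature_le _ _ _ _

/-- A version of `u(t, x) = B(g_{tx})` represents the distribution-valued solution: both sides have
the same integral over every event, by Fubini's theorem in the spectral domain. -/
theorem clm_convReflected_ae_eq [IsProbabilityMeasure P] [SFinite μ] [μ.HasTemperateGrowth]
    (hH : 1 / 2 < H) (hH' : H < 1) (hT : 0 < T)
    (hE : ∀ t ∈ Icc 0 T, ∀ x : Space d,
      ∫⁻ z, absFeature H T (gKernel t x) z ^ 2 ∂spectralMeasure μ ≤ C)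
    (V : Lp ℂ 2 (spectralMeasure μ) →L[ℝ] Lp ℝ 2 P) {X : ℝ × Space d → Ω → ℝ}
    (hXV : ∀ q : ℝ × Space d, q.1 ∈ Icc 0 T → X q =ᵐ[P] V (embed μ H T (gKernel q.1 q.2)))
    (η : 𝓓(domain d T, ℝ))
    (hint : Integrable (fun p : (ℝ × Space d) × Ω => X p.1 p.2 * η p.1) (volume.prod P)) :
    V (embed μ H T (convReflected η)) =ᵐ[P] fun ω => ∫ q, X q ω * η q := by
  have hreg : ∀ q : ℝ × Space d, q.1 ∈ Icc 0 T → IsRegular μ H T (gKernel q.1 q.2) := fun q hq =>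
    isRegular_gKernel ((hE q.1 hq q.2).trans_lt ENNReal.coe_lt_top)
  refine Integrable.ae_eq_of_forall_setIntegral_eq _ _
    ((Lp.memLp (V (embed μ H T (convReflected η)))).integrable (by norm_num))
    hint.integral_prod_right fun A hA _ => ?_
  -- By duality the integral of `V y` over the event `A` is `⟪h, y⟫`, with `h` the adjoint of `V` at
  -- the indicator function of `A`.
  let h : Lp ℂ 2 (spectralMeasure μ) :=
    ContinuousLinearMap.adjoint V (indicatorConstLp 2 hA (measure_ne_top P A) (1 : ℝ))
  have hh : ∀ y, ∫ ω in A, V y ω ∂P = inner ℝ h y := fun y => by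
    rw [ContinuousLinearMap.adjoint_inner_left, L2.inner_indicatorConstLp_one]
  have hhm : Measurable h := (Lp.stronglyMeasurable h).measurable
  have hFm : Measurable fun p : (ℝ × Space d) × (ℝ × Space d) =>
      feature H T (gKernel p.1.1 p.1.2) p.2 := (stronglyMeasurable_feature_gKernel H T).measurable
  have hη := integrable_testFunction η
  have hηm : Measurable η := η.contDiff.continuous.measurable
  -- integrability over `dq ⊗ dw ⊗ μ(dξ)`
  have hm : Measurable fun p : (ℝ × Space d) × (ℝ × Space d) =>
      η p.1 * inner ℝ (h p.2) (feature H T (gKernel p.1.1 p.1.2) p.2) :=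
    (hηm.comp measurable_fst).mul ((hhm.comp measurable_snd).inner hFm)
  have hfin : Integrable (Function.uncurry fun (q z : ℝ × Space d) =>
      η q * inner ℝ (h z) (feature H T (gKernel q.1 q.2) z))
      (volume.prod (spectralMeasure μ)) := by
    refine ⟨hm.aestronglyMeasurable, ?_⟩
    change ∫⁻ p : (ℝ × Space d) × (ℝ × Space d),
      ‖η p.1 * inner ℝ (h p.2) (feature H T (gKernel p.1.1 p.1.2) p.2)‖ₑ ∂_ < ∞
    rw [lintegral_prod _ hm.enorm.aemeasurable]
    have hb : ∫⁻ q, (‖h‖ₑ ^ 2 + C) * ‖η q‖ₑ < ∞ := by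
      rw [lintegral_const_mul' _ _ (by finiteness)]
      exact ENNReal.mul_lt_top (by finiteness) hη.2
    refine lt_of_le_of_lt (lintegral_mono fun q => ?_) hb
    simp only [enorm_mul]
    rw [lintegral_const_mul' _ _ enorm_ne_top, mul_comm]
    by_cases hq : q.1 ∈ Icc 0 T
    · gcongr
      calc ∫⁻ z, ‖inner ℝ (h z) (feature H T (gKernel q.1 q.2) z)‖ₑ ∂spectralMeasure μ
          ≤ ∫⁻ z, (‖h z‖ₑ ^ 2 + ‖feature H T (gKernel q.1 q.2) z‖ₑ ^ 2) ∂spectralMeasure μ := by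
            refine lintegral_mono fun z => le_trans ?_ (ennreal_mul_le_sq_add_sq _ _)
            rw [← ofReal_norm, ← ofReal_norm, ← ofReal_norm, ← ENNReal.ofReal_mul (norm_nonneg _)]
            exact ENNReal.ofReal_le_ofReal (norm_inner_le_norm _ _)
        _ = ‖h‖ₑ ^ 2 + ‖embed μ H T (gKernel q.1 q.2)‖ₑ ^ 2 := by
            rw [lintegral_add_left (hhm.enorm.pow_const 2), enorm_sq_eq_lintegral h,
              enorm_embed_sq (hreg q hq)]
        _ ≤ ‖h‖ₑ ^ 2 + C := by
            gcongr
            exact enorm_embed_gKernel_sq_le (hE q.1 hq q.2)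
    · rw [testFunction_eq_zero η fun h => hq ⟨h.1.le, h.2.le⟩]
      simp
  have hintA : Integrable (fun p : (ℝ × Space d) × Ω => X p.1 p.2 * η p.1)
      (volume.prod (P.restrict A)) := by
    have := hint.restrict (s := univ ×ˢ A)
    rwa [← Measure.prod_restrict, Measure.restrict_univ] at this
  have e1 : ∫ ω in A, (∫ q, X q ω * η q) ∂P = ∫ q, ∫ ω in A, X q ω * η q ∂P :=
    (integral_integral_swap (f := fun q ω => X q ω * η q) hintA).symm
  have e2 : ∀ q, ∫ ω in A, X q ω * η q ∂P =
      ∫ z, η q * inner ℝ (h z) (feature H T (gKernel q.1 q.2) z) ∂spectralMeasure μ := by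
    intro q
    rw [integral_mul_const, integral_const_mul, mul_comm]
    by_cases hq : q.1 ∈ Icc 0 T
    · congr 1
      rw [integral_congr_ae (ae_restrict_of_ae (hXV q hq)), hh, L2.inner_def]
      refine integral_congr_ae ?_
      filter_upwards [embed_coeFn (hreg q hq)] with z hz
      rw [hz]
    · rw [testFunction_eq_zero η fun h => hq ⟨h.1.le, h.2.le⟩]
      simp
  have e3 : ∀ z, ∫ q, η q * inner ℝ (h z) (feature H T (gKernel q.1 q.2) z) =
      inner ℝ (h z) (feature H T (convReflected η) z) := by
    intro z
    have hi : Integrable fun q : ℝ × Space d => (η q : ℂ) * feature H T (gKernel q.1 q.2) z :=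
      hη.ofReal.mul_bdd (continuous_feature_gKernel hH T z).aestronglyMeasurable
        (Eventually.of_forall fun q => norm_feature_gKernel_le hH T q.1 q.2 z)
    rw [feature_convReflected hH, ← integral_inner hi]
    refine integral_congr_ae (Eventually.of_forall fun q => ?_)
    simp only
    rw [← Complex.real_smul, inner_smul_right]
  rw [hh, e1]
  simp_rw [e2]
  rw [integral_integral_swap hfin]
  simp_rw [e3]
  rw [L2.inner_def]
  refine integral_congr_ae ?_
  filter_upwards [embed_coeFn (isRegular_convReflected hH hH' hT η)] with z hz
  rw [hz]

/-- There is a jointly measurable version of `u(t, x) = B(g_{tx})`. -/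
theorem exists_measurable_process [IsProbabilityMeasure P] [SFinite μ] (hT : 0 < T)
    (hE : ∀ t ∈ Icc 0 T, ∀ x : Space d,
      ∫⁻ z, absFeature H T (gKernel t x) z ^ 2 ∂spectralMeasure μ ≤ C)
    (V : Lp ℂ 2 (spectralMeasure μ) →L[ℝ] Lp ℝ 2 P) :
    ∃ X : ℝ → Space d → Ω → ℝ,
      Measurable (fun p : Icc (0 : ℝ) T × Space d × Ω => X p.1 p.2.1 p.2.2) ∧
      ∀ t ∈ Icc 0 T, ∀ x, X t x =ᵐ[P] V (embed μ H T (gKernel t x)) := by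
  have : Fact ((2 : ℝ≥0∞) ≠ ∞) := ⟨by norm_num⟩
  -- The spectral `L²` space is separable, and the distance of `g_{tx}` from each member of a dense
  -- sequence is a measurable function of `(t, x)`.
  let y := TopologicalSpace.denseSeq (Lp ℂ 2 (spectralMeasure μ))
  have hreg : ∀ s : Icc (0 : ℝ) T × Space d, IsRegular μ H T (gKernel s.1 s.2) := fun s =>
    isRegular_gKernel ((hE s.1 s.1.2 s.2).trans_lt ENNReal.coe_lt_top)
  have hdist : ∀ k, Measurable fun s : Icc (0 : ℝ) T × Space d =>
      ‖embed μ H T (gKernel s.1 s.2) - y k‖ₑ := by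
    intro k
    have e : ∀ s : Icc (0 : ℝ) T × Space d, ‖embed μ H T (gKernel s.1 s.2) - y k‖ₑ =
        (∫⁻ z, ‖feature H T (gKernel s.1 s.2) z - y k z‖ₑ ^ 2 ∂spectralMeasure μ) ^
          (1 / 2 : ℝ) := by
      intro s
      have h1 : ‖embed μ H T (gKernel s.1 s.2) - y k‖ₑ ^ 2 =
          ∫⁻ z, ‖feature H T (gKernel s.1 s.2) z - y k z‖ₑ ^ 2 ∂spectralMeasure μ := by
        rw [enorm_sq_eq_lintegral]
        refine lintegral_congr_ae ?_
        filter_upwards [Lp.coeFn_sub (embed μ H T (gKernel s.1 s.2)) (y k), embed_coeFn (hreg s)]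
          with z hz hz'
        rw [hz, Pi.sub_apply, hz']
      rw [← h1, ← ENNReal.rpow_natCast, ← ENNReal.rpow_mul]
      norm_num
    simp_rw [e]
    have h2 : Measurable fun p : (Icc (0 : ℝ) T × Space d) × (ℝ × Space d) =>
        ‖feature H T (gKernel p.1.1 p.1.2) p.2 - y k p.2‖ₑ ^ 2 := by
      have h3 := (stronglyMeasurable_feature_gKernel (d := d) H T).measurable.comp
        (by fun_prop : Measurable fun p : (Icc (0 : ℝ) T × Space d) × (ℝ × Space d) =>
          (((p.1.1 : ℝ), p.1.2), p.2))
      exact (h3.sub ((Lp.stronglyMeasurable (y k)).measurable.comp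
        measurable_snd)).enorm.pow_const 2
    exact h2.lintegral_prod_right'.pow_const _
  obtain ⟨X, hXm, hX⟩ := exists_measurable_modification (P := P)
    (fun s : Icc (0 : ℝ) T × Space d => V (embed μ H T (gKernel s.1 s.2))) (fun k => V (y k))
    (fun k s => ‖V‖ₑ * ‖embed μ H T (gKernel s.1 s.2) - y k‖ₑ) (fun k => (hdist k).const_mul _)
    (fun k s => by
      rw [← map_sub]
      exact V.le_opENorm _)
    (fun s ε hε => by
      have hc : Continuous fun a => ‖V‖ₑ * ‖embed μ H T (gKernel s.1 s.2) - a‖ₑ :=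
        (ENNReal.continuous_const_mul enorm_ne_top).comp (by fun_prop)
      obtain ⟨k, hk⟩ := (TopologicalSpace.denseRange_denseSeq _).exists_mem_open
        (isOpen_Iio.preimage hc) ⟨embed μ H T (gKernel s.1 s.2), by simpa using hε⟩
      exact ⟨k, hk⟩)
  refine ⟨fun t x => X (projIcc 0 T hT.le t, x), ?_, fun t ht x => ?_⟩
  · simp only [projIcc_val]
    exact hXm.comp (by fun_prop : Measurable fun p : Icc (0 : ℝ) T × Space d × Ω =>
      ((p.1, p.2.1), p.2.2))
  · simp only [projIcc_of_mem hT.le ht]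
    exact hX (⟨t, ht⟩, x)

/-- If the energies of the kernels `g_{tx}` are bounded, then there is a version of `B(g_{tx})` that
represents the distribution-valued solution. -/
theorem exists_represents [IsProbabilityMeasure P] [SFinite μ] [μ.HasTemperateGrowth]
    (hH : 1 / 2 < H) (hH' : H < 1) (hT : 0 < T)
    (hE : ∀ t ∈ Icc 0 T, ∀ x : Space d,
      ∫⁻ z, absFeature H T (gKernel t x) z ^ 2 ∂spectralMeasure μ ≤ C)
    (V : Lp ℂ 2 (spectralMeasure μ) →L[ℝ] Lp ℝ 2 P) {u : 𝓓(domain d T, ℝ) → Ω → ℝ}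
    (hu : ∀ η, u η =ᵐ[P] V (embed μ H T (convReflected η))) :
    ∃ X : ℝ → Space d → Ω → ℝ, Represents P u X ∧
      ∀ t ∈ Icc 0 T, ∀ x, X t x =ᵐ[P] V (embed μ H T (gKernel t x)) := by
  obtain ⟨X, hXm, hX⟩ := exists_measurable_process hT hE V
  have hbd : ∀ t ∈ Icc 0 T, ∀ x, eLpNorm (X t x) 2 P ≤ (‖V‖₊ * (C + 1) : ℝ≥0) := by
    intro t ht x
    have h1 := enorm_embed_gKernel_sq_le (hE t ht x)
    have h2 : ‖embed μ H T (gKernel t x)‖ₑ ≤ C + 1 := by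
      rcases le_total ‖embed μ H T (gKernel t x)‖ₑ 1 with h | h
      · exact h.trans le_add_self
      · refine (le_trans ?_ h1).trans le_self_add
        rw [sq]
        exact le_mul_of_one_le_right bot_le h
    rw [eLpNorm_congr_ae (hX t ht x), ← Lp.enorm_def]
    refine (V.le_opENorm _).trans ?_
    push_cast
    exact mul_le_mul_right h2 _
  have hbq : ∀ q : ℝ × Space d, eLpNorm (extendTime hT.le X q) 2 P ≤ (‖V‖₊ * (C + 1) : ℝ≥0) :=
    fun q => hbd _ (projIcc 0 T hT.le q.1).2 _
  have hm := measurable_extendTime hT.le hXm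
  refine ⟨X, ⟨hXm, fun K _ => ⟨_, fun t ht x _ => hbd t ht x⟩, fun η => ?_⟩, hX⟩
  have hint := integrable_process_mul (K := univ) hm (fun q _ => hbq q)
    (integrable_testFunction η) (fun q hq => absurd (mem_univ _) hq)
  have hXV : ∀ q : ℝ × Space d, q.1 ∈ Icc 0 T →
      extendTime hT.le X q =ᵐ[P] V (embed μ H T (gKernel q.1 q.2)) := fun q hq => by
    rw [extendTime_of_mem hT.le X hq]
    exact hX q.1 hq q.2
  filter_upwards [hu η, clm_convReflected_ae_eq hH hH' hT hE V hXV η hint,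
    ae_iterated_integral_eq hT hm (fun K _ => ⟨_, fun q _ => hbq q⟩) η] with ω h1 h2 h3
  rw [h1, h2, h3]

end Energy

end Construction

/-! ### Uniqueness of the process solution -/

section Uniqueness

/-- Measurable rectangles are a `π`-system that generates the product `σ`-algebra. -/
theorem ae_eq_zero_of_forall_setIntegral_prod_eq_zero {α β : Type*} [MeasurableSpace α]
    [MeasurableSpace β] {ρ : Measure (α × β)} {f : α × β → ℝ} (hf : Integrable f ρ)
    (h : ∀ s t, MeasurableSet s → MeasurableSet t → ∫ p in s ×ˢ t, f p ∂ρ = 0) : f =ᵐ[ρ] 0 := by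
  refine hf.ae_eq_zero_of_forall_setIntegral_eq_zero fun S hS hfin => ?_
  clear hfin
  induction S, hS using MeasurableSpace.induction_on_inter generateFrom_prod.symm
    isPiSystem_prod with
  | empty => simp
  | basic S hS =>
    obtain ⟨s, hs, t, ht, rfl⟩ := hS
    exact h s t hs ht
  | compl S hS ih =>
    have h1 := integral_add_compl hS hf
    have h2 := h univ univ MeasurableSet.univ MeasurableSet.univ
    rw [univ_prod_univ, setIntegral_univ] at h2
    linarith
  | iUnion S hd hS ih =>
    rw [integral_iUnion hS hd hf.integrableOn]
    simp [ih]

variable {d : ℕ} {T : ℝ} {Ω : Type*} [MeasurableSpace Ω] {P : Measure Ω}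

/-- Two processes that represent the same distribution-valued process agree: their difference has
integral zero over products of a set in space-time and an event. -/
theorem Represents.ae_unique [IsProbabilityMeasure P] (hT : 0 < T)
    {u : 𝓓(domain d T, ℝ) → Ω → ℝ} {X X' : ℝ → Space d → Ω → ℝ} (h : Represents P u X)
    (h' : Represents P u X') :
    ∀ᵐ q : ℝ × Space d ∂volume.restrict (Icc 0 T ×ˢ univ), X q.1 q.2 =ᵐ[P] X' q.1 q.2 := by
  have hXm := measurable_extendTime hT.le h.measurable
  have hXm' := measurable_extendTime hT.le h'.measurable
  let D : ℝ × Space d → Ω → ℝ := fun q ω => extendTime hT.le X q ω - extendTime hT.le X' q ω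
  have key : ∀ n : ℕ, ∀ᵐ q ∂volume.restrict (Ioo 0 T ×ˢ Metric.ball (0 : Space d) n),
      ∀ᵐ ω ∂P, D q ω = 0 := by
    intro n
    set U : Set (ℝ × Space d) := Ioo 0 T ×ˢ Metric.ball (0 : Space d) n with hU
    have hUo : IsOpen U := isOpen_Ioo.prod Metric.isOpen_ball
    have hUv : volume U ≠ ∞ := by
      rw [hU, Measure.volume_eq_prod, Measure.prod_prod]
      exact (ENNReal.mul_lt_top measure_Ioo_lt_top measure_ball_lt_top).ne
    let K := Metric.closedBall (0 : Space d) n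
    obtain ⟨C, hC⟩ := h.exists_extendTime_bound hT.le (isCompact_closedBall (0 : Space d) n)
    obtain ⟨C', hC'⟩ := h'.exists_extendTime_bound hT.le (isCompact_closedBall (0 : Space d) n)
    have hDmul : ∀ g : ℝ × Space d → ℝ, Integrable g → (∀ q, q.2 ∉ K → g q = 0) →
        Integrable (fun p : (ℝ × Space d) × Ω => D p.1 p.2 * g p.1) (volume.prod P) := by
      intro g hg hgK
      have h1 := (integrable_process_mul hXm hC hg hgK).sub
        (integrable_process_mul hXm' hC' hg hgK)
      refine h1.congr (Eventually.of_forall fun p => ?_)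
      simp only [Pi.sub_apply, D]
      ring
    have hDint : Integrable (fun p : (ℝ × Space d) × Ω => D p.1 p.2)
        ((volume.restrict U).prod P) := by
      have h1 := hDmul (U.indicator fun _ => 1)
        ((integrable_indicator_iff hUo.measurableSet).2 (integrableOn_const hUv))
        (fun q hq => indicator_of_notMem (fun hqU => hq (Metric.ball_subset_closedBall hqU.2)) _)
      have h2 : IntegrableOn (fun p : (ℝ × Space d) × Ω => D p.1 p.2) (U ×ˢ univ)
          (volume.prod P) := by
        rw [← integrable_indicator_iff (hUo.measurableSet.prod MeasurableSet.univ)]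
        refine h1.congr (Eventually.of_forall fun p => ?_)
        by_cases hp : p.1 ∈ U
        · rw [indicator_of_mem (show p ∈ U ×ˢ univ from ⟨hp, mem_univ _⟩)]
          simp [hp]
        · rw [indicator_of_notMem (show p ∉ U ×ˢ univ from fun hmem => hp hmem.1)]
          simp [hp]
      rwa [IntegrableOn, ← Measure.prod_restrict, Measure.restrict_univ] at h2
    -- For an event `A`, testing against smooth functions shows that `E (D q; A)` vanishes for
    -- almost every `q`; the exceptional set depends on `A`.
    have hA : ∀ A, MeasurableSet A → ∀ᵐ q ∂volume.restrict U, ∫ ω in A, D q ω ∂P = 0 := by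
      intro A hA
      rw [ae_restrict_iff' hUo.measurableSet]
      refine hUo.ae_eq_zero_of_integral_contDiff_smul_eq_zero ?_ fun g hgs hgc hgU => ?_
      · have h1 : Integrable (fun p : (ℝ × Space d) × Ω => D p.1 p.2)
            ((volume.restrict U).prod (P.restrict A)) := by
          have h2 := hDint.restrict (s := univ ×ˢ A)
          rwa [← Measure.prod_restrict, Measure.restrict_univ] at h2
        have h3 : IntegrableOn (fun q => ∫ ω in A, D q ω ∂P) U := h1.integral_prod_left
        exact h3.locallyIntegrableOn
      · let η : 𝓓(domain d T, ℝ) := ⟨g, hgs, hgc, fun q hq => ⟨(hgU hq).1, mem_univ _⟩⟩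
        have hgK : ∀ q, q.2 ∉ K → g q = 0 := fun q hq =>
          image_eq_zero_of_notMem_tsupport fun hmem =>
            hq (Metric.ball_subset_closedBall (hgU hmem).2)
        have hgi : Integrable g := integrable_testFunction η
        have hDg := hDmul g hgi hgK
        have hzero : ∀ᵐ ω ∂P, ∫ q, D q ω * g q = 0 := by
          filter_upwards [h.ae_eq_integral hT η, h'.ae_eq_integral hT η,
            (integrable_process_mul hXm hC hgi hgK).prod_left_ae,
            (integrable_process_mul hXm' hC' hgi hgK).prod_left_ae] with ω h1 h2 h3 h4
          have h5 : ∫ q, D q ω * g q = (∫ q, extendTime hT.le X q ω * g q) -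
              ∫ q, extendTime hT.le X' q ω * g q := by
            rw [← integral_sub h3 h4]
            refine integral_congr_ae (Eventually.of_forall fun q => ?_)
            simp only [D]
            ring
          rw [h5, sub_eq_zero]
          exact h1.symm.trans h2
        have hDgA : Integrable (fun p : (ℝ × Space d) × Ω => D p.1 p.2 * g p.1)
            (volume.prod (P.restrict A)) := by
          have h2 := hDg.restrict (s := univ ×ˢ A)
          rwa [← Measure.prod_restrict, Measure.restrict_univ] at h2
        calc ∫ q, g q • ∫ ω in A, D q ω ∂P = ∫ q, ∫ ω in A, D q ω * g q ∂P := by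
              refine integral_congr_ae (Eventually.of_forall fun q => ?_)
              simp only
              rw [integral_mul_const, smul_eq_mul, mul_comm]
          _ = ∫ ω in A, (∫ q, D q ω * g q) ∂P :=
              integral_integral_swap (f := fun q ω => D q ω * g q) hDgA
          _ = 0 := by
              rw [integral_congr_ae (ae_restrict_of_ae hzero)]
              simp
    -- Integration over rectangles removes this dependence.
    have h0 : (fun p : (ℝ × Space d) × Ω => D p.1 p.2) =ᵐ[(volume.restrict U).prod P] 0 := by
      refine ae_eq_zero_of_forall_setIntegral_prod_eq_zero hDint fun s t hs ht => ?_
      rw [setIntegral_prod _ hDint.integrableOn]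
      rw [integral_congr_ae (ae_restrict_of_ae (hA t ht))]
      simp
    exact Measure.ae_ae_of_ae_prod h0
  rw [ae_restrict_iff' (measurableSet_Icc.prod MeasurableSet.univ)]
  have key' : ∀ᵐ q : ℝ × Space d, ∀ n : ℕ, q ∈ Ioo 0 T ×ˢ Metric.ball (0 : Space d) n →
      ∀ᵐ ω ∂P, D q ω = 0 := by
    rw [ae_all_iff]
    intro n
    exact (ae_restrict_iff' (measurableSet_Ioo.prod measurableSet_ball)).1 (key n)
  have hne : ∀ a : ℝ, ∀ᵐ q : ℝ × Space d, q.1 ≠ a := fun a =>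
    Measure.quasiMeasurePreserving_fst.ae (Measure.ae_ne volume a)
  filter_upwards [key', hne 0, hne T] with q hq h0 hTq hmem
  obtain ⟨n, hn⟩ := exists_nat_gt ‖q.2‖
  have hq1 := hq n ⟨⟨lt_of_le_of_ne hmem.1.1 h0.symm, lt_of_le_of_ne hmem.1.2 hTq⟩,
    mem_ball_zero_iff.2 hn⟩
  filter_upwards [hq1] with ω hω
  simp only [D, extendTime_of_mem hT.le _ hmem.1] at hω
  linarith

end Uniqueness

/-! ### Necessity of the condition on the Hurst index -/

section Necessity

/-- Jensen's inequality for the square of a weighted average. -/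
theorem enorm_integral_mul_sq_le {α : Type*} [MeasurableSpace α] {ρ : Measure α} {F g : α → ℝ}
    (hF : Measurable F) (hg : Measurable g) (hg0 : ∀ a, 0 ≤ g a)
    (hg1 : ∫⁻ a, ENNReal.ofReal (g a) ∂ρ = 1) :
    ‖∫ a, F a * g a ∂ρ‖ₑ ^ 2 ≤ ∫⁻ a, ENNReal.ofReal (g a) * ‖F a‖ₑ ^ 2 ∂ρ := by
  let m := ρ.withDensity fun a => ENNReal.ofReal (g a)
  have : IsProbabilityMeasure m := ⟨by simp [m, withDensity_apply, hg1]⟩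
  have h1 : ‖∫ a, F a * g a ∂ρ‖ₑ ≤ eLpNorm F 2 m := by
    refine le_trans ?_ (lintegral_enorm_le_eLpNorm_two (P := m) hF.aestronglyMeasurable)
    refine (enorm_integral_le_lintegral_enorm _).trans (le_of_eq ?_)
    rw [lintegral_withDensity_eq_lintegral_mul _ hg.ennreal_ofReal hF.enorm]
    refine lintegral_congr fun a => ?_
    rw [enorm_mul, mul_comm, Pi.mul_apply, Real.enorm_of_nonneg (hg0 a)]
  refine (pow_le_pow_left' h1 2).trans (le_of_eq ?_)
  rw [eLpNorm_two_sq, lintegral_withDensity_eq_lintegral_mul _ hg.ennreal_ofReal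
    (hF.enorm.pow_const 2)]
  rfl

variable {d : ℕ} {T : ℝ} {Ω : Type*} [MeasurableSpace Ω] {P : Measure Ω}

/-- There are smooth probability densities with support in `(0, T) × ℝ^d` that concentrate at the
point `(T, 0)`. -/
theorem exists_testFunction_concentrating (hT : 0 < T) :
    ∃ η : ℕ → 𝓓(domain d T, ℝ), (∀ n q, 0 ≤ η n q) ∧ (∀ n, ∫ q, η n q = 1) ∧
      ∀ (n : ℕ) q, 3 * T / (4 * ((n : ℝ) + 1)) < dist q (T, (0 : Space d)) → η n q = 0 := by
  -- The ball with centre `(T - 2r, 0)` and radius `r` lies in `(0, T) × ℝ^d` if `3r < T`.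
  let r : ℕ → ℝ := fun n => T / (4 * (n + 1))
  have hr : ∀ n, 0 < r n := fun n => by positivity
  have hrT : ∀ n, 3 * r n < T := fun n => by
    have : r n ≤ T / 4 := by
      simp only [r]
      gcongr
      linarith [n.cast_nonneg (α := ℝ)]
    linarith
  let φ : (n : ℕ) → ContDiffBump ((T - 2 * r n, 0) : ℝ × Space d) := fun n =>
    ⟨r n / 2, r n, half_pos (hr n), half_lt_self (hr n)⟩
  have hsupp : ∀ n, tsupport ((φ n).normed volume) =
      Metric.closedBall ((T - 2 * r n, 0) : ℝ × Space d) (r n) := fun n =>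
    (φ n).tsupport_normed_eq
  have habs : ∀ n (q : ℝ × Space d), q ∈ Metric.closedBall ((T - 2 * r n, 0) : ℝ × Space d) (r n) →
      |q.1 - (T - 2 * r n)| ≤ r n := fun n q hq => (le_max_left _ _).trans hq
  refine ⟨fun n => ⟨(φ n).normed volume, (φ n).contDiff_normed, (φ n).hasCompactSupport_normed,
    fun q hq => ?_⟩, fun n q => (φ n).nonneg_normed q, fun n => (φ n).integral_normed, ?_⟩
  · rw [hsupp] at hq
    have h1 := abs_le.1 (habs n q hq)
    exact ⟨⟨by linarith [h1.1, hrT n], by linarith [h1.2, hr n]⟩, mem_univ _⟩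
  · intro n q hq
    refine image_eq_zero_of_notMem_tsupport (f := (φ n).normed volume) fun hmem => ?_
    rw [hsupp, Metric.mem_closedBall] at hmem
    have h1 : dist ((T - 2 * r n, 0) : ℝ × Space d) (T, 0) ≤ 2 * r n := by
      rw [Prod.dist_eq, dist_self, Real.dist_eq, sub_sub_cancel_left, abs_neg,
        abs_of_pos (by linarith [hr n])]
      exact max_le le_rfl (by linarith [hr n])
    have h2 := dist_triangle q (T - 2 * r n, 0) (T, (0 : Space d))
    have h3 : 3 * T / (4 * (n + 1)) = 3 * r n := by
      simp only [r]
      ring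
    linarith

/-- A representing process forces the energy of `g_{T0}` to be finite: `u(η)` is bounded in mean
square along test functions concentrating at `(T, 0)`, and Fatou's lemma applies. -/
theorem Represents.lintegral_absFeature_lt_top [IsProbabilityMeasure P] {μ : Measure (Space d)}
    [SFinite μ] [μ.HasTemperateGrowth] {H : ℝ} (hH : 1 / 2 < H) (hH' : H < 1) (hT : 0 < T)
    {V : Lp ℂ 2 (spectralMeasure μ) →L[ℝ] Lp ℝ 2 P} {u : 𝓓(domain d T, ℝ) → Ω → ℝ}
    (hu : ∀ η, u η =ᵐ[P] V (embed μ H T (convReflected η)))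
    (hV : ∀ η : 𝓓(domain d T, ℝ), ‖V (embed μ H T (convReflected η))‖ =
      ‖embed μ H T (convReflected η)‖)
    {X : ℝ → Space d → Ω → ℝ} (h : Represents P u X) :
    ∫⁻ z, absFeature H T (gKernel T (0 : Space d)) z ^ 2 ∂spectralMeasure μ < ∞ := by
  obtain ⟨η, hη0, hη1, hηd⟩ := exists_testFunction_concentrating (d := d) hT
  have hXm := measurable_extendTime hT.le h.measurable
  obtain ⟨C, hC⟩ := h.exists_extendTime_bound hT.le (isCompact_closedBall (0 : Space d) T)
  have hηm : ∀ n, Measurable (η n) := fun n => (η n).contDiff.continuous.measurable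
  have hη1' : ∀ n, ∫⁻ q, ENNReal.ofReal (η n q) = 1 := fun n => by
    rw [← ofReal_integral_eq_lintegral_ofReal (integrable_testFunction (η n))
      (Eventually.of_forall (hη0 n)), hη1, ENNReal.ofReal_one]
  -- `E |u(η n)|² ≤ sup E |X|²` by Jensen's inequality
  have hbound : ∀ n, ∫⁻ z, ‖feature H T (convReflected (η n)) z‖ₑ ^ 2 ∂spectralMeasure μ ≤
      (C : ℝ≥0∞) ^ 2 := by
    intro n
    have e1 : ‖embed μ H T (convReflected (η n))‖ₑ = ‖V (embed μ H T (convReflected (η n)))‖ₑ := by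
      rw [← ofReal_norm, ← ofReal_norm, hV]
    rw [← enorm_embed_sq (isRegular_convReflected hH hH' hT (η n)), e1, enorm_sq_eq_lintegral]
    calc ∫⁻ ω, ‖V (embed μ H T (convReflected (η n))) ω‖ₑ ^ 2 ∂P
        = ∫⁻ ω, ‖∫ q, extendTime hT.le X q ω * η n q‖ₑ ^ 2 ∂P := by
          refine lintegral_congr_ae ?_
          filter_upwards [hu (η n), h.ae_eq_integral hT (η n)] with ω h1 h2
          rw [← h1, h2]
      _ ≤ ∫⁻ ω, ∫⁻ q, ENNReal.ofReal (η n q) * ‖extendTime hT.le X q ω‖ₑ ^ 2 ∂volume ∂P :=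
          lintegral_mono fun ω => enorm_integral_mul_sq_le
            (hXm.comp measurable_prodMk_right) (hηm n) (hη0 n) (hη1' n)
      _ = ∫⁻ q, ∫⁻ ω, ENNReal.ofReal (η n q) * ‖extendTime hT.le X q ω‖ₑ ^ 2 ∂P := by
          refine lintegral_lintegral_swap (Measurable.aemeasurable ?_)
          exact ((hηm n).comp measurable_snd).ennreal_ofReal.mul
            ((hXm.comp measurable_swap).enorm.pow_const 2)
      _ ≤ ∫⁻ q, ENNReal.ofReal (η n q) * (C : ℝ≥0∞) ^ 2 := by
          refine lintegral_mono fun q => ?_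
          rw [lintegral_const_mul' _ _ ENNReal.ofReal_ne_top, ← eLpNorm_two_sq]
          by_cases hq : q.2 ∈ Metric.closedBall (0 : Space d) T
          · gcongr
            exact hC q hq
          · rw [hηd n q]
            · simp
            · rw [Metric.mem_closedBall, not_le] at hq
              refine lt_of_lt_of_le ?_ (le_max_right _ _)
              refine lt_of_le_of_lt ?_ hq
              rw [div_le_iff₀ (by positivity)]
              nlinarith [n.cast_nonneg (α := ℝ)]
      _ = (C : ℝ≥0∞) ^ 2 := by
          rw [lintegral_mul_const _ (hηm n).ennreal_ofReal, hη1', one_mul]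
  -- The spectral representative of `η n * G̃` is an average of the continuous function
  -- `(t, x) ↦ feature H T (gKernel t x) z` with weights that concentrate at `(T, 0)`.
  have hlim : ∀ z, Tendsto (fun n => feature H T (convReflected (η n)) z) atTop
      (𝓝 (feature H T (gKernel T 0) z)) := by
    intro z
    have hc := continuous_feature_gKernel hH (d := d) T z
    rw [Metric.tendsto_atTop]
    intro ε hε
    obtain ⟨δ, hδ, hδε⟩ := Metric.continuous_iff.1 hc (T, 0) (ε / 2) (half_pos hε)
    obtain ⟨m, hm⟩ := exists_nat_gt (3 * T / (4 * δ))
    refine ⟨m, fun n hn => ?_⟩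
    have hnδ : 3 * T / (4 * (n + 1)) < δ := by
      have h1 : (m : ℝ) ≤ n := by exact_mod_cast hn
      rw [div_lt_iff₀ (by positivity)] at hm ⊢
      nlinarith
    have hi : Integrable fun q : ℝ × Space d => (η n q : ℂ) * feature H T (gKernel q.1 q.2) z :=
      (integrable_testFunction (η n)).ofReal.mul_bdd hc.aestronglyMeasurable
        (Eventually.of_forall fun q => norm_feature_gKernel_le hH T q.1 q.2 z)
    have hi' : Integrable fun q : ℝ × Space d =>
        (η n q : ℂ) * feature H T (gKernel T (0 : Space d)) z :=
      (integrable_testFunction (η n)).ofReal.mul_const _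
    have e0 : feature H T (gKernel T 0) z =
        ∫ q, (η n q : ℂ) * feature H T (gKernel T (0 : Space d)) z := by
      rw [integral_mul_const, integral_complex_ofReal, hη1]
      simp
    rw [dist_eq_norm, feature_convReflected hH, e0, ← integral_sub hi hi']
    refine lt_of_le_of_lt (norm_integral_le_of_norm_le
      ((integrable_testFunction (η n)).mul_const (ε / 2)) (Eventually.of_forall fun q => ?_)) ?_
    · rw [← mul_sub, norm_mul, Complex.norm_real, Real.norm_of_nonneg (hη0 n q)]
      by_cases hq : dist q (T, (0 : Space d)) < δ
      · refine mul_le_mul_of_nonneg_left ?_ (hη0 n q)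
        rw [← dist_eq_norm]
        exact (hδε q hq).le
      · rw [hηd n q (hnδ.trans_le (not_lt.1 hq)), zero_mul, zero_mul]
    · rw [integral_mul_const, hη1]
      linarith
  calc ∫⁻ z, absFeature H T (gKernel T (0 : Space d)) z ^ 2 ∂spectralMeasure μ
      = ∫⁻ z, liminf (fun n => ‖feature H T (convReflected (η n)) z‖ₑ ^ 2) atTop
          ∂spectralMeasure μ := by
        refine lintegral_congr fun z => ?_
        rw [← enorm_feature_gKernel hH]
        exact (ENNReal.Tendsto.pow (n := 2) (hlim z).enorm).liminf_eq.symm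
    _ ≤ liminf (fun n => ∫⁻ z, ‖feature H T (convReflected (η n)) z‖ₑ ^ 2 ∂spectralMeasure μ)
          atTop := by
        refine lintegral_liminf_le fun n => ?_
        exact (stronglyMeasurable_feature H T
          (contDiff_convReflected (η n)).continuous.measurable).measurable.enorm.pow_const 2
    _ ≤ (C : ℝ≥0∞) ^ 2 := by
        refine (liminf_le_liminf (Eventually.of_forall hbound)).trans (le_of_eq ?_)
        exact liminf_const _
    _ < ∞ := by finiteness

end Necessity

end FracHeat

end

theorem mainTheorem1 {d : ℕ} (hd : 0 < d) {T H : ℝ} (hT : 0 < T) (hH : 1 / 2 < H) (hH' : H < 1)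
    (f : 𝓢(FracHeat.Space d, ℝ) →L[ℝ] ℝ) (hf : FracHeat.IsSpatialCovariance f)
    {α A Bf C : ℝ} (hα : α < d) (hA : 0 < A) (hBf : 0 < Bf) (hC : 0 < C)
    (hI : ∀ t ∈ Icc 0 T, ∀ s ∈ Ico 0 t, ∀ r ∈ Ico 0 t, ∀ x : FracHeat.Space d,
      A * (2 * t - s - r) ^ (-((d - α) / 2)) ≤ FracHeat.Iform f t x r s ∧
      FracHeat.Iform f t x r s ≤ Bf * (2 * t - r - s) ^ (-((d - α) / 2)))
    (hJ : ∀ u ∈ Ioc 0 T, ∀ v ∈ Ioc 0 T, ∀ y z : FracHeat.Space d,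
      FracHeat.Jform f u v y z ≤ C * (u + v) ^ (-((d - α) / 2)))
    {Ω : Type*} [MeasurableSpace Ω] (P : Measure Ω) [IsProbabilityMeasure P]
    (B : 𝓓(FracHeat.domain d T, ℝ) → Ω → ℝ)
    (hB : FracHeat.IsFractionalColoredNoise f H T P B) :
    -- the distribution-valued solution `u(η) = B(η * G̃)` is well defined
    (∀ η : 𝓓(FracHeat.domain d T, ℝ), FracHeat.MemHP f H T (FracHeat.convReflected η)) ∧
    -- it is represented by a process if and only if `H > (d - α) / 4`
    ((∃ X : ℝ → FracHeat.Space d → Ω → ℝ,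
        FracHeat.Represents P (FracHeat.distributionSolution f H T P B) X) ↔
      H > (d - α) / 4) ∧
    -- in this case `u(t, x) = B(g_{tx})` is well defined, `X` can be chosen as a modification of
    -- it, and any representing `X` agrees almost surely with it at almost every `(t, x)`
    (H > (d - α) / 4 →
      (∀ t ∈ Icc 0 T, ∀ x : FracHeat.Space d, FracHeat.MemHP f H T (FracHeat.gKernel t x)) ∧
      (∃ X : ℝ → FracHeat.Space d → Ω → ℝ,
        FracHeat.Represents P (FracHeat.distributionSolution f H T P B) X ∧
        ∀ t ∈ Icc 0 T, ∀ x : FracHeat.Space d,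
          X t x =ᵐ[P] FracHeat.processSolution f H T P B t x) ∧
      (∀ X : ℝ → FracHeat.Space d → Ω → ℝ,
        FracHeat.Represents P (FracHeat.distributionSolution f H T P B) X →
        ∀ᵐ p : ℝ × FracHeat.Space d ∂volume.restrict (Icc 0 T ×ˢ univ),
          X p.1 p.2 =ᵐ[P] FracHeat.processSolution f H T P B p.1 p.2)) := by
  obtain ⟨μ, hμ, hfμ⟩ := hf
  have hfμ : FracHeat.IsFourierTransformOf f μ := hfμ
  have := FracHeat.isLocallyFiniteMeasure_of_temperate μ
  obtain ⟨V, hVB, hVn⟩ := hB.exists_clm hfμ hH hH' hT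
  have hregη := fun η : 𝓓(FracHeat.domain d T, ℝ) =>
    FracHeat.isRegular_convReflected (μ := μ) hH hH' hT η
  have hclη := fun η : 𝓓(FracHeat.domain d T, ℝ) =>
    FracHeat.embed_convReflected_mem_closure (μ := μ) hH hH' hT η
  have hu : ∀ η, FracHeat.distributionSolution f H T P B η =ᵐ[P]
      V (FracHeat.embed μ H T (FracHeat.convReflected η)) := fun η =>
    FracHeat.stochasticIntegral_ae_eq hfμ hH hH' hT hB hVB (hregη η) (hclη η)
  -- above the critical value the kernels `g_{tx}` have bounded energy
  have hsuff : H > (d - α) / 4 →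
      (∀ t ∈ Icc 0 T, ∀ x : FracHeat.Space d, FracHeat.MemHP f H T (FracHeat.gKernel t x)) ∧
      ∃ X : ℝ → FracHeat.Space d → Ω → ℝ,
        FracHeat.Represents P (FracHeat.distributionSolution f H T P B) X ∧
        ∀ t ∈ Icc 0 T, ∀ x : FracHeat.Space d,
          X t x =ᵐ[P] FracHeat.processSolution f H T P B t x := by
    intro hcrit
    obtain ⟨C₀, hE⟩ := FracHeat.exists_lintegral_absFeature_gKernel_le hfμ hH hH' hT
      (β := (d - α) / 2) (by linarith) (by linarith) fun t ht s hs r hr x => (hI t ht s hs r hr x).2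
    have hreg : ∀ t ∈ Icc 0 T, ∀ x : FracHeat.Space d,
        FracHeat.IsRegular μ H T (FracHeat.gKernel t x) := fun t ht x =>
      FracHeat.isRegular_gKernel ((hE t ht x).trans_lt ENNReal.coe_lt_top)
    have hcl := fun (t : ℝ) (ht : t ∈ Icc 0 T) (x : FracHeat.Space d) =>
      FracHeat.embed_gKernel_mem_closure hH hH' hT ht.2 (hreg t ht x)
    refine ⟨fun t ht x => FracHeat.memHP_of_mem_closure hfμ hH hH' hT (hreg t ht x)
      (hcl t ht x), ?_⟩
    obtain ⟨X, hX, hXV⟩ := FracHeat.exists_represents hH hH' hT hE V hu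
    exact ⟨X, hX, fun t ht x => (hXV t ht x).trans (FracHeat.stochasticIntegral_ae_eq hfμ hH hH' hT
      hB hVB (hreg t ht x) (hcl t ht x)).symm⟩
  refine ⟨fun η => FracHeat.memHP_of_mem_closure hfμ hH hH' hT (hregη η) (hclη η),
    ⟨fun ⟨X, hX⟩ => ?_, fun hcrit => (hsuff hcrit).2.imp fun X hX => hX.1⟩, fun hcrit => ?_⟩
  · by_contra hcrit
    have hfin := hX.lintegral_absFeature_lt_top hH hH' hT hu fun η => hVn _ (hclη η)
    refine hfin.ne (FracHeat.lintegral_absFeature_gKernel_eq_top hfμ hH hH' hT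
      (β := (d - α) / 2) hA (by linarith) 0 fun s hs r hr => ?_)
    exact (hI T ⟨hT.le, le_rfl⟩ s hs r hr 0).1
  · obtain ⟨hmem, X, hX, hXu⟩ := hsuff hcrit
    refine ⟨hmem, ⟨X, hX, hXu⟩, fun X' hX' => ?_⟩
    filter_upwards [hX'.ae_unique hT hX,
      ae_restrict_mem (measurableSet_Icc.prod MeasurableSet.univ)] with p hp hmem
    exact hp.trans (hXu p.1 hmem.1 p.2)
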